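/- Let $\mathbb K$ be a field of characteristic $0$ (e.g. $\mathbb R$ or $\mathbb C$). All vector spaces are finite-dimensional and $\mathbb Z$-graded, $V=\bigoplus_a V^a$; $V^*$ is graded by $(V^*)^{-a}=(V^a)^*$. Exterior powers are taken in the graded sense: an element of internal degree $a$ of $W=\Lambda^1W$ has total degree $a-1$, and all signs are Koszul signs with respect to the total degree. *$L_\infty$-quasi-bialgebras.* Let $B=\Lambda V^*\otimes\Lambda V$ with the big bracket, i.e. the bracket that extends the canonical pairing $[\xi,x]=\xi(x)$, $[x,\xi]=(-1)^a\xi(x)$ ($x\in V^a$, $\xi\in V^*$), $[V,V]=[V^*,V^*]=0$, is graded antisymmetric and satisfies the graded Leibniz rule. An element of $\Lambda^kV^*\otimes\Lambda^lV$ of internal degree $d$ has total degree $d+k+l-2$. An $L_\infty$-quasi-bialgebra structure on $V$ is a formal sum $S=\sum_{k,l\ge1}t_{kl}+\sum_{l\ge3}t_{0l}$, $t_{kl}\in\Lambda^kV^*\otimes\Lambda^lV$, of total degree $1$ with $[S,S]=0$ (in every component). *Manin $L_\infty$-quasi-triples.* An $L_\infty$-algebra is a graded space $\mathfrak g$ with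 brackets $\lambda_n:\Lambda^n\mathfrak g\to\mathfrak g[2-n]$, $n\ge1$, satisfying the generalized Jacobi identities $\sum\pm\lambda_{n-k+1}(\lambda_k(x_{\sigma(1)},\dots,x_{\sigma(k)}),x_{\sigma(k+1)},\dots,x_{\sigma(n)})=0$ for all $n$, where the sum is over all $1\le k\le n$ and all $(k,n-k)$-unshuffles $\sigma$, with their Koszul signs. A Manin $L_\infty$-quasi-triple $(\mathfrak g,\mathfrak g_+,\mathfrak g_-)$ is an $L_\infty$-algebra $\mathfrak g$ with a nondegenerate graded symmetric bilinear form of degree $0$ that is invariant, $$\langle\lambda_n(x_1,\dots,x_n),x_0\rangle=(-1)^{(|x_n|-1)(|x_0|-1)}\langle\lambda_n(x_1,\dots,x_{n-1},x_0),x_n\rangle ,$$ together with an isotropic graded $L_\infty$-subalgebra $\mathfrak g_+$ and a chosen graded Lagrangian complement $\mathfrak g_-$ of $\mathfrak g_+$. **Theorem.** The notions of an $L_\infty$-quasi-bialgebra and of a Manin $L_\infty$-quasi-triple with $\lambda_1(\mathfrak g_-)\subseteq\mathfrak g_-$ are equivalent. Precisely: 1. If $S$ is an $L_\infty$-quasi-bialgebra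 structure on $V$, there is exactly one Manin $L_\infty$-quasi-triple $D(S)=(V\oplus V^*,V,V^*)$ with the canonical pairing and with the brackets $\lambda_n(x_1,\dots,x_n)=[\cdots[[\sum_{k+l=n+1}t_{kl},x_1],x_2],\cdots,x_n]$, and it satisfies $\lambda_1(V^*)\subseteq V^*$. 2. For each Manin $L_\infty$-quasi-triple $(\mathfrak g,\mathfrak g_+,\mathfrak g_-)$ with $\lambda_1(\mathfrak g_-)\subseteq\mathfrak g_-$ there is exactly one $L_\infty$-quasi-bialgebra structure $S$ on $\mathfrak g_+$ for which there is an isomorphism of Manin $L_\infty$-quasi-triples from $(\mathfrak g,\mathfrak g_+,\mathfrak g_-)$ to $D(S)$ that is the identity on $\mathfrak g_+$. 3. More generally, if a term $t_{02}\in\Lambda^2V$ is allowed in $S$, then $S\mapsto D(S)$ is still defined, and every Manin $L_\infty$-quasi-triple, without any condition on $\lambda_1$, comes in the sense of 2 from exactly one such $S$ on $\mathfrak g_+$; for this $S$ one has $t_{02}=0$ if and only if $\lambda_1(\mathfrak g_-)\subseteq\mathfrak g_-$. 4. For $S$ on $V$ and $S'$ on $V'$ (with $t_{02}$ allowed), the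 isomorphisms of Manin $L_\infty$-quasi-triples $D(S)\to D(S')$ are exactly the maps $f\oplus(f^{-1})^*$, where $f:V\to V'$ is an isomorphism of graded vector spaces that carries $S$ to $S'$. (Isomorphisms of quasi-triples are linear isomorphisms that respect the gradings, the forms, both subspaces and all brackets.) -/

import Mathlib

set_option linter.unusedSectionVars false

universe u v w

noncomputable section

namespace LInf

/-- A `ℤ`-graded vector space: `V` is the internal direct sum of the subspaces `𝒱 d`. -/
class GradedSpace {K : Type u} [Field K] {V : Type v} [AddCommGroup V] [Module K V]
    (𝒱 : ℤ → Submodule K V) : Prop where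
  internal : DirectSum.IsInternal 𝒱

/-- The Koszul sign `(-1)^((a-1)(b-1))` for exchanging two elements of internal degrees `a`, `b`.
An element of internal degree `a` of `W = Λ¹ W` has total degree `a - 1`, and all signs in the
graded exterior algebra are the Koszul signs of the total degree.  So elements of internal
degree `0` anticommute. -/
def ksign (a b : ℤ) : ℤ := ((((a - 1) * (b - 1)).negOnePow : ℤˣ) : ℤ)

/-! ### L-infinity algebras and Manin L-infinity quasi-triples -/

/-- The Koszul sign of the unshuffle that moves the entries with index in `I` to the front. -/
def unshuffleSign {n : ℕ} (d : Fin n → ℤ) (I : Finset (Fin n)) : ℤ :=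
  ∏ i ∈ I, ∏ j ∈ Iᶜ.filter (fun j => j < i), ksign (d i) (d j)

/-- An `L_∞`-algebra on `W`: a grading and brackets `λ_n : Λⁿ W → W[2-n]`, `n ≥ 1`, with the
generalized Jacobi identities.  (`br 0 = 0` records that there is no `0`-ary bracket.) -/
structure LInftyAlgebra (K : Type u) [Field K] (W : Type v) [AddCommGroup W] [Module K W] where
  gr : ℤ → Submodule K W
  graded : GradedSpace gr
  br : ∀ n : ℕ, MultilinearMap K (fun _ : Fin n => W) W
  br_zero : br 0 = 0
  br_degree : ∀ (n : ℕ) (x : Fin n → W) (d : Fin n → ℤ), (∀ i, x i ∈ gr (d i)) →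
    br n x ∈ gr ((∑ i, d i) + 2 - n)
  br_swap : ∀ (n : ℕ) (x : Fin n → W) (d : Fin n → ℤ), (∀ i, x i ∈ gr (d i)) →
    ∀ i j : Fin n, (j : ℕ) = i + 1 →
      br n (x ∘ Equiv.swap i j) = ksign (d i) (d j) • br n x
  /-- The sum over all unshuffles, that is, over all sets `I` of indices of the inner bracket. -/
  jacobi : ∀ (n : ℕ) (x : Fin n → W) (d : Fin n → ℤ), (∀ i, x i ∈ gr (d i)) →
    ∑ I : Finset (Fin n), unshuffleSign d I •
      br (Iᶜ.card + 1) (Fin.cons (br I.card (fun i => x (I.orderEmbOfFin rfl i)))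
        (fun j => x (Iᶜ.orderEmbOfFin rfl j))) = 0

/-- A Manin `L_∞`-quasi-triple `(W, plus, minus)`: an `L_∞`-algebra `W` with a nondegenerate
invariant form, an isotropic `L_∞`-subalgebra `plus` and a Lagrangian complement `minus`. -/
structure ManinQuasiTriple (K : Type u) [Field K] (W : Type v) [AddCommGroup W] [Module K W]
    extends LInftyAlgebra K W where
  form : W →ₗ[K] W →ₗ[K] K
  form_degree : ∀ (a b : ℤ) (x y : W), x ∈ gr a → y ∈ gr b → a + b ≠ 0 → form x y = 0
  form_symm : ∀ (a b : ℤ) (x y : W), x ∈ gr a → y ∈ gr b →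
    form x y = (((a * b).negOnePow : ℤˣ) : ℤ) • form y x
  form_nondegenerate : form.Nondegenerate
  invariant : ∀ (n : ℕ) (x : Fin (n + 1) → W) (d : Fin (n + 1) → ℤ) (y : W) (e : ℤ),
    (∀ i, x i ∈ gr (d i)) → y ∈ gr e →
    form (br (n + 1) x) y = ksign (d (Fin.last n)) e •
      form (br (n + 1) (Function.update x (Fin.last n) y)) (x (Fin.last n))
  plus : Submodule K W
  plus_graded : plus ≤ ⨆ d, plus ⊓ gr d
  plus_isotropic : ∀ x ∈ plus, ∀ y ∈ plus, form x y = 0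
  plus_subalgebra : ∀ (n : ℕ) (x : Fin n → W), (∀ i, x i ∈ plus) → br n x ∈ plus
  minus : Submodule K W
  minus_graded : minus ≤ ⨆ d, minus ⊓ gr d
  minus_lagrangian : ∀ x, x ∈ minus ↔ ∀ y ∈ minus, form x y = 0
  isCompl : IsCompl plus minus

namespace ManinQuasiTriple

variable {K : Type u} [Field K] {W : Type v} [AddCommGroup W] [Module K W]

/-- The grading of the subalgebra `plus`. -/
def plusGr (T : ManinQuasiTriple K W) (d : ℤ) : Submodule K T.plus :=
  (T.gr d).comap T.plus.subtype

instance (T : ManinQuasiTriple K W) : GradedSpace T.plusGr where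
  internal := by
    rw [DirectSum.isInternal_submodule_iff_iSupIndep_and_iSup_eq_top]
    have hG := (DirectSum.isInternal_submodule_iff_iSupIndep_and_iSup_eq_top _).1 T.graded.internal
    have hmap : ∀ d, (T.plusGr d).map T.plus.subtype = T.plus ⊓ T.gr d := fun d => by
      rw [plusGr, Submodule.map_comap_subtype]
    constructor
    · rw [iSupIndep_def]
      intro i
      rw [Submodule.disjoint_def]
      intro x hx hx'
      have h1 : (x : W) ∈ (⨆ j, ⨆ (_ : j ≠ i), T.plusGr j).map T.plus.subtype :=
        Submodule.mem_map_of_mem hx'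
      simp only [Submodule.map_iSup, hmap] at h1
      have h2 : (⨆ j, ⨆ (_ : j ≠ i), T.plus ⊓ T.gr j) ≤ ⨆ j, ⨆ (_ : j ≠ i), T.gr j :=
        iSup₂_mono fun j _ => inf_le_right
      exact Subtype.ext (Submodule.disjoint_def.1 (iSupIndep_def.1 hG.1 i) x hx (h2 h1))
    · apply Submodule.map_injective_of_injective T.plus.injective_subtype
      rw [Submodule.map_iSup, Submodule.map_top, Submodule.range_subtype]
      simp only [hmap]
      exact le_antisymm (iSup_le fun d => inf_le_left) T.plus_graded

/-- The complement is a subcomplex: it is closed under the differential `λ_1`. -/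
def MinusClosed (T : ManinQuasiTriple K W) : Prop :=
  ∀ x ∈ T.minus, T.br 1 (fun _ => x) ∈ T.minus

/-- A (strict) isomorphism of Manin `L_∞`-quasi-triples. -/
structure IsIso {W' : Type w} [AddCommGroup W'] [Module K W']
    (T : ManinQuasiTriple K W) (T' : ManinQuasiTriple K W') (F : W →ₗ[K] W') : Prop where
  bijective : Function.Bijective F
  map_gr : ∀ d, (T.gr d).map F = T'.gr d
  map_plus : T.plus.map F = T'.plus
  map_minus : T.minus.map F = T'.minus
  map_form : ∀ x y, T'.form (F x) (F y) = T.form x y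
  map_br : ∀ (n : ℕ) (x : Fin n → W), F (T.br n x) = T'.br n (fun i => F (x i))

end ManinQuasiTriple

/-! ### The algebra `B = Λ V^* ⊗ Λ V` and the big bracket -/

section BigBracket

variable {K : Type u} [Field K] {V : Type v} [AddCommGroup V] [Module K V]

/-- The dual grading: `(V^*)_d` consists of the functionals vanishing on `V_b` for `b ≠ -d`. -/
def dualGr (𝒱 : ℤ → Submodule K V) (d : ℤ) : Submodule K (Module.Dual K V) where
  carrier := {ξ | ∀ b, b ≠ -d → ∀ x ∈ 𝒱 b, ξ x = 0}
  add_mem' h h' b hb x hx := by simp [h b hb x hx, h' b hb x hx]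
  zero_mem' b _ x _ := rfl
  smul_mem' c ξ h b hb x hx := by simp [h b hb x hx]

/-- The grading of `V ⊕ V^*`. -/
def dblGr (𝒱 : ℤ → Submodule K V) (d : ℤ) : Submodule K (V × Module.Dual K V) :=
  (𝒱 d).prod (dualGr 𝒱 d)

/-- Graded anticommutativity in the tensor algebra of `V ⊕ V^*`. -/
inductive ExtRel (𝒱 : ℤ → Submodule K V) :
    TensorAlgebra K (V × Module.Dual K V) → TensorAlgebra K (V × Module.Dual K V) → Prop
  | swap (a b : ℤ) (x y : V × Module.Dual K V) (hx : x ∈ dblGr 𝒱 a) (hy : y ∈ dblGr 𝒱 b) :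
      ExtRel 𝒱 (TensorAlgebra.ι K x * TensorAlgebra.ι K y)
        (ksign a b • (TensorAlgebra.ι K y * TensorAlgebra.ι K x))

/-- The ring congruence generated by graded anticommutativity. -/
def extCon (𝒱 : ℤ → Submodule K V) : RingCon (TensorAlgebra K (V × Module.Dual K V)) :=
  ringConGen (ExtRel 𝒱)

/-- The graded exterior algebra `B = Λ (V ⊕ V^*) = Λ V^* ⊗ Λ V`. -/
def BigAlg (𝒱 : ℤ → Submodule K V) : Type (max u v) := (extCon 𝒱).Quotient

instance (𝒱 : ℤ → Submodule K V) : Ring (BigAlg 𝒱) :=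
  inferInstanceAs (Ring (extCon 𝒱).Quotient)

instance (𝒱 : ℤ → Submodule K V) : Algebra K (BigAlg 𝒱) :=
  inferInstanceAs (Algebra K (extCon 𝒱).Quotient)

/-- The projection of the tensor algebra onto `B`. -/
def toB (𝒱 : ℤ → Submodule K V) : TensorAlgebra K (V × Module.Dual K V) →ₐ[K] BigAlg 𝒱 :=
  RingCon.mkₐ K (extCon 𝒱)

theorem toB_surjective (𝒱 : ℤ → Submodule K V) : Function.Surjective (toB 𝒱) :=
  Quotient.mk_surjective

/-- The inclusion of `V ⊕ V^*` into `B`. -/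
def gen (𝒱 : ℤ → Submodule K V) : V × Module.Dual K V →ₗ[K] BigAlg 𝒱 :=
  (toB 𝒱).toLinearMap ∘ₗ TensorAlgebra.ι K

/-- The component of `Λ^k V^* ⊗ Λ^l V ⊆ B` of internal degree `d`, spanned by the products
`ξ_1 ⋯ ξ_k x_1 ⋯ x_l` of homogeneous elements whose degrees add up to `d`. -/
def comp (𝒱 : ℤ → Submodule K V) (k l : ℕ) (d : ℤ) : Submodule K (BigAlg 𝒱) :=
  Submodule.span K {F | ∃ (ξ : Fin k → Module.Dual K V) (a : Fin k → ℤ)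
    (x : Fin l → V) (b : Fin l → ℤ), (∀ i, ξ i ∈ dualGr 𝒱 (a i)) ∧ (∀ j, x j ∈ 𝒱 (b j)) ∧
    (∑ i, a i) + (∑ j, b j) = d ∧
    F = (List.ofFn fun i => gen 𝒱 (0, ξ i)).prod * (List.ofFn fun j => gen 𝒱 (x j, 0)).prod}

theorem ksign_eq (a b : ℤ) : ksign a b = if Even a ∧ Even b then -1 else 1 := by
  unfold ksign
  split_ifs with h
  · rw [Int.negOnePow_odd]
    · rfl
    · exact (h.1.sub_odd odd_one).mul (h.2.sub_odd odd_one)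
  · rw [Int.negOnePow_even]
    · rfl
    · rw [Int.even_mul]
      by_contra hc
      rw [not_or, Int.not_even_iff_odd, Int.not_even_iff_odd] at hc
      exact h ⟨by simpa using hc.1.add_odd odd_one, by simpa using hc.2.add_odd odd_one⟩

theorem gen_mul_gen (𝒱 : ℤ → Submodule K V) {a b : ℤ} {x y : V × Module.Dual K V}
    (hx : x ∈ dblGr 𝒱 a) (hy : y ∈ dblGr 𝒱 b) :
    gen 𝒱 x * gen 𝒱 y = ksign a b • (gen 𝒱 y * gen 𝒱 x) := by
  have h : toB 𝒱 (TensorAlgebra.ι K x * TensorAlgebra.ι K y) =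
      toB 𝒱 (ksign a b • (TensorAlgebra.ι K y * TensorAlgebra.ι K x)) :=
    Quotient.sound (RingCon.le_ringConGen _ _ (ExtRel.swap a b x y hx hy))
  simpa [gen] using h

/-- The universal property of `B`. -/
def liftB (𝒱 : ℤ → Submodule K V) {A : Type w} [Ring A] [Algebra K A]
    (f : V × Module.Dual K V →ₗ[K] A)
    (hf : ∀ (a b : ℤ) (x y : V × Module.Dual K V), x ∈ dblGr 𝒱 a → y ∈ dblGr 𝒱 b →
      f x * f y = ksign a b • (f y * f x)) : BigAlg 𝒱 →ₐ[K] A :=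
  RingCon.liftₐ (extCon 𝒱) (TensorAlgebra.lift K f) (by
    refine RingCon.ringConGen_le.2 ?_
    rintro _ _ ⟨a, b, x, y, hx, hy⟩
    simpa using hf a b x y hx hy)

@[simp] theorem liftB_gen (𝒱 : ℤ → Submodule K V) {A : Type w} [Ring A] [Algebra K A]
    (f : V × Module.Dual K V →ₗ[K] A) (hf) (x : V × Module.Dual K V) :
    liftB 𝒱 f hf (gen 𝒱 x) = f x :=
  (RingCon.liftₐ_mk _ _ _ _).trans (TensorAlgebra.lift_ι_apply _ x)

/-- For an algebra endomorphism `s` of `B`, the algebra map `F ↦ (s F, D F; 0, F)` whose corner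
`D` satisfies `D (F G) = s F * D G + D F * G` and `D x = φ x` on generators. -/
def derHom (𝒱 : ℤ → Submodule K V) (s : BigAlg 𝒱 →ₐ[K] BigAlg 𝒱)
    (φ : V × Module.Dual K V →ₗ[K] K)
    (h : ∀ (a b : ℤ) (x y : V × Module.Dual K V), x ∈ dblGr 𝒱 a → y ∈ dblGr 𝒱 b →
      φ y • s (gen 𝒱 x) + φ x • gen 𝒱 y = ksign a b • (φ x • s (gen 𝒱 y) + φ y • gen 𝒱 x)) :
    BigAlg 𝒱 →ₐ[K] Matrix (Fin 2) (Fin 2) (BigAlg 𝒱) :=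
  liftB 𝒱
    { toFun := fun x => !![s (gen 𝒱 x), φ x • 1; 0, gen 𝒱 x]
      map_add' := fun x y => by simp [add_smul]
      map_smul' := fun c x => by simp [mul_smul] }
    (fun a b x y hx hy => by
      have h1 := gen_mul_gen 𝒱 hx hy
      have h2 := congrArg s h1
      rw [map_zsmul, map_mul, map_mul] at h2
      have h3 := h a b x y hx hy
      simp only [LinearMap.coe_mk, AddHom.coe_mk, Matrix.mul_fin_two]
      simp only [mul_zero, zero_mul, add_zero, h1, h2, mul_smul_comm, smul_mul_assoc,
        mul_one, one_mul, h3]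
      ext i j
      fin_cases i <;> fin_cases j <;> simp)

/-- The grading involution `x ↦ (-1)^d x` for `x ∈ V_d`. -/
def gradInv (𝒱 : ℤ → Submodule K V) [h : GradedSpace 𝒱] : V →ₗ[K] V :=
  letI := h.internal.chooseDecomposition
  (DirectSum.toModule K ℤ V fun d => ((d.negOnePow : ℤˣ) : ℤ) • (𝒱 d).subtype) ∘ₗ
    (DirectSum.decomposeLinearEquiv 𝒱).toLinearMap

variable (𝒱 : ℤ → Submodule K V) [GradedSpace 𝒱]

theorem gradInv_apply {d : ℤ} {x : V} (hx : x ∈ 𝒱 d) :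
    gradInv 𝒱 x = ((d.negOnePow : ℤˣ) : ℤ) • x := by
  let _ := (GradedSpace.internal (𝒱 := 𝒱)).chooseDecomposition
  unfold gradInv
  simp only [LinearMap.comp_apply, LinearEquiv.coe_coe, DirectSum.decomposeLinearEquiv_apply]
  rw [DirectSum.decompose_of_mem 𝒱 hx]
  erw [DirectSum.toModule_lof]
  rfl

/-- The canonical graded symmetric form on `V ⊕ V^*`: `⟨ξ, x⟩ = ξ x` and `⟨x, ξ⟩ = (-1)^d ξ x` for
`x ∈ V_d`.  It is graded antisymmetric for the total degree. -/
def pairing : (V × Module.Dual K V) →ₗ[K] (V × Module.Dual K V) →ₗ[K] K :=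
  LinearMap.mk₂ K (fun u w => u.2 w.1 + w.2 (gradInv 𝒱 u.1))
    (fun u u' w => by simp; ring) (fun c u w => by simp; ring)
    (fun u w w' => by simp; ring) (fun c u w => by simp; ring)

/-- The parity operator of the total degree on `V ⊕ V^*`: multiplication by `(-1)^(d-1)` in
internal degree `d`. -/
def parity : (V × Module.Dual K V) →ₗ[K] (V × Module.Dual K V) :=
  -((gradInv 𝒱).prodMap (gradInv 𝒱).dualMap)

theorem gradInv_dual {d : ℤ} {ξ : Module.Dual K V} (hξ : ξ ∈ dualGr 𝒱 d) :
    (gradInv 𝒱).dualMap ξ = ((d.negOnePow : ℤˣ) : ℤ) • ξ := by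
  have htop := (GradedSpace.internal (𝒱 := 𝒱)).submodule_iSup_eq_top
  ext x
  have hx : x ∈ ⨆ i, 𝒱 i := htop ▸ Submodule.mem_top
  induction hx using Submodule.iSup_induction' with
  | mem b x hx =>
    rw [LinearMap.dualMap_apply, gradInv_apply 𝒱 hx, map_zsmul, LinearMap.smul_apply]
    by_cases hb : b = -d
    · rw [hb, Int.negOnePow_neg]
    · rw [hξ b hb x hx, smul_zero, smul_zero]
  | zero => simp
  | add x y _ _ hx hy => rw [map_add, map_add, hx, hy]

theorem parity_apply {d : ℤ} {u : V × Module.Dual K V} (hu : u ∈ dblGr 𝒱 d) :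
    parity 𝒱 u = (((d - 1).negOnePow : ℤˣ) : ℤ) • u := by
  obtain ⟨x, ξ⟩ := u
  obtain ⟨hx, hξ⟩ := Submodule.mem_prod.1 hu
  rw [Int.negOnePow_sub, Int.negOnePow_one]
  simp [parity, gradInv_apply 𝒱 hx, gradInv_dual 𝒱 hξ]

/-- The parity automorphism of `B`. -/
def parityB : BigAlg 𝒱 →ₐ[K] BigAlg 𝒱 :=
  liftB 𝒱 (gen 𝒱 ∘ₗ parity 𝒱) (fun a b x y hx hy => by
    simp only [LinearMap.comp_apply, parity_apply 𝒱 hx, parity_apply 𝒱 hy, map_zsmul,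
      smul_mul_smul_comm, gen_mul_gen 𝒱 hx hy]
    rw [smul_comm, mul_comm (((a - 1).negOnePow : ℤˣ) : ℤ)])

theorem parity_even {d : ℤ} (hd : Even d) {u : V × Module.Dual K V} (hu : u ∈ dblGr 𝒱 d) :
    parity 𝒱 u = -u := by
  rw [parity_apply 𝒱 hu, Int.negOnePow_odd _ (hd.sub_odd odd_one)]
  simp

theorem parity_odd {d : ℤ} (hd : Odd d) {u : V × Module.Dual K V} (hu : u ∈ dblGr 𝒱 d) :
    parity 𝒱 u = u := by
  rw [parity_apply 𝒱 hu, Int.negOnePow_even _ (hd.sub_odd odd_one)]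
  simp

/-- The derivation `[w₀, ·]`, where `w₀` is the part of `w` of even total degree (in the upper right
corner). -/
def leftEven (w : V × Module.Dual K V) : BigAlg 𝒱 →ₐ[K] Matrix (Fin 2) (Fin 2) (BigAlg 𝒱) :=
  derHom 𝒱 (AlgHom.id K _)
    ((2 : K)⁻¹ • (pairing 𝒱 w + pairing 𝒱 w ∘ₗ parity 𝒱)) (by
    intro a b x y hx hy
    rw [ksign_eq]
    split_ifs with h
    · simp [parity_even 𝒱 h.1 hx, parity_even 𝒱 h.2 hy]
    · rw [one_smul, add_comm]
      rfl)

/-- The derivation `[w₁, ·]`, where `w₁` is the part of `w` of odd total degree (in the upper right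
corner). -/
def leftOdd (w : V × Module.Dual K V) : BigAlg 𝒱 →ₐ[K] Matrix (Fin 2) (Fin 2) (BigAlg 𝒱) :=
  derHom 𝒱 (parityB 𝒱)
    ((2 : K)⁻¹ • (pairing 𝒱 w - pairing 𝒱 w ∘ₗ parity 𝒱)) (by
    intro a b x y hx hy
    rw [ksign_eq]
    rcases Int.even_or_odd a with ha | ha <;> rcases Int.even_or_odd b with hb | hb
    · simp [parityB, parity_even 𝒱 ha hx, parity_even 𝒱 hb hy, ha, hb]
      abel
    · simp [parityB, parity_even 𝒱 ha hx, parity_odd 𝒱 hb hy, hb]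
    · simp [parityB, parity_odd 𝒱 ha hx, parity_even 𝒱 hb hy, ha]
    · simp [parityB, parity_odd 𝒱 ha hx, parity_odd 𝒱 hb hy])

/-- `[w, F]` for `w ∈ V ⊕ V^*`. -/
def leftBr (w : V × Module.Dual K V) : BigAlg 𝒱 →ₗ[K] BigAlg 𝒱 :=
  Matrix.entryLinearMap K _ 0 1 ∘ₗ
    ((leftEven 𝒱 w).toLinearMap + (leftOdd 𝒱 w).toLinearMap)

/-- `[F, w] = -(-1)^(|F||w|) [w, F]` for `w ∈ V ⊕ V^*`. -/
def rightBr (w : V × Module.Dual K V) : BigAlg 𝒱 →ₗ[K] BigAlg 𝒱 :=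
  -(Matrix.entryLinearMap K _ 0 1 ∘ₗ
    ((leftEven 𝒱 w).toLinearMap + (leftOdd 𝒱 w).toLinearMap ∘ₗ (parityB 𝒱).toLinearMap))

/-- The big bracket on `B`, written as the graded Poisson bracket
`[F, G] = ∑ᵢ [F, eᵢ] [eⁱ, G] + [F, ±eⁱ] [eᵢ, G]`. -/
def bigBracket [Module.Finite K V] : BigAlg 𝒱 →ₗ[K] BigAlg 𝒱 →ₗ[K] BigAlg 𝒱 :=
  ∑ i, (((LinearMap.mul K (BigAlg 𝒱)).compl₁₂
      (rightBr 𝒱 (Module.finBasis K V i, 0)) (leftBr 𝒱 (0, (Module.finBasis K V).coord i))) +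
    ((LinearMap.mul K (BigAlg 𝒱)).compl₁₂
      (rightBr 𝒱 (0, (gradInv 𝒱).dualMap ((Module.finBasis K V).coord i)))
      (leftBr 𝒱 (Module.finBasis K V i, 0))))

/-- The iterated adjoint action `[⋯[[F, x₁], x₂], ⋯, xₙ]`. -/
def iad [Module.Finite K V] (F : BigAlg 𝒱) (x : List (V × Module.Dual K V)) : BigAlg 𝒱 :=
  x.foldl (fun G w => bigBracket 𝒱 G (gen 𝒱 w)) F

/-- A family `t_{kl} ∈ Λ^k V^* ⊗ Λ^l V`, nonzero only for `l ≥ 1` and `k + l ≥ 2`, of total degree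
`1` (that is, of internal degree `1 - (k + l - 2)`), whose formal sum `S = ∑ t_{kl}` satisfies
`[S, S] = 0`.  The equation is written out in each component `Λ^{p-1} V^* ⊗ Λ^{q-1} V`, where it is
a finite sum. -/
structure IsMaurerCartan [Module.Finite K V] (t : ℕ → ℕ → BigAlg 𝒱) : Prop where
  mem : ∀ k l : ℕ, t k l ∈ comp 𝒱 k l (3 - k - l)
  t_k_zero : ∀ k, t k 0 = 0
  t_zero_one : t 0 1 = 0
  bracket_self : ∀ p q : ℕ, ∑ k ∈ Finset.HasAntidiagonal.antidiagonal p,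
    ∑ l ∈ Finset.HasAntidiagonal.antidiagonal q,
    bigBracket 𝒱 (t k.1 l.1) (t k.2 l.2) = 0

/-- An `L_∞`-quasi-bialgebra structure on `V`:
`S = ∑_{k ≥ 1, l ≥ 1} t_{kl} + ∑_{l ≥ 3} t_{0l}` of total degree `1` with `[S, S] = 0`. -/
structure IsQuasiBialgebra [Module.Finite K V] (t : ℕ → ℕ → BigAlg 𝒱) : Prop
    extends IsMaurerCartan 𝒱 t where
  t_zero_two : t 0 2 = 0

variable {𝒱} in
/-- A (strict) isomorphism of `L_∞`-quasi-bialgebras: an isomorphism `f` of graded vector spaces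
such that the induced isomorphism of the algebras `Λ V^* ⊗ Λ V` carries `S` to `S'`. -/
def IsQBIso {V' : Type w} [AddCommGroup V'] [Module K V'] {𝒱' : ℤ → Submodule K V'}
    (t : ℕ → ℕ → BigAlg 𝒱) (t' : ℕ → ℕ → BigAlg 𝒱') (f : V ≃ₗ[K] V') : Prop :=
  (∀ d, (𝒱 d).map f.toLinearMap = 𝒱' d) ∧
    ∃ Φ : BigAlg 𝒱 →ₐ[K] BigAlg 𝒱',
      (∀ u, Φ (gen 𝒱 u) = gen 𝒱' (f u.1, f.symm.dualMap u.2)) ∧ ∀ k l, Φ (t k l) = t' k l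

variable {𝒱} in
/-- `T` is the quasi-triple `(V ⊕ V^*, V, V^*)` with the canonical pairing and with the brackets
`λ_n(x₁, …, xₙ) = [⋯[[S, x₁], x₂], ⋯, xₙ]`.  Only the terms `t_{kl}` of `S` with `k + l = n + 1`
contribute to the component in `V ⊕ V^*`. -/
structure IsDouble [Module.Finite K V] (t : ℕ → ℕ → BigAlg 𝒱)
    (T : ManinQuasiTriple K (V × Module.Dual K V)) : Prop where
  gr_eq : T.gr = dblGr 𝒱
  form_eq : T.form = pairing 𝒱
  plus_eq : T.plus = (⊤ : Submodule K V).prod ⊥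
  minus_eq : T.minus = (⊥ : Submodule K V).prod ⊤
  br_eq : ∀ (n : ℕ) (x : Fin (n + 1) → V × Module.Dual K V),
    gen 𝒱 (T.br (n + 1) x) =
      iad 𝒱 (∑ k ∈ Finset.HasAntidiagonal.antidiagonal (n + 2), t k.1 k.2) (List.ofFn x)

/-- The solution `t` on the subalgebra `plus` presents the quasi-triple `T`: there is an isomorphism
of `T` with the quasi-triple on `plus ⊕ plus^*` built from `t` which is the identity on `plus`. -/
def Presents {W : Type v} [AddCommGroup W] [Module K W] [Module.Finite K W]
    (T : ManinQuasiTriple K W) (t : ℕ → ℕ → BigAlg T.plusGr) : Prop :=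
  ∃ T' : ManinQuasiTriple K (T.plus × Module.Dual K T.plus), IsDouble t T' ∧
    ∃ F : W →ₗ[K] T.plus × Module.Dual K T.plus, ManinQuasiTriple.IsIso T T' F ∧
      ∀ x : T.plus, F x = (x, 0)

/-! ### The big bracket is the pairing on generators, satisfies the graded Leibniz rule and is
graded antisymmetric -/

theorem gradInv_gradInv (x : V) : gradInv 𝒱 (gradInv 𝒱 x) = x := by
  have htop := (GradedSpace.internal (𝒱 := 𝒱)).submodule_iSup_eq_top
  have hx : x ∈ ⨆ i, 𝒱 i := htop ▸ Submodule.mem_top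
  induction hx using Submodule.iSup_induction' with
  | mem b x hx =>
    rw [gradInv_apply 𝒱 hx, map_zsmul, gradInv_apply 𝒱 hx, smul_smul, ← Units.val_mul]
    simp
  | zero => simp
  | add x y _ _ hx hy => rw [map_add, map_add, hx, hy]

theorem parity_parity (u : V × Module.Dual K V) : parity 𝒱 (parity 𝒱 u) = u := by
  obtain ⟨x, ξ⟩ := u
  simp only [parity, LinearMap.neg_apply, LinearMap.prodMap_apply, Prod.neg_mk, map_neg, neg_neg,
    gradInv_gradInv, Prod.mk.injEq, true_and]
  ext y
  simp [gradInv_gradInv]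

theorem parityB_gen (u) : parityB 𝒱 (gen 𝒱 u) = gen 𝒱 (parity 𝒱 u) := by simp [parityB]

variable [CharZero K]

theorem leftBr_gen (w u : V × Module.Dual K V) :
    leftBr 𝒱 w (gen 𝒱 u) = pairing 𝒱 w u • 1 := by
  simp only [leftBr, leftEven, leftOdd, derHom, LinearMap.comp_apply, LinearMap.add_apply,
    AlgHom.toLinearMap_apply, liftB_gen]
  simp only [LinearMap.coe_mk, AddHom.coe_mk, Matrix.entryLinearMap_apply, Matrix.add_apply,
    Matrix.of_apply, Matrix.cons_val', Matrix.cons_val_zero, Matrix.cons_val_one]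
  rw [← add_smul]
  congr 1
  simp
  ring

theorem rightBr_gen (w u : V × Module.Dual K V) :
    rightBr 𝒱 w (gen 𝒱 u) = pairing 𝒱 u w • 1 := by
  have hp : parityB 𝒱 (gen 𝒱 u) = gen 𝒱 (parity 𝒱 u) := by simp [parityB]
  simp only [rightBr, leftEven, leftOdd, derHom, LinearMap.comp_apply, LinearMap.add_apply,
    LinearMap.neg_apply, AlgHom.toLinearMap_apply, hp, liftB_gen]
  simp only [LinearMap.coe_mk, AddHom.coe_mk, Matrix.entryLinearMap_apply, Matrix.add_apply,
    Matrix.of_apply, Matrix.cons_val', Matrix.cons_val_zero, Matrix.cons_val_one]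
  rw [← add_smul, ← neg_smul]
  congr 1
  simp [parity_parity]
  simp [pairing, parity, gradInv_gradInv]
  ring

theorem sum_pairing [Module.Finite K V] (u w : V × Module.Dual K V) :
    ∑ i, (pairing 𝒱 u (Module.finBasis K V i, 0) * pairing 𝒱 (0, (Module.finBasis K V).coord i) w +
      pairing 𝒱 u (0, (gradInv 𝒱).dualMap ((Module.finBasis K V).coord i)) *
        pairing 𝒱 (Module.finBasis K V i, 0) w) = pairing 𝒱 u w := by
  simp only [Finset.sum_add_distrib, pairing, LinearMap.mk₂_apply, map_zero, add_zero, zero_add,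
    LinearMap.zero_apply, LinearMap.dualMap_apply, gradInv_gradInv]
  have h : ∀ (ξ : Module.Dual K V) (g : V →ₗ[K] V) (x : V),
      ∑ i, ξ (g (Module.finBasis K V i)) * (Module.finBasis K V).coord i x = ξ (g x) := by
    intro ξ g x
    conv_rhs => rw [← (Module.finBasis K V).sum_repr x, map_sum, map_sum]
    exact Finset.sum_congr rfl fun i _ => by simp [mul_comm]
  have h1 := h u.2 LinearMap.id w.1
  have h2 := h w.2 (gradInv 𝒱) u.1
  simp only [LinearMap.id_apply] at h1
  rw [h1, ← h2]
  simp [mul_comm]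

/-- On generators the big bracket is the pairing. -/
theorem bigBracket_gen [Module.Finite K V] (u w : V × Module.Dual K V) :
    bigBracket 𝒱 (gen 𝒱 u) (gen 𝒱 w) = pairing 𝒱 u w • 1 := by
  simp only [bigBracket, LinearMap.sum_apply, LinearMap.add_apply, LinearMap.compl₁₂_apply,
    LinearMap.mul_apply', leftBr_gen, rightBr_gen, smul_mul_smul_comm, mul_one, ← add_smul,
    ← Finset.sum_smul, sum_pairing]


theorem iSup_dualGr [Module.Finite K V] : ⨆ d, dualGr 𝒱 d = ⊤ := by
  let _ := (GradedSpace.internal (𝒱 := 𝒱)).chooseDecomposition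
  rw [← Subspace.dualCoannihilator_dualAnnihilator_eq (W := ⨆ d, dualGr 𝒱 d)]
  rw [show (⨆ d, dualGr 𝒱 d).dualCoannihilator = ⊥ from ?_]
  · simp
  rw [eq_bot_iff]
  intro x hx
  rw [Submodule.mem_dualCoannihilator] at hx
  rw [Submodule.mem_bot]
  have : ∀ d, (DirectSum.decompose 𝒱 x d : V) = 0 := by
    intro d
    rw [← Module.forall_dual_apply_eq_zero_iff K]
    intro f
    let P : V →ₗ[K] V := (𝒱 d).subtype ∘ₗ DirectSum.component K ℤ (fun i => 𝒱 i) d ∘ₗ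
      (DirectSum.decomposeLinearEquiv 𝒱).toLinearMap
    have hP : ∀ y, P y = DirectSum.decompose 𝒱 y d := fun y => rfl
    have h1 := hx (f ∘ₗ P) (Submodule.mem_iSup_of_mem (-d) (by
      intro b hb y hy
      rw [LinearMap.comp_apply, hP, DirectSum.decompose_of_mem_ne 𝒱 hy (by simpa using hb),
        map_zero]))
    exact h1
  classical
  rw [← DirectSum.sum_support_decompose 𝒱 x]
  exact Finset.sum_eq_zero fun i _ => this i

theorem B_induction [Module.Finite K V] {p : BigAlg 𝒱 → Prop} (h1 : ∀ c : K, p (c • 1))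
    (hg : ∀ d, ∀ u ∈ dblGr 𝒱 d, p (gen 𝒱 u)) (hm : ∀ F G, p F → p G → p (F * G))
    (ha : ∀ F G, p F → p G → p (F + G)) (F : BigAlg 𝒱) : p F := by
  have h0 : p 0 := by simpa using h1 0
  obtain ⟨F, rfl⟩ := toB_surjective 𝒱 F
  induction F using TensorAlgebra.induction with
  | algebraMap r => rw [AlgHom.commutes, Algebra.algebraMap_eq_smul_one]; exact h1 r
  | mul a b ha hb => rw [map_mul]; exact hm _ _ ha hb
  | add a b ha' hb => rw [map_add]; exact ha _ _ ha' hb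
  | ι u =>
    change p (gen 𝒱 u)
    obtain ⟨x, ξ⟩ := u
    have : gen 𝒱 (x, ξ) = gen 𝒱 (x, 0) + gen 𝒱 (0, ξ) := by rw [← map_add]; simp
    rw [this]
    apply ha
    · have hx : x ∈ ⨆ i, 𝒱 i :=
        (GradedSpace.internal (𝒱 := 𝒱)).submodule_iSup_eq_top ▸ Submodule.mem_top
      induction hx using Submodule.iSup_induction' with
      | mem b x hx => exact hg b _ (Submodule.mem_prod.2 ⟨hx, zero_mem _⟩)
      | zero => rw [show ((0 : V), (0 : Module.Dual K V)) = 0 from rfl, map_zero]; exact h0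
      | add x y _ _ hx hy =>
        rw [show (x + y, (0 : Module.Dual K V)) = (x, 0) + (y, 0) by simp, map_add]
        exact ha _ _ (hx (by rw [← map_add]; simp)) (hy (by rw [← map_add]; simp))
    · have hx : ξ ∈ ⨆ i, dualGr 𝒱 i := iSup_dualGr 𝒱 ▸ Submodule.mem_top
      clear this
      induction hx using Submodule.iSup_induction' with
      | mem b x hx => exact hg b _ (Submodule.mem_prod.2 ⟨zero_mem _, hx⟩)
      | zero => rw [show ((0 : V), (0 : Module.Dual K V)) = 0 from rfl, map_zero]; exact h0
      | add x y _ _ hx hy =>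
        rw [show ((0 : V), x + y) = (0, x) + (0, y) by simp, map_add]
        exact ha _ _ hx hy

theorem parityB_parityB [Module.Finite K V] (F : BigAlg 𝒱) :
    parityB 𝒱 (parityB 𝒱 F) = F := by
  induction F using B_induction 𝒱 with
  | h1 c => simp
  | hg d u hu => simp [parityB_gen, parity_parity]
  | hm F G hF hG => simp [hF, hG]
  | ha F G hF hG => simp [hF, hG]

theorem gen_comm [Module.Finite K V] {d : ℤ} {u} (hu : u ∈ dblGr 𝒱 d) (G : BigAlg 𝒱) :
    gen 𝒱 u * G = (if Even d then parityB 𝒱 G else G) * gen 𝒱 u := by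
  induction G using B_induction 𝒱 with
  | h1 c => simp
  | hg e w hw =>
    rw [gen_mul_gen 𝒱 hu hw, ksign_eq, parityB_gen]
    by_cases hd : Even d
    · rcases Int.even_or_odd e with he | he
      · simp [hd, he, parity_even 𝒱 he hw, neg_mul]
      · simp [hd, he, parity_odd 𝒱 he hw]
    · simp [hd]
  | hm F G hF hG =>
    rw [← mul_assoc, hF, mul_assoc, hG, ← mul_assoc]
    split_ifs <;> simp
  | ha F G hF hG => rw [mul_add, hF, hG, ← add_mul]; split_ifs <;> simp


theorem aux0 {A : Type*} [Ring A] (a b c d : A) :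
    (a * b + c * d) + (a * b + c * d) = (a + c) * (b + d) + (a - c) * (b - d) := by
  simp only [mul_add, add_mul, sub_mul, mul_sub]; abel
theorem aux1 {A : Type*} [Ring A] (a b c d : A) :
    (a * b - c * d) + (a * b - c * d) = (a + c) * (b - d) + (a - c) * (b + d) := by
  simp only [mul_add, add_mul, sub_mul, mul_sub]; abel

/-- Graded commutativity of `B`. -/
theorem B_comm [Module.Finite K V] (F G : BigAlg 𝒱) :
    ((F + parityB 𝒱 F) * G = G * (F + parityB 𝒱 F)) ∧
    ((F - parityB 𝒱 F) * G = parityB 𝒱 G * (F - parityB 𝒱 F)) := by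
  induction F using B_induction 𝒱 generalizing G with
  | h1 c => simp [← add_smul]
  | hg d u hu =>
    have := gen_comm 𝒱 hu G
    rcases Int.even_or_odd d with he | he
    · simp [parityB_gen, parity_even 𝒱 he hu, add_mul, mul_add, this, he]
    · simp [parityB_gen, parity_odd 𝒱 he hu, add_mul, mul_add, this, Int.not_even_iff_odd.2 he]
  | hm F G' hF hG =>
    have two : (2 : K) ≠ 0 := two_ne_zero
    have e0 := aux0 F G' (parityB 𝒱 F) (parityB 𝒱 G')
    have e1 := aux1 F G' (parityB 𝒱 F) (parityB 𝒱 G')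
    rw [← two_smul K, ← map_mul] at e0 e1
    generalize F + parityB 𝒱 F = F0 at *
    generalize F - parityB 𝒱 F = F1 at *
    generalize G' + parityB 𝒱 G' = G0 at *
    generalize G' - parityB 𝒱 G' = G1 at *
    constructor
    · apply smul_right_injective _ two
      simp only
      rw [← smul_mul_assoc, ← mul_smul_comm, e0, add_mul, mul_add, mul_assoc, (hG _).1, ← mul_assoc,
        (hF _).1, mul_assoc, mul_assoc F1, (hG _).2, ← mul_assoc F1, (hF _).2, parityB_parityB,
        mul_assoc]
    · apply smul_right_injective _ two
      simp only
      rw [← smul_mul_assoc, ← mul_smul_comm, e1, add_mul, mul_add, mul_assoc, (hG _).2, ← mul_assoc,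
        (hF _).1, mul_assoc, mul_assoc F1, (hG _).1, ← mul_assoc F1, (hF _).2, mul_assoc]
  | ha F G' hF hG =>
    have a1 := hF G
    have a2 := hG G
    constructor
    · rw [map_add, add_add_add_comm, add_mul, a1.1, a2.1, ← mul_add]
    · rw [map_add, add_sub_add_comm, add_mul, a1.2, a2.2, ← mul_add]

theorem B_comm' [Module.Finite K V] (F G : BigAlg 𝒱) (a b : ℕ)
    (hF : parityB 𝒱 F = (-1 : K) ^ a • F) (hG : parityB 𝒱 G = (-1 : K) ^ b • G) :
    F * G = (-1 : K) ^ (a * b) • (G * F) := by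
  have two : (2 : K) ≠ 0 := two_ne_zero
  have h := B_comm 𝒱 F G
  rw [hF, hG] at h
  rcases Nat.even_or_odd a with ha | ha
  · rw [ha.neg_one_pow, one_smul, ← two_smul K, smul_mul_assoc, mul_smul_comm] at h
    rw [(ha.mul_right b).neg_one_pow, one_smul]
    exact smul_right_injective _ two h.1
  · rw [ha.neg_one_pow, neg_smul, one_smul, sub_neg_eq_add, ← two_smul K, smul_mul_assoc,
      mul_smul_comm] at h
    rw [pow_mul, ha.neg_one_pow]
    have := smul_right_injective _ two h.2
    rw [this, smul_mul_assoc]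


def L0 (w : V × Module.Dual K V) (F : BigAlg 𝒱) : BigAlg 𝒱 := leftEven 𝒱 w F 0 1
def L1 (w : V × Module.Dual K V) (F : BigAlg 𝒱) : BigAlg 𝒱 := leftOdd 𝒱 w F 0 1

theorem derHom_corners (s φ h) [Module.Finite K V] (F : BigAlg 𝒱) :
    derHom 𝒱 s φ h F 0 0 = s F ∧ derHom 𝒱 s φ h F 1 0 = 0 ∧ derHom 𝒱 s φ h F 1 1 = F := by
  induction F using B_induction 𝒱 with
  | h1 c => simp
  | hg d u hu => simp [derHom]
  | hm F G hF hG => simp [Matrix.mul_apply, hF, hG]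
  | ha F G hF hG => simp [hF, hG]

theorem L0_mul [Module.Finite K V] (w) (F G : BigAlg 𝒱) :
    L0 𝒱 w (F * G) = F * L0 𝒱 w G + L0 𝒱 w F * G := by
  simp only [L0, leftEven, map_mul, Matrix.mul_apply, Fin.sum_univ_two, derHom_corners]
  simp

theorem L1_mul [Module.Finite K V] (w) (F G : BigAlg 𝒱) :
    L1 𝒱 w (F * G) = parityB 𝒱 F * L1 𝒱 w G + L1 𝒱 w F * G := by
  simp only [L1, leftOdd, map_mul, Matrix.mul_apply, Fin.sum_univ_two, derHom_corners]

theorem leftBr_eq (w) (F : BigAlg 𝒱) : leftBr 𝒱 w F = L0 𝒱 w F + L1 𝒱 w F := rfl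
theorem rightBr_eq (w) (F : BigAlg 𝒱) :
    rightBr 𝒱 w F = -(L0 𝒱 w F + L1 𝒱 w (parityB 𝒱 F)) := rfl

theorem L0_gen (w u : V × Module.Dual K V) :
    L0 𝒱 w (gen 𝒱 u) = ((2 : K)⁻¹ * (pairing 𝒱 w u + pairing 𝒱 w (parity 𝒱 u))) • 1 := by
  simp [L0, leftEven, derHom, mul_add]
theorem L1_gen (w u : V × Module.Dual K V) :
    L1 𝒱 w (gen 𝒱 u) = ((2 : K)⁻¹ * (pairing 𝒱 w u - pairing 𝒱 w (parity 𝒱 u))) • 1 := by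
  simp [L1, leftOdd, derHom, mul_sub]
theorem L0_smul (w) (c : K) (F : BigAlg 𝒱) : L0 𝒱 w (c • F) = c • L0 𝒱 w F := by simp [L0]
theorem L1_smul (w) (c : K) (F : BigAlg 𝒱) : L1 𝒱 w (c • F) = c • L1 𝒱 w F := by simp [L1]
theorem L0_one (w) : L0 𝒱 w 1 = 0 := by simp [L0]
theorem L1_one (w) : L1 𝒱 w 1 = 0 := by simp [L1]
theorem L0_add (w) (F G : BigAlg 𝒱) : L0 𝒱 w (F + G) = L0 𝒱 w F + L0 𝒱 w G := by simp [L0]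
theorem L1_add (w) (F G : BigAlg 𝒱) : L1 𝒱 w (F + G) = L1 𝒱 w F + L1 𝒱 w G := by simp [L1]

theorem pairing_parity (u w) : pairing 𝒱 (parity 𝒱 u) w = pairing 𝒱 u (parity 𝒱 w) := by
  simp [pairing, parity, gradInv_gradInv]

theorem pairing_swap (u w) : pairing 𝒱 u w = - pairing 𝒱 w (parity 𝒱 u) := by
  simp [pairing, parity, gradInv_gradInv]

theorem L_w [Module.Finite K V] (c : K) (w w' : V × Module.Dual K V) (F : BigAlg 𝒱) :
    L0 𝒱 (w + w') F = L0 𝒱 w F + L0 𝒱 w' F ∧ L1 𝒱 (w + w') F = L1 𝒱 w F + L1 𝒱 w' F ∧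
    L0 𝒱 (c • w) F = c • L0 𝒱 w F ∧ L1 𝒱 (c • w) F = c • L1 𝒱 w F ∧
    L0 𝒱 (parity 𝒱 w) F = L0 𝒱 w F ∧ L1 𝒱 (parity 𝒱 w) F = - L1 𝒱 w F ∧
    parityB 𝒱 (L0 𝒱 w F) = L0 𝒱 w (parityB 𝒱 F) ∧
    parityB 𝒱 (L1 𝒱 w F) = - L1 𝒱 w (parityB 𝒱 F) := by
  induction F using B_induction 𝒱 with
  | h1 c => simp [L0_smul, L1_smul, L0_one, L1_one]
  | hg d u hu =>
    simp only [L0_gen, L1_gen, pairing_parity, parityB_gen, parity_parity, map_smul, map_one,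
      map_add, LinearMap.add_apply, LinearMap.smul_apply, ← add_smul, smul_smul, ← neg_smul,
      smul_eq_mul]
    refine ⟨?_, ?_, ?_, ?_, ?_, ?_, ?_, ?_⟩ <;> congr 1 <;> ring
  | hm F G hF hG =>
    simp only [L0_mul, L1_mul, map_mul, map_add, hF, hG]
    refine ⟨?_, ?_, ?_, ?_, ?_, ?_, ?_, ?_⟩ <;>
      simp only [mul_add, add_mul, smul_add, mul_neg, neg_mul, mul_smul_comm, smul_mul_assoc] <;>
      try abel
  | ha F G hF hG =>
    simp only [L0_add, L1_add, map_add, hF, hG]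
    refine ⟨?_, ?_, ?_, ?_, ?_, ?_, ?_, ?_⟩ <;>
      (try simp only [smul_add]) <;> abel

theorem canon [Module.Finite K V] {A : Type*} [AddCommGroup A] [Module K A]
    (β : V × Module.Dual K V →ₗ[K] V × Module.Dual K V →ₗ[K] A) :
    ∑ i, (β (parity 𝒱 (Module.finBasis K V i, 0)) (0, (Module.finBasis K V).coord i) +
      β (parity 𝒱 (0, (gradInv 𝒱).dualMap ((Module.finBasis K V).coord i)))
        (Module.finBasis K V i, 0)) =
    ∑ i, (β (Module.finBasis K V i, 0) (parity 𝒱 (0, (Module.finBasis K V).coord i)) +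
      β (0, (gradInv 𝒱).dualMap ((Module.finBasis K V).coord i))
        (parity 𝒱 (Module.finBasis K V i, 0))) := by
  set e := Module.finBasis K V with he
  -- general transposition
  have key : ∀ (γ : V →ₗ[K] Module.Dual K V →ₗ[K] A) ,
      ∑ i, γ (gradInv 𝒱 (e i)) (e.coord i) = ∑ i, γ (e i) ((gradInv 𝒱).dualMap (e.coord i)) := by
    intro γ
    have h1 : ∀ i, gradInv 𝒱 (e i) = ∑ j, e.coord j (gradInv 𝒱 (e i)) • e j := fun i => by
      simp
    have h2 : ∀ j, (gradInv 𝒱).dualMap (e.coord j) = ∑ i, e.coord j (gradInv 𝒱 (e i)) • e.coord i :=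
      fun j => e.ext fun k => by simp [Finsupp.single_apply]
    simp_rw [h2, map_sum, map_smul]
    conv_lhs => enter [2, i]; rw [h1 i]
    simp_rw [map_sum, map_smul, LinearMap.sum_apply, LinearMap.smul_apply]
    exact Finset.sum_comm
  have k1 := key (LinearMap.mk₂ K (fun x ξ => β (x, 0) (0, ξ))
    (fun x x' ξ => by rw [← LinearMap.add_apply, ← map_add]; simp)
    (fun c x ξ => by rw [← LinearMap.smul_apply, ← map_smul]; simp)
    (fun x ξ ξ' => by rw [← map_add]; simp)
    (fun c x ξ => by rw [← map_smul]; simp))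
  have k2 := key (LinearMap.mk₂ K (fun x ξ => β (0, (gradInv 𝒱).dualMap ξ) (x, 0))
    (fun x x' ξ => by rw [← map_add]; simp)
    (fun c x ξ => by rw [← map_smul]; simp)
    (fun x ξ ξ' => by rw [← LinearMap.add_apply, ← map_add]; simp)
    (fun c x ξ => by rw [← LinearMap.smul_apply, ← map_smul]; simp))
  simp only [LinearMap.mk₂_apply] at k1 k2
  have p1 : ∀ x : V, parity 𝒱 (x, 0) = -(gradInv 𝒱 x, 0) := fun x => by simp [parity]
  have p2 : ∀ x : Module.Dual K V, parity 𝒱 (0, x) = -(0, (gradInv 𝒱).dualMap x) :=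
    fun x => by simp [parity]
  simp only [p1, p2, map_neg, LinearMap.neg_apply, Finset.sum_add_distrib, Finset.sum_neg_distrib,
    k1, k2]

def L0' [Module.Finite K V] (F : BigAlg 𝒱) : V × Module.Dual K V →ₗ[K] BigAlg 𝒱 where
  toFun w := L0 𝒱 w F
  map_add' w w' := (L_w 𝒱 0 w w' F).1
  map_smul' c w := (L_w 𝒱 c w w F).2.2.1
def L1' [Module.Finite K V] (F : BigAlg 𝒱) : V × Module.Dual K V →ₗ[K] BigAlg 𝒱 where
  toFun w := L1 𝒱 w F
  map_add' w w' := (L_w 𝒱 0 w w' F).2.1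
  map_smul' c w := (L_w 𝒱 c w w F).2.2.2.1

/-- contraction with the canonical element -/
def con [Module.Finite K V] (f g : V × Module.Dual K V → BigAlg 𝒱) : BigAlg 𝒱 :=
  ∑ i, (f (Module.finBasis K V i, 0) * g (0, (Module.finBasis K V).coord i) +
      f (0, (gradInv 𝒱).dualMap ((Module.finBasis K V).coord i)) * g (Module.finBasis K V i, 0))

theorem con01 [Module.Finite K V] (F G : BigAlg 𝒱) :
    con 𝒱 (fun w => L0 𝒱 w F) (fun w => L1 𝒱 w G) = 0 ∧
    con 𝒱 (fun w => L1 𝒱 w F) (fun w => L0 𝒱 w G) = 0 := by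
  have two : (2 : K) ≠ 0 := two_ne_zero
  have c1 := canon 𝒱 ((LinearMap.mul K (BigAlg 𝒱)).compl₁₂ (L0' 𝒱 F) (L1' 𝒱 G))
  have c2 := canon 𝒱 ((LinearMap.mul K (BigAlg 𝒱)).compl₁₂ (L1' 𝒱 F) (L0' 𝒱 G))
  have hl := fun w => L_w 𝒱 0 w 0 F
  have hl' := fun w => L_w 𝒱 0 w 0 G
  simp only [LinearMap.compl₁₂_apply, LinearMap.mul_apply', L0', L1', LinearMap.coe_mk,
    AddHom.coe_mk, hl, hl', mul_neg, neg_mul, ← neg_add, Finset.sum_neg_distrib] at c1 c2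
  have z : ∀ x : BigAlg 𝒱, x = -x → x = 0 := fun x hx => by
    have : (2 : K) • x = 0 := by rw [two_smul]; nth_rw 1 [hx]; simp
    exact (smul_eq_zero.1 this).resolve_left two
  exact ⟨z _ c1, z _ c2.symm⟩

theorem con_add [Module.Finite K V] (f f' g g' : V × Module.Dual K V → BigAlg 𝒱) :
    con 𝒱 (fun w => f w + f' w) g = con 𝒱 f g + con 𝒱 f' g ∧
    con 𝒱 f (fun w => g w + g' w) = con 𝒱 f g + con 𝒱 f g' := by
  simp only [con, add_mul, mul_add, ← Finset.sum_add_distrib]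
  exact ⟨Finset.sum_congr rfl fun i _ => by abel, Finset.sum_congr rfl fun i _ => by abel⟩

theorem bigBracket_con [Module.Finite K V] (F G : BigAlg 𝒱) :
    bigBracket 𝒱 F G = con 𝒱 (fun w => rightBr 𝒱 w F) (fun w => leftBr 𝒱 w G) := by
  simp [bigBracket, con]

/-- for homogeneous `F` -/
theorem bigBracket_hom [Module.Finite K V] (F G : BigAlg 𝒱) (a : ℕ)
    (hF : parityB 𝒱 F = (-1 : K) ^ a • F) :
    bigBracket 𝒱 F G = -con 𝒱 (fun w => L0 𝒱 w F) (fun w => L0 𝒱 w G) -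
      (-1 : K) ^ a • con 𝒱 (fun w => L1 𝒱 w F) (fun w => L1 𝒱 w G) := by
  rw [bigBracket_con]
  simp only [rightBr_eq, leftBr_eq, hF, L1_smul]
  have n : ∀ f g, con 𝒱 (fun w => - f w) g = - con 𝒱 f g := fun f g => by
    simp only [con, neg_mul, ← neg_add, Finset.sum_neg_distrib]
  have s : ∀ f g, con 𝒱 (fun w => (-1 : K) ^ a • f w) g = (-1 : K) ^ a • con 𝒱 f g := fun f g => by
    simp only [con, smul_mul_assoc, ← smul_add, Finset.smul_sum]
  rw [n, (con_add 𝒱 _ _ _ (fun _ => 0)).1, s,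
    (con_add 𝒱 (fun w => L0 𝒱 w F) (fun _ => 0) (fun w => L0 𝒱 w G) (fun w => L1 𝒱 w G)).2,
    (con_add 𝒱 (fun w => L1 𝒱 w F) (fun _ => 0) (fun w => L0 𝒱 w G) (fun w => L1 𝒱 w G)).2, (con01 𝒱 F G).1, (con01 𝒱 F G).2]
  simp
  abel

/-- The graded Leibniz rule -/
theorem bigBracket_mul [Module.Finite K V] (F G H : BigAlg 𝒱) (a b : ℕ)
    (hF : parityB 𝒱 F = (-1 : K) ^ a • F) (hG : parityB 𝒱 G = (-1 : K) ^ b • G) :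
    bigBracket 𝒱 F (G * H) =
      bigBracket 𝒱 F G * H + (-1 : K) ^ (a * b) • (G * bigBracket 𝒱 F H) := by
  simp only [bigBracket_hom 𝒱 F _ a hF, L0_mul, L1_mul, hG]
  have h0 : ∀ w, L0 𝒱 w F * G = (-1 : K) ^ (a * b) • (G * L0 𝒱 w F) := fun w =>
    B_comm' 𝒱 _ _ a b (by rw [(L_w 𝒱 0 w 0 F).2.2.2.2.2.2.1, hF, L0_smul]) hG
  have h1 : ∀ w, L1 𝒱 w F * G = (-1 : K) ^ ((a + 1) * b) • (G * L1 𝒱 w F) := fun w =>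
    B_comm' 𝒱 _ _ (a + 1) b
      (by rw [(L_w 𝒱 0 w 0 F).2.2.2.2.2.2.2, hF, L1_smul, pow_succ]; simp) hG
  have hb : (-1 : K) ^ b * (-1) ^ b = 1 := by rw [← mul_pow]; simp
  have s0 : con 𝒱 (fun w => L0 𝒱 w F) (fun w => G * L0 𝒱 w H) =
      (-1 : K) ^ (a * b) • (G * con 𝒱 (fun w => L0 𝒱 w F) (fun w => L0 𝒱 w H)) := by
    simp only [con, ← mul_assoc, h0, Finset.mul_sum, Finset.smul_sum, smul_mul_assoc, mul_add,
      smul_add]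
  have s1 : con 𝒱 (fun w => L1 𝒱 w F) (fun w => (-1 : K) ^ b • G * L1 𝒱 w H) =
      (-1 : K) ^ (a * b) • (G * con 𝒱 (fun w => L1 𝒱 w F) (fun w => L1 𝒱 w H)) := by
    simp only [con, ← mul_assoc, mul_smul_comm, h1, Finset.mul_sum, Finset.smul_sum,
      smul_mul_assoc, mul_add, smul_add, smul_smul, add_mul, one_mul, pow_add]
    have : (-1 : K) ^ b * ((-1) ^ (a * b) * (-1) ^ b) = (-1) ^ (a * b) := by
      rw [mul_left_comm, hb, mul_one]
    simp only [mul_assoc ((-1 : K) ^ b), this]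
  have s2 : ∀ f g, con 𝒱 f (fun w => g w * H) = con 𝒱 f g * H := fun f g => by
    simp only [con, ← mul_assoc, ← add_mul, ← Finset.sum_mul]
  rw [(con_add 𝒱 _ (fun _ => 0) _ _).2, (con_add 𝒱 _ (fun _ => 0) _ _).2, s0, s1, s2, s2]
  simp only [smul_add, sub_mul, mul_sub, neg_mul, mul_neg, smul_sub, smul_neg, smul_mul_assoc,
    mul_smul_comm]
  rw [smul_comm ((-1 : K) ^ a) ((-1 : K) ^ (a * b))]
  abel

theorem con_swap [Module.Finite K V] (F G : BigAlg 𝒱) :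
    con 𝒱 (fun w => L0 𝒱 w F) (fun w => L0 𝒱 w G) =
      -∑ i, (L0 𝒱 (0, (Module.finBasis K V).coord i) F * L0 𝒱 (Module.finBasis K V i, 0) G +
        L0 𝒱 (Module.finBasis K V i, 0) F *
          L0 𝒱 (0, (gradInv 𝒱).dualMap ((Module.finBasis K V).coord i)) G) ∧
    con 𝒱 (fun w => L1 𝒱 w F) (fun w => L1 𝒱 w G) =
      ∑ i, (L1 𝒱 (0, (Module.finBasis K V).coord i) F * L1 𝒱 (Module.finBasis K V i, 0) G +
        L1 𝒱 (Module.finBasis K V i, 0) F *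
          L1 𝒱 (0, (gradInv 𝒱).dualMap ((Module.finBasis K V).coord i)) G) := by
  have p : ∀ x : Module.Dual K V, ((0 : V), (gradInv 𝒱).dualMap x) = -parity 𝒱 (0, x) :=
    fun x => by simp [parity]
  have n0 : ∀ w H, L0 𝒱 (-w) H = - L0 𝒱 w H := fun w H => by
    rw [← neg_one_smul K w, (L_w 𝒱 (-1) w 0 H).2.2.1, neg_one_smul]
  have n1 : ∀ w H, L1 𝒱 (-w) H = - L1 𝒱 w H := fun w H => by
    rw [← neg_one_smul K w, (L_w 𝒱 (-1) w 0 H).2.2.2.1, neg_one_smul]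
  have a0 := fun w H => (L_w 𝒱 0 w 0 H).2.2.2.2.1
  have a1 := fun w H => (L_w 𝒱 0 w 0 H).2.2.2.2.2.1
  constructor
  · simp only [con, p, n0, a0, ← Finset.sum_neg_distrib]
    exact Finset.sum_congr rfl fun i _ => by noncomm_ring
  · simp only [con, p, n1, a1, neg_neg]
    exact Finset.sum_congr rfl fun i _ => by abel

/-- The big bracket is graded antisymmetric. -/
theorem bigBracket_skew [Module.Finite K V] (F G : BigAlg 𝒱) (a b : ℕ)
    (hF : parityB 𝒱 F = (-1 : K) ^ a • F) (hG : parityB 𝒱 G = (-1 : K) ^ b • G) :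
    bigBracket 𝒱 F G = -((-1 : K) ^ (a * b) • bigBracket 𝒱 G F) := by
  have p0 : ∀ H c, parityB 𝒱 H = (-1 : K) ^ c • H → ∀ w,
      parityB 𝒱 (L0 𝒱 w H) = (-1 : K) ^ c • L0 𝒱 w H := fun H c hH w => by
    rw [(L_w 𝒱 0 w 0 H).2.2.2.2.2.2.1, hH, L0_smul]
  have p1 : ∀ H c, parityB 𝒱 H = (-1 : K) ^ c • H → ∀ w,
      parityB 𝒱 (L1 𝒱 w H) = (-1 : K) ^ (c + 1) • L1 𝒱 w H := fun H c hH w => by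
    rw [(L_w 𝒱 0 w 0 H).2.2.2.2.2.2.2, hH, L1_smul, pow_succ]; simp
  have h0 := fun w w' => B_comm' 𝒱 (L0 𝒱 w F) (L0 𝒱 w' G) a b (p0 F a hF w) (p0 G b hG w')
  have h1 := fun w w' => B_comm' 𝒱 (L1 𝒱 w F) (L1 𝒱 w' G) (a + 1) (b + 1)
    (p1 F a hF w) (p1 G b hG w')
  have c0 : con 𝒱 (fun w => L0 𝒱 w F) (fun w => L0 𝒱 w G) =
      -((-1 : K) ^ (a * b) • con 𝒱 (fun w => L0 𝒱 w G) (fun w => L0 𝒱 w F)) := by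
    rw [(con_swap 𝒱 F G).1]
    simp only [con, h0, ← smul_add, ← Finset.smul_sum]
  have c1 : con 𝒱 (fun w => L1 𝒱 w F) (fun w => L1 𝒱 w G) =
      (-1 : K) ^ ((a + 1) * (b + 1)) • con 𝒱 (fun w => L1 𝒱 w G) (fun w => L1 𝒱 w F) := by
    rw [(con_swap 𝒱 F G).2]
    simp only [con, h1, ← smul_add, ← Finset.smul_sum]
  rw [bigBracket_hom 𝒱 F G a hF, bigBracket_hom 𝒱 G F b hG, c0, c1]
  have e : (-1 : K) ^ a * (-1) ^ ((a + 1) * (b + 1)) = -((-1) ^ (a * b) * (-1) ^ b) := by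
    have : (-1 : K) ^ a * (-1) ^ a = 1 := by rw [← mul_pow]; simp
    rw [show (a + 1) * (b + 1) = a * b + a + b + 1 by ring]
    linear_combination (-(-1 : K) ^ (a * b) * (-1) ^ b) * this
  rw [smul_smul, e, smul_sub, smul_neg, smul_smul, neg_smul]
  abel

end BigBracket

end LInf

end

open LInf

/-! Write E = V ⊕ V^*. An element of weight N in B is the same thing as a graded symmetric N-linear
form on E: bracket it with N elements of E. The actions `adR w` = [·, w] are twisted derivations
that commute up to the Koszul sign (`adR_mul`, `adR_adR`), so the iterated bracket is graded
symmetric. For dual bases a_j, b_j of E the Euler operator F ↦ ∑ [F, a_j] b_j is multiplication by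
the weight (`euler`). In characteristic 0 this gives injectivity (`eq_zero_of_iad`) and, by
induction on the weight, surjectivity: a form in N + 1 slots whose slices are represented by θ_w is
represented by (N + 1)⁻¹ ∑ θ_{a_j} b_j (`exists_iad_eq`).

An invariant bracket λ_n on E is encoded by the form ⟨λ_n(x_1, …, x_n), x_{n+1}⟩. Invariance is its
symmetry in the last two slots, so the form is graded symmetric in all of them and comes from a
unique θ_{n+1} of weight n + 1 and total degree 1. Bracketing ∑ [θ_a, θ_b], a + b = n + 3, with x_1,
…, x_n gives twice the Jacobi sum (`iad_antidiagonal`). Hence the generalized Jacobi identities say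
that [S, S] = 0 in every weight.

The passage from weights to bidegrees uses the automorphism `dil`, which is 2^l on Λ^k V^* ⊗ Λ^l V.
Its eigenvalues separate the components of a given weight, so the θ_N determine the t_{kl}, and [S,
S] = 0 may be checked by weight (`bracket_self_iff`). On arguments from V the form θ_k sees only
t_{k0}, so V being an isotropic subalgebra amounts to t_{k0} = 0. The absence of a 0-ary bracket
gives t_{01} = 0, and the V-component of λ_1 on V^* is [t_{02}, ·].

For a general quasi-triple, x ↦ (projection to g_+, ⟨x, ·⟩ on g_+) is an isometry onto g_+ ⊕ g_+^*
that matches both subspaces, and it is the only isomorphism to a double that is the identity on g_+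
(`IsIso.eq_toDouble`). An isomorphism of doubles respects both halves and the pairing, which forces
the shape f ⊕ (f⁻¹)^*. The induced map of B intertwines iterated brackets, so by injectivity it
carries S to S' exactly when the brackets correspond. -/

noncomputable section

namespace LInf

/-! ### Signs -/

/-- The sign `(-1)^a`. -/
def eps (a : ℤ) : ℤ := ((a.negOnePow : ℤˣ) : ℤ)

theorem eps_add (a b : ℤ) : eps (a + b) = eps a * eps b := by
  simp [eps, Int.negOnePow_add]

theorem eps_congr {a b : ℤ} (h : Even (a - b)) : eps a = eps b := by
  rw [eps, eps, (Int.negOnePow_eq_iff a b).2 h]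

theorem eps_mul_self (a : ℤ) : eps a * eps a = 1 := by
  simp [eps]

theorem eps_even {a : ℤ} (h : Even a) : eps a = 1 := by
  simp [eps, Int.negOnePow_even a h]

theorem eps_odd {a : ℤ} (h : Odd a) : eps a = -1 := by
  simp [eps, Int.negOnePow_odd a h]

theorem ksign_eq_eps (a b : ℤ) : ksign a b = eps ((a - 1) * (b - 1)) := rfl

theorem ksign_comm (a b : ℤ) : ksign a b = ksign b a := by
  rw [ksign_eq_eps, ksign_eq_eps, mul_comm]

theorem ksign_mul_self (a b : ℤ) : ksign a b * ksign a b = 1 := eps_mul_self _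

/-- Only parities matter. This makes the signs of the two members of a dual pair, whose degrees are
opposite, cancel. -/
theorem ksign_neg_right (a b : ℤ) : ksign a (-b) = ksign a b := by
  simp [ksign_eq]

section

variable {K : Type u} [Field K] {V : Type v} [AddCommGroup V] [Module K V]

/-! ### The grading of the double -/

/-- The degree operator `x ↦ d x` for `x ∈ V_d`. -/
def degOp (𝒱 : ℤ → Submodule K V) [h : GradedSpace 𝒱] : V →ₗ[K] V :=
  letI := h.internal.chooseDecomposition
  (DirectSum.toModule K ℤ V fun d => d • (𝒱 d).subtype) ∘ₗ
    (DirectSum.decomposeLinearEquiv 𝒱).toLinearMap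

variable (𝒱 : ℤ → Submodule K V) [GradedSpace 𝒱]

theorem degOp_apply {d : ℤ} {x : V} (hx : x ∈ 𝒱 d) : degOp 𝒱 x = d • x := by
  let _ := (GradedSpace.internal (𝒱 := 𝒱)).chooseDecomposition
  unfold degOp
  simp only [LinearMap.comp_apply, LinearEquiv.coe_coe, DirectSum.decomposeLinearEquiv_apply]
  rw [DirectSum.decompose_of_mem 𝒱 hx]
  erw [DirectSum.toModule_lof]
  rfl

theorem hom_induction {p : V → Prop} (h0 : p 0) (ha : ∀ x y, p x → p y → p (x + y))
    (hh : ∀ d, ∀ x ∈ 𝒱 d, p x) (x : V) : p x := by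
  have hx : x ∈ ⨆ i, 𝒱 i :=
    (GradedSpace.internal (𝒱 := 𝒱)).submodule_iSup_eq_top ▸ Submodule.mem_top
  induction hx using Submodule.iSup_induction' with
  | mem b x hx => exact hh b x hx
  | zero => exact h0
  | add x y _ _ hx hy => exact ha _ _ hx hy

theorem ext_hom {A : Type*} [AddCommGroup A] [Module K A] {f g : V →ₗ[K] A}
    (h : ∀ d, ∀ x ∈ 𝒱 d, f x = g x) : f = g := by
  ext x
  induction x using hom_induction 𝒱 with
  | h0 => simp
  | ha x y hx hy => simp [hx, hy]
  | hh d x hx => exact h d x hx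

theorem degOp_dual {d : ℤ} {ξ : Module.Dual K V} (hξ : ξ ∈ dualGr 𝒱 d) :
    -(degOp 𝒱).dualMap ξ = d • ξ := by
  refine ext_hom 𝒱 fun b x hx => ?_
  rw [LinearMap.neg_apply, LinearMap.dualMap_apply, degOp_apply 𝒱 hx, map_zsmul,
    LinearMap.smul_apply]
  by_cases hb : b = -d
  · subst hb; simp
  · simp [hξ b hb x hx]

theorem mem_dblGr {d : ℤ} {u : V × Module.Dual K V} :
    u ∈ dblGr 𝒱 d ↔ u.1 ∈ 𝒱 d ∧ u.2 ∈ dualGr 𝒱 d := Submodule.mem_prod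

theorem inl_mem_dblGr {d : ℤ} {x : V} (hx : x ∈ 𝒱 d) :
    ((x, 0) : V × Module.Dual K V) ∈ dblGr 𝒱 d := (mem_dblGr 𝒱).2 ⟨hx, zero_mem _⟩

theorem inr_mem_dblGr {d : ℤ} {ξ : Module.Dual K V} (hξ : ξ ∈ dualGr 𝒱 d) :
    ((0, ξ) : V × Module.Dual K V) ∈ dblGr 𝒱 d := (mem_dblGr 𝒱).2 ⟨zero_mem _, hξ⟩

/-! ### Gradings as eigenspace decompositions -/

variable [CharZero K]

/-- For a degree operator the eigenvalues are the integers, which stay distinct in characteristic 0;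
independence of a grading then comes from that of eigenspaces. -/
theorem iSupIndep_of_eigen {E : Type*} [AddCommGroup E] [Module K E] {ι : Type*}
    (f : E →ₗ[K] E) (μ : ι → K) (hμ : Function.Injective μ) (p : ι → Submodule K E)
    (h : ∀ i, ∀ x ∈ p i, f x = μ i • x) : iSupIndep p :=
  ((Module.End.eigenspaces_iSupIndep f).comp hμ).mono fun i x hx =>
    Module.End.mem_eigenspace_iff.2 (h i x hx)

/-- Injectivity of μ is required on `s` only: in the application to bidegrees the eigenvalue 2^l
separates pairs (k, l) only when k + l is fixed. -/
theorem eq_zero_of_sum_eigen {E : Type*} [AddCommGroup E] [Module K E] {ι : Type*}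
    (f : E →ₗ[K] E) (μ : ι → K) (s : Finset ι) (hμ : Set.InjOn μ s) (v : ι → E)
    (h : ∀ i ∈ s, f (v i) = μ i • v i) (hs : ∑ i ∈ s, v i = 0) : ∀ i ∈ s, v i = 0 := by
  have hi : iSupIndep fun i : s => Module.End.eigenspace f (μ i) :=
    (Module.End.eigenspaces_iSupIndep f).comp fun i j hij =>
      Subtype.ext (hμ i.2 j.2 hij)
  rw [← Finset.sum_coe_sort] at hs
  intro i hmem
  exact (iSupIndep_iff_finsetSum_eq_zero_imp_eq_zero _).1 hi Finset.univ (fun i => v i)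
    (fun i _ => Module.End.mem_eigenspace_iff.2 (h i i.2)) hs ⟨i, hmem⟩ (Finset.mem_univ _)

variable [Module.Finite K V]

instance dblGr_graded : GradedSpace (dblGr 𝒱) where
  internal := by
    rw [DirectSum.isInternal_submodule_iff_iSupIndep_and_iSup_eq_top]
    constructor
    -- A functional of degree d lives on V_{-d}, so the transposed degree operator needs a minus
    -- sign to act by d.
    · refine iSupIndep_of_eigen ((degOp 𝒱).prodMap (-(degOp 𝒱).dualMap)) (fun d : ℤ => (d : K))
        Int.cast_injective _ fun d u hu => ?_
      obtain ⟨h1, h2⟩ := (mem_dblGr 𝒱).1 hu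
      rw [LinearMap.prodMap_apply, degOp_apply 𝒱 h1, LinearMap.neg_apply, degOp_dual 𝒱 h2,
        Int.cast_smul_eq_zsmul]
      rfl
    · rw [eq_top_iff]
      rintro ⟨x, ξ⟩ -
      rw [show (x, ξ) = LinearMap.inl K V (Module.Dual K V) x +
        LinearMap.inr K V (Module.Dual K V) ξ by simp]
      refine add_mem ?_ ?_
      · have : (⨆ d, 𝒱 d).map (LinearMap.inl K V (Module.Dual K V)) ≤ ⨆ d, dblGr 𝒱 d := by
          rw [Submodule.map_iSup]
          refine iSup_mono fun d => ?_
          rintro _ ⟨x, hx, rfl⟩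
          exact inl_mem_dblGr 𝒱 hx
        exact this ⟨x, (GradedSpace.internal (𝒱 := 𝒱)).submodule_iSup_eq_top ▸ Submodule.mem_top,
          rfl⟩
      · have : (⨆ d, dualGr 𝒱 d).map (LinearMap.inr K V (Module.Dual K V)) ≤ ⨆ d, dblGr 𝒱 d := by
          rw [Submodule.map_iSup]
          refine iSup_mono fun d => ?_
          rintro _ ⟨x, hx, rfl⟩
          exact inr_mem_dblGr 𝒱 hx
        exact this ⟨ξ, iSup_dualGr 𝒱 ▸ Submodule.mem_top, rfl⟩

instance dual_graded : GradedSpace (dualGr 𝒱) where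
  internal := by
    rw [DirectSum.isInternal_submodule_iff_iSupIndep_and_iSup_eq_top]
    refine ⟨iSupIndep_of_eigen (-(degOp 𝒱).dualMap) (fun d : ℤ => (d : K))
      Int.cast_injective _ fun d u hu => ?_, iSup_dualGr 𝒱⟩
    rw [LinearMap.neg_apply, ← LinearMap.neg_apply, LinearMap.neg_apply, degOp_dual 𝒱 hu,
      Int.cast_smul_eq_zsmul]

/-! ### The pairing -/

theorem pairing_apply (u w : V × Module.Dual K V) :
    pairing 𝒱 u w = u.2 w.1 + w.2 (gradInv 𝒱 u.1) := rfl

theorem pairing_left_nondeg {u : V × Module.Dual K V} (h : ∀ w, pairing 𝒱 u w = 0) : u = 0 := by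
  obtain ⟨x, ξ⟩ := u
  have h1 : ξ = 0 := by
    ext y; simpa [pairing_apply] using h (y, 0)
  have h2 : gradInv 𝒱 x = 0 := by
    rw [← Module.forall_dual_apply_eq_zero_iff K]
    intro η
    simpa [pairing_apply] using h (0, η)
  have h3 : x = 0 := by rw [← gradInv_gradInv 𝒱 x, h2, map_zero]
  rw [h1, h3]; rfl

/-- Only the part of `w` of degree -d contributes, so the usual sign (-1)^{de} becomes (-1)^d and
`w` need not be homogeneous. -/
theorem pairing_hom_swap {d : ℤ} {u w : V × Module.Dual K V} (hu : u ∈ dblGr 𝒱 d) :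
    pairing 𝒱 u w = eps d • pairing 𝒱 w u := by
  rw [pairing_swap, parity_apply 𝒱 hu, map_zsmul, ← neg_smul]
  congr 1
  change -eps (d - 1) = eps d
  have : eps (-1) = -1 := eps_odd (by decide)
  rw [sub_eq_add_neg, eps_add, this]
  simp

theorem pairing_right_nondeg {u : V × Module.Dual K V} (h : ∀ w, pairing 𝒱 w u = 0) : u = 0 :=
  pairing_left_nondeg 𝒱 fun w => by rw [pairing_swap, ← pairing_parity, h, neg_zero]

theorem pairing_degree {d e : ℤ} {u w : V × Module.Dual K V} (hu : u ∈ dblGr 𝒱 d)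
    (hw : w ∈ dblGr 𝒱 e) (h : d + e ≠ 0) : pairing 𝒱 u w = 0 := by
  obtain ⟨h1, h2⟩ := (mem_dblGr 𝒱).1 hu
  obtain ⟨h3, h4⟩ := (mem_dblGr 𝒱).1 hw
  rw [pairing_apply, gradInv_apply 𝒱 h1, map_zsmul, h2 e (by omega) _ h3, h4 d (by omega) _ h1]
  simp

/-! ### The adjoint actions of generators -/

/-- The sign automorphism of `B` that an element of internal degree `d` produces when it is moved
past an element of `B`. -/
def sgn (d : ℤ) : BigAlg 𝒱 →ₐ[K] BigAlg 𝒱 := if Even d then parityB 𝒱 else AlgHom.id K _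

theorem sgn_even {d : ℤ} (h : Even d) : sgn 𝒱 d = parityB 𝒱 := if_pos h

theorem sgn_odd {d : ℤ} (h : Odd d) : sgn 𝒱 d = AlgHom.id K _ :=
  if_neg (Int.not_even_iff_odd.2 h)

theorem sgn_sgn (d : ℤ) (F : BigAlg 𝒱) : sgn 𝒱 d (sgn 𝒱 d F) = F := by
  rcases Int.even_or_odd d with h | h
  · simp [sgn_even 𝒱 h, parityB_parityB]
  · simp [sgn_odd 𝒱 h]

theorem sgn_comm (d e : ℤ) (F : BigAlg 𝒱) :
    sgn 𝒱 d (sgn 𝒱 e F) = sgn 𝒱 e (sgn 𝒱 d F) := by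
  rcases Int.even_or_odd d with h | h <;> rcases Int.even_or_odd e with h' | h' <;>
    simp [sgn_even, sgn_odd, h, h']

theorem sgn_neg (d : ℤ) : sgn 𝒱 (-d) = sgn 𝒱 d := by
  simp [sgn]

theorem sgn_apply (d : ℤ) {F : BigAlg 𝒱} {g : ℤ} (hF : parityB 𝒱 F = eps g • F) :
    sgn 𝒱 d F = eps ((d - 1) * g) • F := by
  rcases Int.even_or_odd d with h | h
  · rw [sgn_even 𝒱 h, hF]
    congr 1
    refine eps_congr ?_
    rw [show g - (d - 1) * g = (2 - d) * g by ring]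
    exact (even_two.sub h).mul_right _
  · rw [sgn_odd 𝒱 h, eps_even ((h.sub_odd odd_one).mul_right _)]
    simp

theorem parityB_gen_hom {e : ℤ} {u : V × Module.Dual K V} (hu : u ∈ dblGr 𝒱 e) :
    parityB 𝒱 (gen 𝒱 u) = eps (e - 1) • gen 𝒱 u := by
  rw [parityB_gen, parity_apply 𝒱 hu, map_zsmul]; rfl

theorem sgn_gen (d : ℤ) {e : ℤ} {u : V × Module.Dual K V} (hu : u ∈ dblGr 𝒱 e) :
    sgn 𝒱 d (gen 𝒱 u) = ksign d e • gen 𝒱 u :=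
  sgn_apply 𝒱 d (parityB_gen_hom 𝒱 hu)

theorem gen_mul {d : ℤ} {u} (hu : u ∈ dblGr 𝒱 d) (G : BigAlg 𝒱) :
    gen 𝒱 u * G = sgn 𝒱 d G * gen 𝒱 u := by
  rw [gen_comm 𝒱 hu, sgn]
  split_ifs <;> rfl

/-- The right adjoint action `F ↦ [F, w]` of `w ∈ V ⊕ V^*`, as a bilinear map. -/
def adR : (V × Module.Dual K V) →ₗ[K] BigAlg 𝒱 →ₗ[K] BigAlg 𝒱 :=
  LinearMap.mk₂ K (fun w F => rightBr 𝒱 w F)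
    (fun w w' F => by
      simp only [rightBr_eq, (L_w 𝒱 0 w w' F).1, (L_w 𝒱 0 w w' (parityB 𝒱 F)).2.1]; abel)
    (fun c w F => by
      simp only [rightBr_eq, (L_w 𝒱 c w w F).2.2.1, (L_w 𝒱 c w w (parityB 𝒱 F)).2.2.2.1, smul_neg,
        smul_add])
    (fun w F G => map_add _ _ _) (fun c w F => map_smul _ _ _)

/-- The left adjoint action `F ↦ [w, F]` of `w ∈ V ⊕ V^*`, as a bilinear map. -/
def adL : (V × Module.Dual K V) →ₗ[K] BigAlg 𝒱 →ₗ[K] BigAlg 𝒱 :=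
  LinearMap.mk₂ K (fun w F => leftBr 𝒱 w F)
    (fun w w' F => by
      simp only [leftBr_eq, (L_w 𝒱 0 w w' F).1, (L_w 𝒱 0 w w' F).2.1]; abel)
    (fun c w F => by
      simp only [leftBr_eq, (L_w 𝒱 c w w F).2.2.1, (L_w 𝒱 c w w F).2.2.2.1, smul_add])
    (fun w F G => map_add _ _ _) (fun c w F => map_smul _ _ _)

theorem adR_apply (w : V × Module.Dual K V) (F : BigAlg 𝒱) : adR 𝒱 w F = rightBr 𝒱 w F := rfl

theorem adL_apply (w : V × Module.Dual K V) (F : BigAlg 𝒱) : adL 𝒱 w F = leftBr 𝒱 w F := rfl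

theorem self_eq_neg_iff_zero {x : BigAlg 𝒱} (h : x = -x) : x = 0 := by
  have : (2 : K) • x = 0 := by rw [two_smul]; nth_rw 1 [h]; simp
  exact (smul_eq_zero.1 this).resolve_left two_ne_zero

/-- `L0` belongs to the part of `w` of even total degree and does not change when `w` is replaced by
`parity 𝒱 w`, which here is -w. For homogeneous `w` the adjoint action thus reduces to one of its
two halves. -/
theorem L0_even {d : ℤ} (hd : Even d) {w} (hw : w ∈ dblGr 𝒱 d) (F : BigAlg 𝒱) :
    L0 𝒱 w F = 0 := by
  have h := (L_w 𝒱 0 w w F).2.2.2.2.1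
  rw [parity_even 𝒱 hd hw, ← neg_one_smul K w, (L_w 𝒱 (-1) w w F).2.2.1, neg_one_smul] at h
  exact self_eq_neg_iff_zero 𝒱 h.symm

theorem L1_odd {d : ℤ} (hd : Odd d) {w} (hw : w ∈ dblGr 𝒱 d) (F : BigAlg 𝒱) :
    L1 𝒱 w F = 0 := by
  have h := (L_w 𝒱 0 w w F).2.2.2.2.2.1
  rw [parity_odd 𝒱 hd hw] at h
  exact self_eq_neg_iff_zero 𝒱 h

theorem adR_even {d : ℤ} (hd : Even d) {w} (hw : w ∈ dblGr 𝒱 d) (F : BigAlg 𝒱) :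
    adR 𝒱 w F = -L1 𝒱 w (parityB 𝒱 F) := by
  rw [adR_apply, rightBr_eq, L0_even 𝒱 hd hw, zero_add]

theorem adR_odd {d : ℤ} (hd : Odd d) {w} (hw : w ∈ dblGr 𝒱 d) (F : BigAlg 𝒱) :
    adR 𝒱 w F = -L0 𝒱 w F := by
  rw [adR_apply, rightBr_eq, L1_odd 𝒱 hd hw, add_zero]

theorem adL_eq {d : ℤ} {w} (hw : w ∈ dblGr 𝒱 d) (F : BigAlg 𝒱) :
    adL 𝒱 w F = -adR 𝒱 w (sgn 𝒱 d F) := by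
  rcases Int.even_or_odd d with h | h
  · rw [adR_even 𝒱 h hw, sgn_even 𝒱 h, adL_apply, leftBr_eq, L0_even 𝒱 h hw, zero_add,
      parityB_parityB, neg_neg]
  · rw [adR_odd 𝒱 h hw, sgn_odd 𝒱 h, adL_apply, leftBr_eq, L1_odd 𝒱 h hw, add_zero, neg_neg]
    rfl

/-- Acting from the right, `w` has to pass `G` before it reaches `F`, which costs `sgn 𝒱 d`. -/
theorem adR_mul {d : ℤ} {w} (hw : w ∈ dblGr 𝒱 d) (F G : BigAlg 𝒱) :
    adR 𝒱 w (F * G) = F * adR 𝒱 w G + adR 𝒱 w F * sgn 𝒱 d G := by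
  rcases Int.even_or_odd d with h | h
  · simp only [adR_even 𝒱 h hw, sgn_even 𝒱 h, map_mul, L1_mul, parityB_parityB]
    noncomm_ring
  · simp only [adR_odd 𝒱 h hw, sgn_odd 𝒱 h, L0_mul, AlgHom.id_apply]
    noncomm_ring

theorem adR_gen (w u : V × Module.Dual K V) : adR 𝒱 w (gen 𝒱 u) = pairing 𝒱 u w • 1 :=
  rightBr_gen 𝒱 w u

theorem adL_gen (w u : V × Module.Dual K V) : adL 𝒱 w (gen 𝒱 u) = pairing 𝒱 w u • 1 :=
  leftBr_gen 𝒱 w u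

theorem adR_one (w : V × Module.Dual K V) : adR 𝒱 w 1 = 0 := by
  rw [adR_apply, rightBr_eq, map_one, L0_one, L1_one]; simp

theorem adL_one (w : V × Module.Dual K V) : adL 𝒱 w 1 = 0 := by
  rw [adL_apply, leftBr_eq, L0_one, L1_one]; simp

theorem sgn_adR (e : ℤ) {d : ℤ} {w} (hw : w ∈ dblGr 𝒱 d) (F : BigAlg 𝒱) :
    sgn 𝒱 e (adR 𝒱 w F) = ksign e d • adR 𝒱 w (sgn 𝒱 e F) := by
  rcases Int.even_or_odd e with he | he
  · rcases Int.even_or_odd d with h | h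
    · rw [sgn_even 𝒱 he, adR_even 𝒱 h hw, adR_even 𝒱 h hw, ksign_eq, if_pos ⟨he, h⟩, map_neg,
        (L_w 𝒱 0 w w _).2.2.2.2.2.2.2]
      simp
    · rw [sgn_even 𝒱 he, adR_odd 𝒱 h hw, adR_odd 𝒱 h hw, ksign_eq,
        if_neg (fun hc => Int.not_even_iff_odd.2 h hc.2), map_neg,
        (L_w 𝒱 0 w w _).2.2.2.2.2.2.1]
      simp
  · rw [sgn_odd 𝒱 he, ksign_eq, if_neg (fun hc => Int.not_even_iff_odd.2 he hc.1)]
    simp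

/-- The bracket of two generators is a scalar and so brackets to zero with everything; hence their
actions commute in the graded sense. Both sides vanish on scalars and generators, and their mixed
Leibniz terms agree. -/
theorem adR_adR {d e : ℤ} {w w'} (hw : w ∈ dblGr 𝒱 d) (hw' : w' ∈ dblGr 𝒱 e) (F : BigAlg 𝒱) :
    adR 𝒱 w (adR 𝒱 w' F) = ksign d e • adR 𝒱 w' (adR 𝒱 w F) := by
  induction F using B_induction 𝒱 with
  | h1 c => simp [adR_one]
  | hg b u hu => simp [adR_gen, adR_one]
  | hm F G hF hG =>
    have hk := ksign_mul_self d e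
    simp only [adR_mul 𝒱 hw, adR_mul 𝒱 hw', map_add, hF, hG, sgn_adR 𝒱 _ hw, sgn_adR 𝒱 _ hw',
      ksign_comm e d, sgn_comm 𝒱 e d, smul_add, smul_mul_assoc, mul_smul_comm, smul_smul, hk,
      one_smul]
    abel
  | ha F G hF hG => simp [hF, hG]

/-- No sign remains: the one from exchanging the two right actions is undone by the one from moving
`sgn` past `w`. -/
theorem adR_adL {d : ℤ} {w} (hw : w ∈ dblGr 𝒱 d) (b : V × Module.Dual K V) (F : BigAlg 𝒱) :
    adR 𝒱 w (adL 𝒱 b F) = adL 𝒱 b (adR 𝒱 w F) := by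
  induction b using hom_induction (dblGr 𝒱) with
  | h0 => simp
  | ha x y hx hy => simp [hx, hy]
  | hh e b hb =>
    rw [adL_eq 𝒱 hb, adL_eq 𝒱 hb, map_neg, adR_adR 𝒱 hw hb, sgn_adR 𝒱 e hw, map_zsmul,
      ksign_comm]

theorem sgn_adL (e : ℤ) {d : ℤ} {w} (hw : w ∈ dblGr 𝒱 d) (F : BigAlg 𝒱) :
    sgn 𝒱 e (adL 𝒱 w F) = ksign e d • adL 𝒱 w (sgn 𝒱 e F) := by
  rw [adL_eq 𝒱 hw, adL_eq 𝒱 hw, map_neg, sgn_adR 𝒱 e hw, sgn_comm, smul_neg]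

theorem bigBracket_eq (F G : BigAlg 𝒱) : bigBracket 𝒱 F G =
    ∑ i, (adR 𝒱 (Module.finBasis K V i, 0) F * adL 𝒱 (0, (Module.finBasis K V).coord i) G +
      adR 𝒱 (0, (gradInv 𝒱).dualMap ((Module.finBasis K V).coord i)) F *
        adL 𝒱 (Module.finBasis K V i, 0) G) := by
  simp [bigBracket, adR_apply, adL_apply]

/-- Bracketing with a generator is the adjoint action. -/
theorem bigBracket_gen_right (F : BigAlg 𝒱) (w : V × Module.Dual K V) :
    bigBracket 𝒱 F (gen 𝒱 w) = adR 𝒱 w F := by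
  -- The expansion of `w` in the dual bases that define the big bracket, verified by pairing with an
  -- arbitrary `u`.
  have hv : ∑ i, (pairing 𝒱 (0, (Module.finBasis K V).coord i) w • (Module.finBasis K V i, 0) +
      pairing 𝒱 (Module.finBasis K V i, 0) w •
        ((0, (gradInv 𝒱).dualMap ((Module.finBasis K V).coord i)) : V × Module.Dual K V)) = w := by
    rw [← sub_eq_zero]
    refine pairing_right_nondeg 𝒱 fun u => ?_
    rw [map_sub, sub_eq_zero, ← sum_pairing 𝒱 u w, map_sum]
    exact Finset.sum_congr rfl fun i _ => by simp only [map_add, map_smul, smul_eq_mul, mul_comm]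
  rw [bigBracket_eq]
  conv_rhs => rw [← hv]
  simp only [adL_gen, mul_smul_comm, mul_one, map_sum, map_add, map_smul, LinearMap.sum_apply,
    LinearMap.add_apply, LinearMap.smul_apply]

theorem bigBracket_gen_left (F : BigAlg 𝒱) (w : V × Module.Dual K V) :
    bigBracket 𝒱 (gen 𝒱 w) F = adL 𝒱 w F := by
  have hv : ∑ i, (pairing 𝒱 w (Module.finBasis K V i, 0) • (0, (Module.finBasis K V).coord i) +
      pairing 𝒱 w (0, (gradInv 𝒱).dualMap ((Module.finBasis K V).coord i)) •
        ((Module.finBasis K V i, 0) : V × Module.Dual K V)) = w := by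
    rw [← sub_eq_zero]
    refine pairing_left_nondeg 𝒱 fun u => ?_
    rw [map_sub, LinearMap.sub_apply, sub_eq_zero, ← sum_pairing 𝒱 w u, map_sum,
      LinearMap.sum_apply]
    exact Finset.sum_congr rfl fun i _ => by
      simp only [map_add, map_smul, smul_eq_mul, LinearMap.add_apply, LinearMap.smul_apply]
  rw [bigBracket_eq]
  conv_rhs => rw [← hv]
  simp only [adR_gen, smul_mul_assoc, one_mul, map_sum, map_add, map_smul, LinearMap.sum_apply,
    LinearMap.add_apply, LinearMap.smul_apply]

theorem bigBracket_one_left (G : BigAlg 𝒱) : bigBracket 𝒱 1 G = 0 := by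
  simp [bigBracket_eq, adR_one]

theorem bigBracket_one_right (G : BigAlg 𝒱) : bigBracket 𝒱 G 1 = 0 := by
  simp [bigBracket_eq, adL_one]

/-! ### Homogeneous dual bases -/

/-- The canonical element does not depend on the basis. -/
theorem canon_basis {ι : Type*} [Fintype ι] (b : Module.Basis ι K V) {A : Type*} [AddCommGroup A]
    [Module K A] (γ : V →ₗ[K] Module.Dual K V →ₗ[K] A) :
    ∑ i, γ (Module.finBasis K V i) ((Module.finBasis K V).coord i) = ∑ j, γ (b j) (b.coord j) := by
  classical
  set e := Module.finBasis K V
  have h1 : ∀ i, e i = ∑ j, b.coord j (e i) • b j := fun i => by simp [b.sum_repr]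
  have h2 : ∀ j, b.coord j = ∑ i, b.coord j (e i) • e.coord i :=
    fun j => e.ext fun k => by simp [Finsupp.single_apply]
  conv_lhs => enter [2, i]; rw [h1 i]
  conv_rhs => enter [2, j, 2]; rw [h2 j]
  simp_rw [map_sum, map_smul, LinearMap.sum_apply, LinearMap.smul_apply]
  exact Finset.sum_comm

/-- Homogeneous dual bases of `V ⊕ V^*` for the pairing. -/
theorem exists_dual_pairs : ∃ (ι : Type v) (_ : Fintype ι) (a b : ι → V × Module.Dual K V)
    (δ : ι → ℤ), (∀ j, a j ∈ dblGr 𝒱 (δ j)) ∧ (∀ j, b j ∈ dblGr 𝒱 (-δ j)) ∧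
    (∀ F G : BigAlg 𝒱, bigBracket 𝒱 F G = ∑ j, adR 𝒱 (a j) F * adL 𝒱 (b j) G) ∧
    (∀ u, ∑ j, pairing 𝒱 u (a j) • b j = u) ∧ (∀ u, ∑ j, pairing 𝒱 (b j) u • a j = u) := by
  classical
  let bs : ∀ d, Module.Basis (Module.Basis.ofVectorSpaceIndex K (𝒱 d)) K (𝒱 d) :=
    fun d => Module.Basis.ofVectorSpace K (𝒱 d)
  let B := (GradedSpace.internal (𝒱 := 𝒱)).collectedBasis bs
  have hB : ∀ i, B i ∈ 𝒱 i.1 :=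
    fun i => (GradedSpace.internal (𝒱 := 𝒱)).collectedBasis_mem bs i
  have hc : ∀ i, B.coord i ∈ dualGr 𝒱 (-i.1) := by
    rintro ⟨d, i⟩ e he x hx
    exact (GradedSpace.internal (𝒱 := 𝒱)).collectedBasis_repr_of_mem_ne bs
      (by simpa using he) hx
  let fι := FiniteDimensional.fintypeBasisIndex B
  let e : ULift.{v} (Fin (Fintype.card (Σ d, Module.Basis.ofVectorSpaceIndex K (𝒱 d)))) ≃ _ :=
    Equiv.ulift.trans (Fintype.equivFin _).symm
  have hg : ∀ i, (gradInv 𝒱).dualMap (B.coord i) ∈ dualGr 𝒱 (-i.1) := fun i => by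
    rw [gradInv_dual 𝒱 (hc i)]
    exact zsmul_mem (hc i) _
  -- The canonical element may be computed in the homogeneous basis. This is needed for the pairing,
  -- with values in K, and for the bracket, with values in B.
  have hpair : ∀ (A : Type (max u v)) [AddCommGroup A] [Module K A]
      (β : (V × Module.Dual K V) →ₗ[K] (V × Module.Dual K V) →ₗ[K] A),
      ∑ i, (β (Module.finBasis K V i, 0) (0, (Module.finBasis K V).coord i) +
        β (0, (gradInv 𝒱).dualMap ((Module.finBasis K V).coord i)) (Module.finBasis K V i, 0)) =
      ∑ i, (β (B i, 0) (0, B.coord i) + β (0, (gradInv 𝒱).dualMap (B.coord i)) (B i, 0)) := by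
    intro A _ _ β
    rw [Finset.sum_add_distrib, Finset.sum_add_distrib]
    congr 1
    · exact canon_basis B ((β.compl₁₂ (LinearMap.inl K _ _) (LinearMap.inr K _ _)))
    · exact canon_basis B ((β.compl₁₂ (LinearMap.inr K _ _ ∘ₗ (gradInv 𝒱).dualMap)
        (LinearMap.inl K _ _)).flip)
  have key : ∀ u w, ∑ i, (pairing 𝒱 u (B i, 0) * pairing 𝒱 (0, B.coord i) w +
      pairing 𝒱 u (0, (gradInv 𝒱).dualMap (B.coord i)) * pairing 𝒱 (B i, 0) w) =
      pairing 𝒱 u w := by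
    intro u w
    -- The lift of K only adjusts the universe.
    have h := hpair (ULift.{max u v} K) ((LinearMap.mul K K).compl₁₂ (pairing 𝒱 u)
      ((pairing 𝒱).flip w) |>.compr₂ ULift.moduleEquiv.symm.toLinearMap)
    have h' := congrArg ULift.down h
    simp only [LinearMap.compr₂_apply, LinearMap.compl₁₂_apply, LinearMap.mul_apply',
      LinearMap.flip_apply, LinearEquiv.coe_coe, ← map_add, ← map_sum, sum_pairing] at h'
    exact h'.symm
  -- Each basis vector e_i occurs twice, in the pair (e_i, e^i) and in the pair (±e^i, e_i), with
  -- the sign of the grading involution in the second.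
  refine ⟨_ ⊕ _, inferInstance,
    Sum.elim (fun i => (B (e i), 0)) (fun i => (0, (gradInv 𝒱).dualMap (B.coord (e i)))),
    Sum.elim (fun i => (0, B.coord (e i))) (fun i => (B (e i), 0)),
    Sum.elim (fun i => (e i).1) (fun i => -(e i).1), ?_, ?_, ?_, ?_, ?_⟩
  · rintro (j | j)
    · exact inl_mem_dblGr 𝒱 (hB _)
    · exact inr_mem_dblGr 𝒱 (hg _)
  · rintro (j | j)
    · exact inr_mem_dblGr 𝒱 (hc _)
    · exact inl_mem_dblGr 𝒱 (by simpa using hB _)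
  · intro F G
    have := hpair (BigAlg 𝒱) ((LinearMap.mul K (BigAlg 𝒱)).compl₁₂ ((adR 𝒱).flip F)
      ((adL 𝒱).flip G))
    simp only [LinearMap.compl₁₂_apply, LinearMap.mul_apply', LinearMap.flip_apply] at this
    rw [bigBracket_eq, this, Fintype.sum_sum_type, Finset.sum_add_distrib]
    congr 1 <;> exact (Equiv.sum_comp e _).symm
  · intro u
    rw [← sub_eq_zero]
    refine pairing_left_nondeg 𝒱 fun w => ?_
    rw [map_sub, LinearMap.sub_apply, sub_eq_zero, ← key u w, map_sum, LinearMap.sum_apply,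
      Fintype.sum_sum_type, Finset.sum_add_distrib]
    simp only [map_smul, LinearMap.smul_apply, Sum.elim_inl, Sum.elim_inr, smul_eq_mul]
    congr 1
    · exact Equiv.sum_comp e fun i => pairing 𝒱 u (B i, 0) * pairing 𝒱 (0, B.coord i) w
    · exact Equiv.sum_comp e fun i => pairing 𝒱 u (0, (gradInv 𝒱).dualMap (B.coord i)) *
        pairing 𝒱 (B i, 0) w
  · intro w
    rw [← sub_eq_zero]
    refine pairing_right_nondeg 𝒱 fun u => ?_
    rw [map_sub, sub_eq_zero, ← key u w, map_sum,
      Fintype.sum_sum_type, Finset.sum_add_distrib]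
    simp only [map_smul, Sum.elim_inl, Sum.elim_inr, smul_eq_mul, mul_comm (pairing 𝒱 u _)]
    congr 1
    · exact Equiv.sum_comp e fun i => pairing 𝒱 (0, B.coord i) w * pairing 𝒱 u (B i, 0)
    · exact Equiv.sum_comp e fun i => pairing 𝒱 (B i, 0) w *
        pairing 𝒱 u (0, (gradInv 𝒱).dualMap (B.coord i))

/-- The graded Jacobi identity for a bracket with a generator. -/
theorem adR_bigBracket {d : ℤ} {w} (hw : w ∈ dblGr 𝒱 d) (F G : BigAlg 𝒱) :
    adR 𝒱 w (bigBracket 𝒱 F G) =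
      bigBracket 𝒱 F (adR 𝒱 w G) + bigBracket 𝒱 (adR 𝒱 w F) (sgn 𝒱 d G) := by
  obtain ⟨ι, _, a, b, δ, ha, hb, hbr, -, -⟩ := exists_dual_pairs 𝒱
  simp only [hbr, map_sum, ← Finset.sum_add_distrib]
  refine Finset.sum_congr rfl fun j _ => ?_
  -- In the second term `w` is exchanged with a_j, and `sgn 𝒱 d` with the action of b_j; the degrees
  -- are opposite, so the two equal signs cancel.
  rw [adR_mul 𝒱 hw, adR_adL 𝒱 hw, adR_adR 𝒱 hw (ha j), sgn_adL 𝒱 d (hb j), ksign_neg_right,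
    smul_mul_smul_comm, ksign_mul_self, one_smul]

end

section

variable {K : Type u} [Field K] {V : Type v} [AddCommGroup V] [Module K V]
variable (𝒱 : ℤ → Submodule K V) [GradedSpace 𝒱]

/-! ### Weight and degree in `B` -/

/-- Products of `N` homogeneous generators of total internal degree `d`. -/
inductive IsMon : ℕ → ℤ → BigAlg 𝒱 → Prop
  | one : IsMon 0 0 1
  | cons {N : ℕ} {d e : ℤ} {u : V × Module.Dual K V} {P : BigAlg 𝒱} (hu : u ∈ dblGr 𝒱 e)
      (hP : IsMon N d P) : IsMon (N + 1) (e + d) (gen 𝒱 u * P)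

/-- The elements of `B` of weight `N` and internal degree `d`. -/
def wt (N : ℕ) (d : ℤ) : Submodule K (BigAlg 𝒱) := Submodule.span K {P | IsMon 𝒱 N d P}

variable {𝒱}

theorem IsMon.cast {N N' : ℕ} {d d' : ℤ} {P : BigAlg 𝒱} (h : IsMon 𝒱 N d P) (hN : N = N')
    (hd : d = d') : IsMon 𝒱 N' d' P := hN ▸ hd ▸ h

theorem IsMon.mul {N M : ℕ} {d e : ℤ} {P Q : BigAlg 𝒱} (hP : IsMon 𝒱 N d P)
    (hQ : IsMon 𝒱 M e Q) : IsMon 𝒱 (N + M) (d + e) (P * Q) := by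
  induction hP with
  | one => simpa using hQ
  | cons hu _ ih =>
    rw [mul_assoc]
    exact (ih.cons hu).cast (by omega) (by ring)

theorem IsMon.mem_wt {N : ℕ} {d : ℤ} {P : BigAlg 𝒱} (h : IsMon 𝒱 N d P) : P ∈ wt 𝒱 N d :=
  Submodule.subset_span h

theorem isMon_gen {d : ℤ} {u : V × Module.Dual K V} (hu : u ∈ dblGr 𝒱 d) :
    IsMon 𝒱 1 d (gen 𝒱 u) := by
  simpa using IsMon.one.cons hu

variable (𝒱)

theorem one_mem_wt : (1 : BigAlg 𝒱) ∈ wt 𝒱 0 0 := IsMon.one.mem_wt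

theorem gen_mem_wt {d : ℤ} {u : V × Module.Dual K V} (hu : u ∈ dblGr 𝒱 d) :
    gen 𝒱 u ∈ wt 𝒱 1 d := (isMon_gen hu).mem_wt

theorem wt_cast {N N' : ℕ} {d d' : ℤ} {P : BigAlg 𝒱} (h : P ∈ wt 𝒱 N d) (hN : N = N')
    (hd : d = d') : P ∈ wt 𝒱 N' d' := hN ▸ hd ▸ h

theorem wt_mul {N M : ℕ} {d e : ℤ} {P Q : BigAlg 𝒱} (hP : P ∈ wt 𝒱 N d)
    (hQ : Q ∈ wt 𝒱 M e) : P * Q ∈ wt 𝒱 (N + M) (d + e) := by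
  induction hP using Submodule.span_induction with
  | mem P hP =>
    induction hQ using Submodule.span_induction with
    | mem Q hQ => exact (IsMon.mul hP hQ).mem_wt
    | zero => simp
    | add x y _ _ hx hy => rw [mul_add]; exact add_mem hx hy
    | smul c x _ hx => rw [mul_smul_comm]; exact Submodule.smul_mem _ _ hx
  | zero => simp
  | add x y _ _ hx hy => rw [add_mul]; exact add_mem hx hy
  | smul c x _ hx => rw [smul_mul_assoc]; exact Submodule.smul_mem _ _ hx

theorem eq_smul_one_of_mem_wt {d : ℤ} {F : BigAlg 𝒱} (h : F ∈ wt 𝒱 0 d) :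
    ∃ c : K, F = c • 1 := by
  induction h using Submodule.span_induction with
  | mem P hP => cases hP; exact ⟨1, by simp⟩
  | zero => exact ⟨0, by simp⟩
  | add x y _ _ hx hy =>
    obtain ⟨a, rfl⟩ := hx
    obtain ⟨b, rfl⟩ := hy
    exact ⟨a + b, by rw [add_smul]⟩
  | smul c x _ hx =>
    obtain ⟨a, rfl⟩ := hx
    exact ⟨c * a, by rw [smul_smul]⟩

theorem exists_gen_of_mem_wt {d : ℤ} {F : BigAlg 𝒱} (h : F ∈ wt 𝒱 1 d) :
    ∃ u ∈ dblGr 𝒱 d, F = gen 𝒱 u := by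
  induction h using Submodule.span_induction with
  | mem P hP =>
    cases hP with
    | cons hu hP =>
      cases hP
      exact ⟨_, by simpa using hu, by simp⟩
  | zero => exact ⟨0, zero_mem _, by simp⟩
  | add x y _ _ hx hy =>
    obtain ⟨a, ha, rfl⟩ := hx
    obtain ⟨b, hb, rfl⟩ := hy
    exact ⟨a + b, add_mem ha hb, by rw [map_add]⟩
  | smul c x _ hx =>
    obtain ⟨a, ha, rfl⟩ := hx
    exact ⟨c • a, Submodule.smul_mem _ _ ha, by rw [map_smul]⟩

variable [CharZero K] [Module.Finite K V]

/-- A generator of internal degree e has total degree e - 1, so N of them lower the degree by N. -/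
theorem parityB_wt {N : ℕ} {d : ℤ} {F : BigAlg 𝒱} (h : F ∈ wt 𝒱 N d) :
    parityB 𝒱 F = eps (d - N) • F := by
  induction h using Submodule.span_induction with
  | mem P hP =>
    induction hP with
    | one => simp [eps_even]
    | @cons N d e u P hu hP ih =>
      rw [map_mul, ih, parityB_gen_hom 𝒱 hu, smul_mul_smul_comm, ← eps_add]
      congr 2
      push_cast
      ring
  | zero => simp
  | add x y _ _ hx hy => rw [map_add, hx, hy, smul_add]
  | smul c x _ hx => rw [map_smul, hx, smul_comm]

theorem sgn_wt (e : ℤ) {N : ℕ} {d : ℤ} {F : BigAlg 𝒱} (h : F ∈ wt 𝒱 N d) :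
    sgn 𝒱 e F = eps ((e - 1) * (d - N)) • F := sgn_apply 𝒱 e (parityB_wt 𝒱 h)

theorem sgn_mem_wt (e : ℤ) {N : ℕ} {d : ℤ} {F : BigAlg 𝒱} (h : F ∈ wt 𝒱 N d) :
    sgn 𝒱 e F ∈ wt 𝒱 N d := by
  rw [sgn_wt 𝒱 e h]
  exact zsmul_mem h _

theorem adR_smul_one (w : V × Module.Dual K V) (c : K) : adR 𝒱 w (c • 1) = 0 := by
  rw [map_smul, adR_one, smul_zero]

theorem adR_mem_wt_zero {d : ℤ} (w : V × Module.Dual K V) {F : BigAlg 𝒱} (h : F ∈ wt 𝒱 0 d) :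
    adR 𝒱 w F = 0 := by
  obtain ⟨c, rfl⟩ := eq_smul_one_of_mem_wt 𝒱 h
  exact adR_smul_one 𝒱 w c

theorem adR_gen_mul {e : ℤ} {w : V × Module.Dual K V} (hw : w ∈ dblGr 𝒱 e)
    (u : V × Module.Dual K V) (P : BigAlg 𝒱) :
    adR 𝒱 w (gen 𝒱 u * P) = gen 𝒱 u * adR 𝒱 w P + pairing 𝒱 u w • sgn 𝒱 e P := by
  rw [adR_mul 𝒱 hw, adR_gen, smul_mul_assoc, one_mul]

theorem adR_isMon {e : ℤ} {w : V × Module.Dual K V} (hw : w ∈ dblGr 𝒱 e) {N : ℕ} {d : ℤ}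
    {P : BigAlg 𝒱} (hP : IsMon 𝒱 N d P) : ∀ M, N = M + 1 → adR 𝒱 w P ∈ wt 𝒱 M (d + e) := by
  induction hP with
  | one => intro M hM; omega
  | @cons N d' e' u P hu hP ih =>
    intro M hM
    obtain rfl : N = M := by omega
    rw [adR_gen_mul 𝒱 hw]
    refine add_mem ?_ ?_
    · cases N with
      | zero => rw [adR_mem_wt_zero 𝒱 w hP.mem_wt, mul_zero]; exact zero_mem _
      | succ M =>
        exact wt_cast 𝒱 (wt_mul 𝒱 (gen_mem_wt 𝒱 hu) (ih M rfl)) (by omega) (by ring)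
    · by_cases h : e' + e = 0
      · exact Submodule.smul_mem _ _ (wt_cast 𝒱 (sgn_mem_wt 𝒱 e hP.mem_wt) rfl (by linarith))
      · rw [pairing_degree 𝒱 hu hw h, zero_smul]
        exact zero_mem _

theorem adR_mem_wt {e : ℤ} {w : V × Module.Dual K V} (hw : w ∈ dblGr 𝒱 e) {N : ℕ} {d : ℤ}
    {F : BigAlg 𝒱} (hF : F ∈ wt 𝒱 (N + 1) d) : adR 𝒱 w F ∈ wt 𝒱 N (d + e) := by
  induction hF using Submodule.span_induction with
  | mem P hP => exact adR_isMon 𝒱 hw hP N rfl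
  | zero => simp
  | add x y _ _ hx hy => rw [map_add]; exact add_mem hx hy
  | smul c x _ hx => rw [map_smul]; exact Submodule.smul_mem _ _ hx

theorem adL_mem_wt {e : ℤ} {w : V × Module.Dual K V} (hw : w ∈ dblGr 𝒱 e) {N : ℕ} {d : ℤ}
    {F : BigAlg 𝒱} (hF : F ∈ wt 𝒱 (N + 1) d) : adL 𝒱 w F ∈ wt 𝒱 N (d + e) := by
  rw [adL_eq 𝒱 hw]
  exact neg_mem (adR_mem_wt 𝒱 hw (sgn_mem_wt 𝒱 e hF))

theorem bigBracket_mem_wt {N M : ℕ} {d e : ℤ} {F G : BigAlg 𝒱} (hF : F ∈ wt 𝒱 (N + 1) d)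
    (hG : G ∈ wt 𝒱 (M + 1) e) : bigBracket 𝒱 F G ∈ wt 𝒱 (N + M) (d + e) := by
  obtain ⟨ι, _, a, b, δ, ha, hb, hbr, -, -⟩ := exists_dual_pairs 𝒱
  rw [hbr]
  exact sum_mem fun j _ => wt_cast 𝒱 (wt_mul 𝒱 (adR_mem_wt 𝒱 (ha j) hF) (adL_mem_wt 𝒱 (hb j) hG))
    rfl (by ring)

/-- The Euler operator multiplies by the weight. -/
theorem euler {ι : Type*} [Fintype ι] {a b : ι → V × Module.Dual K V} {δ : ι → ℤ}
    (ha : ∀ j, a j ∈ dblGr 𝒱 (δ j)) (hb : ∀ j, b j ∈ dblGr 𝒱 (-δ j))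
    (hab : ∀ u, ∑ j, pairing 𝒱 u (a j) • b j = u) {N : ℕ} {d : ℤ}
    {F : BigAlg 𝒱} (hF : F ∈ wt 𝒱 N d) :
    ∑ j, adR 𝒱 (a j) F * gen 𝒱 (b j) = (N : K) • F := by
  induction hF using Submodule.span_induction with
  | mem P hP =>
    induction hP with
    | one => simp [adR_one]
    | @cons N d e u P hu hP ih =>
      have h : ∀ j, adR 𝒱 (a j) (gen 𝒱 u * P) * gen 𝒱 (b j) =
          gen 𝒱 u * (adR 𝒱 (a j) P * gen 𝒱 (b j)) +
            gen 𝒱 (pairing 𝒱 u (a j) • b j) * P := by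
        intro j
        -- The sign operator left on `P` by the Leibniz rule is the one that appears when b_j is
        -- moved from the left of `P` to its right.
        rw [adR_gen_mul 𝒱 (ha j), map_smul, smul_mul_assoc, gen_mul 𝒱 (hb j), sgn_neg, add_mul,
          smul_mul_assoc, mul_assoc]
      simp only [h, Finset.sum_add_distrib]
      rw [← Finset.mul_sum, ih, ← Finset.sum_mul, ← map_sum, hab, mul_smul_comm]
      push_cast
      rw [add_smul, one_smul]
  | zero => simp
  | add x y _ _ hx hy => simp only [map_add, add_mul, Finset.sum_add_distrib, hx, hy, smul_add]
  | smul c x _ hx =>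
    simp only [map_smul, smul_mul_assoc, ← Finset.smul_sum, hx]
    rw [smul_comm]

/-- The Euler operator kills such an `F`, but it also multiplies it by N + 1, which is invertible in
characteristic 0. -/
theorem eq_zero_of_adR {N : ℕ} {d : ℤ} {F : BigAlg 𝒱} (hF : F ∈ wt 𝒱 (N + 1) d)
    (h : ∀ e, ∀ w ∈ dblGr 𝒱 e, adR 𝒱 w F = 0) : F = 0 := by
  obtain ⟨ι, _, a, b, δ, ha, hb, -, hab, -⟩ := exists_dual_pairs 𝒱
  have := euler 𝒱 ha hb hab hF
  simp only [h _ _ (ha _), zero_mul, Finset.sum_const_zero] at this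
  exact (smul_eq_zero.1 this.symm).resolve_left (Nat.cast_ne_zero.2 (Nat.succ_ne_zero N))

theorem one_ne_zero_B : (1 : BigAlg 𝒱) ≠ 0 := by
  intro h
  -- The augmentation, which sends all generators to 0, separates 1 from 0.
  have := congrArg (liftB 𝒱 (A := K) 0 (by simp)) h
  simp at this

theorem smul_one_inj {a b : K} (h : a • (1 : BigAlg 𝒱) = b • 1) : a = b := by
  have : (a - b) • (1 : BigAlg 𝒱) = 0 := by rw [sub_smul, h, sub_self]
  exact sub_eq_zero.1 ((smul_eq_zero.1 this).resolve_right (one_ne_zero_B 𝒱))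

/-- The pairing with u can be read off from the adjoint actions on `gen 𝒱 u`, and the pairing is
nondegenerate. -/
theorem gen_injective : Function.Injective (gen 𝒱) := by
  refine (injective_iff_map_eq_zero _).2 fun u hu => pairing_left_nondeg 𝒱 fun w => ?_
  have h := adR_gen 𝒱 w u
  rw [hu, map_zero] at h
  exact smul_one_inj 𝒱 (by rw [← h, zero_smul])

/-! ### Iterated adjoint actions -/

theorem iad_nil (F : BigAlg 𝒱) : iad 𝒱 F [] = F := rfl

theorem iad_cons (F : BigAlg 𝒱) (w : V × Module.Dual K V) (l : List (V × Module.Dual K V)) :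
    iad 𝒱 F (w :: l) = iad 𝒱 (adR 𝒱 w F) l := by
  rw [iad, List.foldl_cons, bigBracket_gen_right]; rfl

theorem iad_concat (F : BigAlg 𝒱) (l : List (V × Module.Dual K V)) (w : V × Module.Dual K V) :
    iad 𝒱 F (l ++ [w]) = adR 𝒱 w (iad 𝒱 F l) := by
  rw [iad, List.foldl_append, List.foldl_cons, List.foldl_nil, bigBracket_gen_right]; rfl

/-- The iterated adjoint action as a linear map. -/
def iadLin : List (V × Module.Dual K V) → BigAlg 𝒱 →ₗ[K] BigAlg 𝒱
  | [] => LinearMap.id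
  | w :: l => iadLin l ∘ₗ adR 𝒱 w

theorem iad_eq_iadLin (F : BigAlg 𝒱) (l : List (V × Module.Dual K V)) :
    iad 𝒱 F l = iadLin 𝒱 l F := by
  induction l generalizing F with
  | nil => rfl
  | cons w l ih => rw [iad_cons, ih]; rfl

theorem iad_add (F G : BigAlg 𝒱) (l : List (V × Module.Dual K V)) :
    iad 𝒱 (F + G) l = iad 𝒱 F l + iad 𝒱 G l := by
  simp only [iad_eq_iadLin, map_add]

theorem iad_sub (F G : BigAlg 𝒱) (l : List (V × Module.Dual K V)) :
    iad 𝒱 (F - G) l = iad 𝒱 F l - iad 𝒱 G l := by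
  simp only [iad_eq_iadLin, map_sub]

theorem iad_zero (l : List (V × Module.Dual K V)) : iad 𝒱 0 l = 0 := by
  simp only [iad_eq_iadLin, map_zero]

theorem iad_smul (c : K) (F : BigAlg 𝒱) (l : List (V × Module.Dual K V)) :
    iad 𝒱 (c • F) l = c • iad 𝒱 F l := by
  simp only [iad_eq_iadLin, map_smul]

theorem iad_zsmul (c : ℤ) (F : BigAlg 𝒱) (l : List (V × Module.Dual K V)) :
    iad 𝒱 (c • F) l = c • iad 𝒱 F l := by
  simp only [iad_eq_iadLin, map_zsmul]

theorem iad_sum {ι : Type*} (s : Finset ι) (F : ι → BigAlg 𝒱) (l : List (V × Module.Dual K V)) :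
    iad 𝒱 (∑ i ∈ s, F i) l = ∑ i ∈ s, iad 𝒱 (F i) l := by
  simp only [iad_eq_iadLin, map_sum]

/-- The iterated adjoint action as a multilinear map. -/
def iadM : ∀ n : ℕ, BigAlg 𝒱 →ₗ[K] MultilinearMap K (fun _ : Fin n => V × Module.Dual K V)
    (BigAlg 𝒱)
  | 0 =>
    { toFun := fun F => MultilinearMap.constOfIsEmpty K _ F
      map_add' := fun _ _ => rfl
      map_smul' := fun _ _ => rfl }
  | n + 1 =>
    { toFun := fun F => LinearMap.uncurryLeft (iadM n ∘ₗ (adR 𝒱).flip F)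
      map_add' := fun F G => by ext x; simp
      map_smul' := fun c F => by ext x; simp }

theorem iadM_apply {n : ℕ} (F : BigAlg 𝒱) (x : Fin n → V × Module.Dual K V) :
    iadM 𝒱 n F x = iad 𝒱 F (List.ofFn x) := by
  induction n generalizing F with
  | zero => rfl
  | succ n ih =>
    rw [List.ofFn_succ, iad_cons, ← ih]
    rfl

/-- Sign and degree rules are stated for homogeneous arguments, whereas brackets are compared on all
arguments; this bridges the two. -/
theorem multilinear_ext_hom {E : Type*} [AddCommGroup E] [Module K E] (gr : ℤ → Submodule K E)
    [GradedSpace gr] {A : Type*} [AddCommGroup A] [Module K A] {n : ℕ}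
    {f g : MultilinearMap K (fun _ : Fin n => E) A}
    (h : ∀ (x : Fin n → E) (δ : Fin n → ℤ), (∀ i, x i ∈ gr (δ i)) → f x = g x) : f = g := by
  induction n with
  | zero => ext x; exact h x 0 (fun i => i.elim0)
  | succ n ih =>
    have hc : f.curryLeft = g.curryLeft := ext_hom gr fun d w hw => ih fun x δ hx => by
      rw [MultilinearMap.curryLeft_apply, MultilinearMap.curryLeft_apply]
      refine h _ (Fin.cons d δ) fun i => ?_
      refine Fin.cases ?_ (fun i => ?_) i
      · simpa using hw
      · simpa using hx i
    ext x
    rw [← Fin.cons_self_tail x, ← MultilinearMap.curryLeft_apply, hc,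
      MultilinearMap.curryLeft_apply]

/-- The entries of `l` are homogeneous of the degrees listed in `D`. -/
abbrev HomList (l : List (V × Module.Dual K V)) (D : List ℤ) : Prop :=
  List.Forall₂ (fun w d => w ∈ dblGr 𝒱 d) l D

theorem homList_map {ι : Type*} (x : ι → V × Module.Dual K V) (δ : ι → ℤ)
    (h : ∀ i, x i ∈ dblGr 𝒱 (δ i)) (s : List ι) : HomList 𝒱 (s.map x) (s.map δ) := by
  induction s with
  | nil => exact List.Forall₂.nil
  | cons i s ih => exact List.Forall₂.cons (h i) ih

theorem homList_ofFn {n : ℕ} {x : Fin n → V × Module.Dual K V} {δ : Fin n → ℤ}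
    (h : ∀ i, x i ∈ dblGr 𝒱 (δ i)) : HomList 𝒱 (List.ofFn x) (List.ofFn δ) := by
  rw [List.ofFn_eq_map, List.ofFn_eq_map]
  exact homList_map 𝒱 x δ h _

theorem iad_mem_wt {l : List (V × Module.Dual K V)} {D : List ℤ} (h : HomList 𝒱 l D) {N : ℕ}
    {d : ℤ} {F : BigAlg 𝒱} (hF : F ∈ wt 𝒱 (N + l.length) d) :
    iad 𝒱 F l ∈ wt 𝒱 N (d + D.sum) := by
  induction h generalizing F d with
  | nil => simpa [iad_nil] using hF
  | cons hw _ ih =>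
    rw [iad_cons, List.sum_cons, ← add_assoc]
    exact ih (adR_mem_wt 𝒱 hw hF)

theorem iad_smul_one (c : K) (l : List (V × Module.Dual K V)) :
    ∃ c' : K, iad 𝒱 (c • 1) l = c' • 1 := by
  cases l with
  | nil => exact ⟨c, rfl⟩
  | cons w l => exact ⟨0, by rw [iad_cons, adR_smul_one, iad_zero, zero_smul]⟩

/-- Bracketing at least `N` times makes an element of weight `N` a scalar. -/
theorem iad_eq_smul_one {l : List (V × Module.Dual K V)} {D : List ℤ} (h : HomList 𝒱 l D) {N : ℕ}
    {d : ℤ} {F : BigAlg 𝒱} (hF : F ∈ wt 𝒱 N d) (hN : N ≤ l.length) :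
    ∃ c : K, iad 𝒱 F l = c • 1 := by
  induction h generalizing F d N with
  | nil =>
    obtain rfl : N = 0 := by simpa using hN
    exact eq_smul_one_of_mem_wt 𝒱 hF
  | cons hw _ ih =>
    cases N with
    | zero =>
      obtain ⟨c, rfl⟩ := eq_smul_one_of_mem_wt 𝒱 hF
      exact iad_smul_one 𝒱 c _
    | succ N =>
      rw [iad_cons]
      exact ih (adR_mem_wt 𝒱 hw hF) (by simpa using hN)

/-- Injectivity of the passage from elements of weight N to N-linear forms, by peeling off one
argument at a time with `eq_zero_of_adR`. -/
theorem eq_zero_of_iad {N : ℕ} {d : ℤ} {F : BigAlg 𝒱} (hF : F ∈ wt 𝒱 N d)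
    (h : ∀ (x : Fin N → V × Module.Dual K V) (δ : Fin N → ℤ), (∀ i, x i ∈ dblGr 𝒱 (δ i)) →
      iad 𝒱 F (List.ofFn x) = 0) : F = 0 := by
  induction N generalizing F d with
  | zero => simpa [iad_nil] using h Fin.elim0 Fin.elim0 (fun i => i.elim0)
  | succ N ih =>
    refine eq_zero_of_adR 𝒱 hF fun e w hw => ih (adR_mem_wt 𝒱 hw hF) fun x δ hx => ?_
    have := h (Fin.cons w x) (Fin.cons e δ) (fun i => by
      refine Fin.cases ?_ (fun i => ?_) i
      · simpa using hw
      · simpa using hx i)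
    rwa [List.ofFn_cons, iad_cons] at this

theorem eq_of_iad {N : ℕ} {d : ℤ} {F G : BigAlg 𝒱} (hF : F ∈ wt 𝒱 N d) (hG : G ∈ wt 𝒱 N d)
    (h : ∀ (x : Fin N → V × Module.Dual K V) (δ : Fin N → ℤ), (∀ i, x i ∈ dblGr 𝒱 (δ i)) →
      iad 𝒱 F (List.ofFn x) = iad 𝒱 G (List.ofFn x)) : F = G :=
  sub_eq_zero.1 <| eq_zero_of_iad 𝒱 (sub_mem hF hG) fun x δ hx => by
    rw [iad_sub, h x δ hx, sub_self]

/-! ### Graded symmetric forms -/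

/-- Graded symmetry of a multilinear map on a graded space. -/
def GradedSymm {E : Type*} [AddCommGroup E] [Module K E] (gr : ℤ → Submodule K E) {A : Type*}
    [AddCommGroup A] [Module K A] {n : ℕ} (c : MultilinearMap K (fun _ : Fin n => E) A) : Prop :=
  ∀ (x : Fin n → E) (δ : Fin n → ℤ), (∀ i, x i ∈ gr (δ i)) → ∀ i j : Fin n, (j : ℕ) = i + 1 →
    c (x ∘ Equiv.swap i j) = ksign (δ i) (δ j) • c x

/-- A multilinear form of degree `d`. -/
def FormDegree {E : Type*} [AddCommGroup E] [Module K E] (gr : ℤ → Submodule K E)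
    {n : ℕ} (c : MultilinearMap K (fun _ : Fin n => E) K) (d : ℤ) : Prop :=
  ∀ (x : Fin n → E) (δ : Fin n → ℤ), (∀ i, x i ∈ gr (δ i)) → ∑ i, δ i + d ≠ 0 → c x = 0

theorem cons_swap_succ {E : Type*} {n : ℕ} (w : E) (x : Fin n → E) (i j : Fin n) :
    (Fin.cons w x : Fin (n + 1) → E) ∘ Equiv.swap i.succ j.succ =
      Fin.cons w (x ∘ Equiv.swap i j) := by
  funext k
  refine Fin.cases ?_ (fun k => ?_) k
  · rw [Function.comp_apply, Equiv.swap_apply_of_ne_of_ne (Fin.succ_ne_zero _).symm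
      (Fin.succ_ne_zero _).symm]
    rfl
  · simp only [Function.comp_apply, Fin.cons_succ]
    rw [Equiv.swap_apply_def, Equiv.swap_apply_def]
    simp only [Fin.succ_inj]
    split_ifs <;> simp

theorem cons_cons_swap {E : Type*} {n : ℕ} (w w' : E) (x : Fin n → E) :
    (Fin.cons w (Fin.cons w' x : Fin (n + 1) → E) : Fin (n + 2) → E) ∘ Equiv.swap 0 1 =
      Fin.cons w' (Fin.cons w x : Fin (n + 1) → E) := by
  funext k
  refine Fin.cases ?_ (fun k => Fin.cases ?_ (fun k => ?_) k) k
  · simp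
  · simp
  · rw [Function.comp_apply, Equiv.swap_apply_of_ne_of_ne (Fin.succ_ne_zero _)
      (by simp [Fin.ext_iff])]
    simp

theorem cons_hom {E : Type*} [AddCommGroup E] [Module K E] {gr : ℤ → Submodule K E} {n : ℕ}
    {w : E} {e : ℤ} (hw : w ∈ gr e) {x : Fin n → E} {δ : Fin n → ℤ} (hx : ∀ i, x i ∈ gr (δ i))
    (i : Fin (n + 1)) :
    (Fin.cons w x : Fin (n + 1) → E) i ∈ gr ((Fin.cons e δ : Fin (n + 1) → ℤ) i) := by
  refine Fin.cases ?_ (fun i => ?_) i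
  · simpa using hw
  · simpa using hx i

theorem GradedSymm.curryLeft {E : Type*} [AddCommGroup E] [Module K E] {gr : ℤ → Submodule K E}
    {A : Type*} [AddCommGroup A] [Module K A] {n : ℕ}
    {c : MultilinearMap K (fun _ : Fin (n + 1) => E) A}
    (h : GradedSymm gr c) {e : ℤ} {w : E} (hw : w ∈ gr e) : GradedSymm gr (c.curryLeft w) := by
  intro x δ hx i j hij
  have := h (Fin.cons w x) (Fin.cons e δ) (cons_hom hw hx) i.succ j.succ (by simp [hij])
  rw [cons_swap_succ] at this
  simpa using this

theorem FormDegree.curryLeft {E : Type*} [AddCommGroup E] [Module K E] {gr : ℤ → Submodule K E}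
    {n : ℕ} {c : MultilinearMap K (fun _ : Fin (n + 1) => E) K} {d : ℤ}
    (h : FormDegree gr c d) {e : ℤ} {w : E} (hw : w ∈ gr e) :
    FormDegree gr (c.curryLeft w) (d + e) := by
  intro x δ hx hne
  rw [MultilinearMap.curryLeft_apply]
  refine h _ _ (cons_hom hw hx) ?_
  rw [Fin.sum_univ_succ]
  simp only [Fin.cons_zero, Fin.cons_succ]
  intro h0
  exact hne (by linarith)

/-- Every graded symmetric multilinear form is the iterated adjoint action of an element of `B`. -/
theorem exists_iad_eq {N : ℕ} (c : MultilinearMap K (fun _ : Fin N => V × Module.Dual K V) K)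
    {d : ℤ} (hs : GradedSymm (dblGr 𝒱) c) (hd : FormDegree (dblGr 𝒱) c d) :
    ∃ θ ∈ wt 𝒱 N d, ∀ (x : Fin N → V × Module.Dual K V) (δ : Fin N → ℤ),
      (∀ i, x i ∈ dblGr 𝒱 (δ i)) → iad 𝒱 θ (List.ofFn x) = c x • 1 := by
  induction N generalizing d with
  | zero =>
    by_cases h0 : d = 0
    · subst h0
      refine ⟨c Fin.elim0 • 1, Submodule.smul_mem _ _ (one_mem_wt 𝒱), fun x δ hx => ?_⟩
      rw [Subsingleton.elim x Fin.elim0]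
      rfl
    · refine ⟨0, zero_mem _, fun x δ hx => ?_⟩
      rw [hd x δ hx (by simpa using h0), iad_zero, zero_smul]
  | succ N ih =>
    obtain ⟨ι, _, a, b, δ, ha, hb, -, hab, hba⟩ := exists_dual_pairs 𝒱
    -- By induction every slice c(w, ·) is represented by some θ_w. The task is to find one element
    -- whose bracket with each `w` is θ_w.
    choose θ hθ hiad using fun (e : ℤ) (w) (hw : w ∈ dblGr 𝒱 e) =>
      ih (c.curryLeft w) (hs.curryLeft hw) (hd.curryLeft hw)
    -- The integrability condition: it expresses the symmetry of `c` in its first two slots. If the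
    -- slices have weight 0, both sides vanish.
    have hcomm : ∀ (e : ℤ) (w) (hw : w ∈ dblGr 𝒱 e) (j : ι), adR 𝒱 w (θ _ _ (ha j)) =
        ksign e (δ j) • adR 𝒱 (a j) (θ e w hw) := by
      intro e w hw j
      cases N with
      | zero => rw [adR_mem_wt_zero 𝒱 _ (hθ _ _ _), adR_mem_wt_zero 𝒱 _ (hθ _ _ _), smul_zero]
      | succ M =>
        refine eq_of_iad 𝒱 (adR_mem_wt 𝒱 hw (hθ _ _ (ha j)))
          (zsmul_mem (wt_cast 𝒱 (adR_mem_wt 𝒱 (ha j) (hθ e w hw)) rfl (by ring)) _)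
          fun x ν hx => ?_
        have h1 := hiad _ _ (ha j) (Fin.cons w x) _ (cons_hom hw hx)
        have h2 := hiad e w hw (Fin.cons (a j) x) _ (cons_hom (ha j) hx)
        rw [List.ofFn_cons, iad_cons, MultilinearMap.curryLeft_apply] at h1 h2
        have h3 := hs (Fin.cons w (Fin.cons (a j) x : Fin (M + 1) → _)) _
          (cons_hom hw (cons_hom (ha j) hx)) 0 1 rfl
        rw [cons_cons_swap] at h3
        rw [iad_zsmul, h1, h2, h3, smul_assoc]
        rfl
    -- The θ_w were chosen independently of each other; uniqueness makes them linear in `w`.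
    have hlin : ∀ (e : ℤ) (w) (hw : w ∈ dblGr 𝒱 e),
        ∑ j, pairing 𝒱 (b j) w • θ _ _ (ha j) = θ e w hw := by
      intro e w hw
      refine eq_of_iad 𝒱 (sum_mem fun j _ => ?_) (hθ e w hw) fun x ν hx => ?_
      · by_cases h : -δ j + e = 0
        · exact Submodule.smul_mem _ _ (wt_cast 𝒱 (hθ _ _ (ha j)) rfl (by linarith))
        · rw [pairing_degree 𝒱 (hb j) hw h, zero_smul]
          exact zero_mem _
      · simp only [iad_sum, iad_smul, hiad _ _ _ x ν hx, smul_smul]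
        rw [← Finset.sum_smul]
        congr 1
        conv_rhs => rw [← hba w]
        simp
    -- `euler` in weight N + 1 leaves no other choice for the witness.
    refine ⟨((N : K) + 1)⁻¹ • ∑ j, θ _ _ (ha j) * gen 𝒱 (b j), Submodule.smul_mem _ _
      (sum_mem fun j _ => wt_cast 𝒱 (wt_mul 𝒱 (hθ _ _ (ha j)) (gen_mem_wt 𝒱 (hb j))) rfl (by ring)),
      fun x ν hx => ?_⟩
    -- By the Leibniz rule the terms where b_j is hit sum to θ_w. The others, after `hcomm`, form
    -- the Euler operator on θ_w and sum to N θ_w.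
    have hmain : adR 𝒱 (x 0) (((N : K) + 1)⁻¹ • ∑ j, θ _ _ (ha j) * gen 𝒱 (b j)) =
        θ _ _ (hx 0) := by
      have h1 : ∀ j, adR 𝒱 (x 0) (θ _ _ (ha j) * gen 𝒱 (b j)) =
          pairing 𝒱 (b j) (x 0) • θ _ _ (ha j) +
            adR 𝒱 (a j) (θ _ _ (hx 0)) * gen 𝒱 (b j) := by
        intro j
        rw [adR_mul 𝒱 (hx 0), adR_gen, mul_smul_comm, mul_one, sgn_gen 𝒱 _ (hb j), hcomm,
          ksign_neg_right, smul_mul_smul_comm, ksign_mul_self, one_smul]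
      rw [map_smul, map_sum]
      simp only [h1, Finset.sum_add_distrib]
      rw [hlin, euler 𝒱 ha hb hab (hθ _ _ (hx 0)), show ∀ z : BigAlg 𝒱, z + (N : K) • z =
        ((N : K) + 1) • z from fun z => by rw [add_smul, one_smul, add_comm], smul_smul,
        inv_mul_cancel₀ (by exact_mod_cast Nat.succ_ne_zero N), one_smul]
    rw [List.ofFn_succ, iad_cons, hmain, hiad _ _ (hx 0) (fun i => x i.succ) (fun i => ν i.succ)
      (fun i => hx i.succ), MultilinearMap.curryLeft_apply]
    congr 2
    exact Fin.cons_self_tail x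

end

/-! ### Sums over unshuffles -/

/-- The elements of `I` in increasing order. -/
def idx {n : ℕ} (I : Finset (Fin n)) : List (Fin n) := (List.finRange n).filter (· ∈ I)

theorem length_idx {n : ℕ} (I : Finset (Fin n)) : (idx I).length = I.card := by
  rw [idx, ← List.toFinset_card_of_nodup ((List.nodup_finRange n).filter _)]
  congr 1
  ext i
  simp

theorem ofFn_orderEmbOfFin {n : ℕ} (I : Finset (Fin n)) :
    List.ofFn (fun i => I.orderEmbOfFin rfl i) = idx I := by
  have h1 : (List.ofFn (fun i => I.orderEmbOfFin rfl i)).Pairwise (· < ·) := by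
    rw [List.pairwise_ofFn]
    intro i j hij
    exact (I.orderEmbOfFin rfl).strictMono hij
  have h2 : (idx I).Pairwise (· < ·) := (List.pairwise_lt_finRange n).filter _
  refine List.Perm.eq_of_pairwise (le := (· < ·)) (fun a b _ _ h h' => absurd h (lt_asymm h')) h1 h2 ?_
  rw [List.perm_ext_iff_of_nodup (h1.imp fun h => h.ne) (h2.imp fun h => h.ne)]
  intro a
  rw [List.mem_ofFn']
  change a ∈ Set.range (I.orderEmbOfFin rfl) ↔ _
  rw [Finset.range_orderEmbOfFin]
  simp [idx]

theorem ofFn_comp_orderEmbOfFin {n : ℕ} {E : Type*} (x : Fin n → E) (I : Finset (Fin n)) :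
    List.ofFn (fun i => x (I.orderEmbOfFin rfl i)) = (idx I).map x := by
  rw [← ofFn_orderEmbOfFin, List.map_ofFn]; rfl

theorem idx_map_succ {n : ℕ} (I : Finset (Fin n)) :
    idx (I.map (Fin.succEmb n)) = (idx I).map Fin.succ := by
  rw [idx, List.finRange_succ, List.filter_cons_of_neg (by simp), List.filter_map, idx]
  congr 1
  refine List.filter_congr fun i _ => ?_
  simp

theorem idx_insert_zero {n : ℕ} (I : Finset (Fin n)) :
    idx (insert 0 (I.map (Fin.succEmb n))) = 0 :: (idx I).map Fin.succ := by
  rw [idx, List.finRange_succ, List.filter_cons_of_pos (by simp), List.filter_map, idx]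
  congr 2
  refine List.filter_congr fun i _ => ?_
  simp

theorem compl_map_succ {n : ℕ} (I : Finset (Fin n)) :
    (I.map (Fin.succEmb n))ᶜ = insert 0 (Iᶜ.map (Fin.succEmb n)) := by
  ext i
  refine Fin.cases ?_ (fun i => ?_) i <;> simp

theorem compl_insert_zero {n : ℕ} (I : Finset (Fin n)) :
    (insert 0 (I.map (Fin.succEmb n)))ᶜ = Iᶜ.map (Fin.succEmb n) := by
  ext i
  refine Fin.cases ?_ (fun i => ?_) i <;> simp

/-- Splits the subsets by whether they contain 0; it drives the inductions that peel off the first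
argument. -/
theorem sum_finset_succ {n : ℕ} {A : Type*} [AddCommGroup A] (f : Finset (Fin (n + 1)) → A) :
    ∑ I, f I = ∑ I : Finset (Fin n), f (I.map (Fin.succEmb n)) +
      ∑ I : Finset (Fin n), f (insert 0 (I.map (Fin.succEmb n))) := by
  have h0 : (0 : Fin (n + 1)) ∉ Finset.univ.map (Fin.succEmb n) := by simp
  have h : ∀ g : Finset (Fin (n + 1)) → A, ∑ I ∈ (Finset.univ.map (Fin.succEmb n)).powerset, g I =
      ∑ I : Finset (Fin n), g (I.map (Fin.succEmb n)) := by
    intro g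
    refine (Finset.sum_bij (fun I _ => I.map (Fin.succEmb n)) ?_ ?_ ?_ ?_).symm
    · intro I _
      rw [Finset.mem_powerset]
      exact Finset.map_subset_map.2 (Finset.subset_univ _)
    · intro I _ J _ hIJ
      exact Finset.map_injective _ hIJ
    · intro I hI
      obtain ⟨J, -, rfl⟩ := Finset.subset_map_iff.1 (Finset.mem_powerset.1 hI)
      exact ⟨J, Finset.mem_univ _, rfl⟩
    · intro I _; rfl
  rw [← h, ← h (fun I => f (insert 0 I)), ← Finset.sum_powerset_insert h0, ← Finset.powerset_univ]
  congr 2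
  ext i
  refine Fin.cases ?_ (fun i => ?_) i <;> simp

theorem prod_ksign {ι : Type*} (I : Finset ι) (d : ι → ℤ) (e : ℤ) :
    ∏ i ∈ I, ksign (d i) e = eps ((∑ i ∈ I, (d i - 1)) * (e - 1)) := by
  classical
  induction I using Finset.induction_on with
  | empty => simp [eps]
  | insert a s ha ih =>
    rw [Finset.prod_insert ha, Finset.sum_insert ha, ih, add_mul, eps_add]; rfl

/-- The index 0 precedes all others and stays behind, so every element of the block has to jump over
it. If 0 belongs to the block it is already in front and costs nothing. -/
theorem unshuffleSign_map_succ {n : ℕ} (d : Fin (n + 1) → ℤ) (I : Finset (Fin n)) :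
    unshuffleSign d (I.map (Fin.succEmb n)) =
      eps ((∑ i ∈ I, (d i.succ - 1)) * (d 0 - 1)) * unshuffleSign (fun i => d i.succ) I := by
  rw [unshuffleSign, compl_map_succ, Finset.prod_map, ← prod_ksign, unshuffleSign,
    ← Finset.prod_mul_distrib]
  refine Finset.prod_congr rfl fun i _ => ?_
  rw [Finset.filter_insert, if_pos (by simp),
    Finset.prod_insert (fun h => by simpa using (Finset.mem_filter.1 h).1), Finset.filter_map,
    Finset.prod_map]
  simp [Function.comp_def]

theorem unshuffleSign_insert_zero {n : ℕ} (d : Fin (n + 1) → ℤ) (I : Finset (Fin n)) :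
    unshuffleSign d (insert 0 (I.map (Fin.succEmb n))) = unshuffleSign (fun i => d i.succ) I := by
  rw [unshuffleSign, compl_insert_zero, Finset.prod_insert (by simp), Finset.prod_map,
    unshuffleSign]
  rw [Finset.filter_false_of_mem (by simp), Finset.prod_empty, one_mul]
  refine Finset.prod_congr rfl fun i _ => ?_
  rw [Finset.filter_map, Finset.prod_map]
  simp [Function.comp_def]

/-- The two orders of the blocks differ by exchanging the blocks, whose total degrees are the two
sums. -/
theorem unshuffleSign_compl {n : ℕ} (d : Fin n → ℤ) (I : Finset (Fin n)) :
    unshuffleSign d Iᶜ = unshuffleSign d I *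
      eps ((∑ i ∈ I, (d i - 1)) * ∑ i ∈ Iᶜ, (d i - 1)) := by
  induction n with
  | zero =>
    rw [Subsingleton.elim I ∅]
    simp [unshuffleSign, eps]
  | succ n ih =>
    obtain ⟨J, rfl | rfl⟩ : ∃ J : Finset (Fin n), I = J.map (Fin.succEmb n) ∨
        I = insert 0 (J.map (Fin.succEmb n)) := by
      refine ⟨Finset.univ.filter fun i => i.succ ∈ I, ?_⟩
      by_cases h0 : 0 ∈ I
      · right; ext i; refine Fin.cases ?_ (fun i => ?_) i <;> simp [h0]
      · left; ext i; refine Fin.cases ?_ (fun i => ?_) i <;> simp [h0]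
    · rw [compl_map_succ, unshuffleSign_insert_zero, unshuffleSign_map_succ, ih,
        Finset.sum_insert (by simp), Finset.sum_map, Finset.sum_map]
      simp only [Fin.coe_succEmb, mul_add, eps_add]
      have := eps_mul_self ((∑ i ∈ J, (d i.succ - 1)) * (d 0 - 1))
      linear_combination (-(unshuffleSign (fun i => d i.succ) J *
        eps ((∑ i ∈ J, (d i.succ - 1)) * ∑ i ∈ Jᶜ, (d i.succ - 1)))) * this
    · rw [compl_insert_zero, unshuffleSign_insert_zero, unshuffleSign_map_succ, ih,
        Finset.sum_insert (by simp), Finset.sum_map, Finset.sum_map]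
      simp only [Fin.coe_succEmb, add_mul, eps_add]
      rw [mul_comm (d 0 - 1)]
      ring

/-! ### The Leibniz rule for iterated brackets -/

section

variable {K : Type u} [Field K] {V : Type v} [AddCommGroup V] [Module K V]
variable (𝒱 : ℤ → Submodule K V) [GradedSpace 𝒱] [CharZero K] [Module.Finite K V]

theorem parityB_adR {d : ℤ} {w} (hw : w ∈ dblGr 𝒱 d) {F : BigAlg 𝒱} {g : ℤ}
    (hF : parityB 𝒱 F = eps g • F) : parityB 𝒱 (adR 𝒱 w F) = eps (g + (d - 1)) • adR 𝒱 w F := by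
  rw [← sgn_even 𝒱 (d := 0) (by simp), sgn_adR 𝒱 0 hw, sgn_even 𝒱 (d := 0) (by simp), hF,
    map_zsmul, smul_smul, ksign_eq_eps, ← eps_add]
  congr 1
  refine eps_congr ⟨-(d - 1), by ring⟩

/-- Iterated adjoint action on a bracket. -/
theorem iad_bigBracket {n : ℕ} {x : Fin n → V × Module.Dual K V} {δ : Fin n → ℤ}
    (hx : ∀ i, x i ∈ dblGr 𝒱 (δ i)) (F G : BigAlg 𝒱) {g : ℤ} (hG : parityB 𝒱 G = eps g • G) :
    iad 𝒱 (bigBracket 𝒱 F G) (List.ofFn x) =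
      ∑ I : Finset (Fin n), (eps (g * ∑ i ∈ I, (δ i - 1)) * unshuffleSign δ I) •
        bigBracket 𝒱 (iad 𝒱 F ((idx I).map x)) (iad 𝒱 G ((idx Iᶜ).map x)) := by
  induction n generalizing F G g with
  | zero =>
    rw [Fintype.sum_subsingleton _ (∅ : Finset (Fin 0))]
    simp [idx, iad_nil, unshuffleSign, eps]
  | succ n ih =>
    have hx' : ∀ i : Fin n, x i.succ ∈ dblGr 𝒱 (δ i.succ) := fun i => hx _
    -- The first argument acts either on `G` or, after passing `G`, on `F`. These are the subsets
    -- without and with 0.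
    rw [List.ofFn_succ, iad_cons, adR_bigBracket 𝒱 (hx 0), sgn_apply 𝒱 _ hG, map_zsmul, iad_add,
      iad_zsmul, ih hx' F _ (parityB_adR 𝒱 (hx 0) hG), ih hx' _ G hG, sum_finset_succ]
    congr 1
    · refine Finset.sum_congr rfl fun I _ => ?_
      rw [compl_map_succ, idx_map_succ, idx_insert_zero, unshuffleSign_map_succ, Finset.sum_map,
        List.map_cons, iad_cons, List.map_map, List.map_map, ← mul_assoc, ← eps_add]
      simp only [Fin.coe_succEmb, Function.comp_def]
      congr 3
      ring
    · rw [Finset.smul_sum]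
      refine Finset.sum_congr rfl fun I _ => ?_
      rw [compl_insert_zero, idx_map_succ, idx_insert_zero, unshuffleSign_insert_zero,
        Finset.sum_insert (by simp), Finset.sum_map,
        List.map_cons, iad_cons, List.map_map, List.map_map, smul_smul, ← mul_assoc, ← eps_add]
      simp only [Fin.coe_succEmb, Function.comp_def]
      congr 3
      ring

end

section

variable {K : Type u} [Field K] {V : Type v} [AddCommGroup V] [Module K V]
variable (𝒱 : ℤ → Submodule K V) [GradedSpace 𝒱] [CharZero K] [Module.Finite K V]

/-! ### The generalized Jacobi identities and `[S, S]` -/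

theorem adL_iad {l : List (V × Module.Dual K V)} {D : List ℤ} (h : HomList 𝒱 l D)
    (u : V × Module.Dual K V) (F : BigAlg 𝒱) :
    adL 𝒱 u (iad 𝒱 F l) = iad 𝒱 (adL 𝒱 u F) l := by
  induction h generalizing F with
  | nil => rfl
  | cons hw _ ih => rw [iad_cons, iad_cons, ih, adR_adL 𝒱 hw]

/-- The left hand side of the generalized Jacobi identity. -/
def jacobiator {E : Type*} [AddCommGroup E] (br : ∀ n : ℕ, (Fin n → E) → E) {n : ℕ} (x : Fin n → E)
    (δ : Fin n → ℤ) : E :=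
  ∑ I : Finset (Fin n), unshuffleSign δ I •
      br (Iᶜ.card + 1) (Fin.cons (br I.card (fun i => x (I.orderEmbOfFin rfl i)))
        (fun j => x (Iᶜ.orderEmbOfFin rfl j)))

theorem bigBracket_smul_one_left (c : K) (G : BigAlg 𝒱) : bigBracket 𝒱 (c • 1) G = 0 := by
  rw [map_smul, LinearMap.smul_apply, bigBracket_one_left, smul_zero]

theorem bigBracket_smul_one_right (c : K) (G : BigAlg 𝒱) : bigBracket 𝒱 G (c • 1) = 0 := by
  rw [map_smul, bigBracket_one_right, smul_zero]

/-- The exponent 3 - 2a is odd: all parts of S are odd. -/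
theorem parityB_theta {a : ℕ} {F : BigAlg 𝒱} (hF : F ∈ wt 𝒱 a (3 - a)) :
    parityB 𝒱 F = eps 1 • F := by
  rw [parityB_wt 𝒱 hF]
  congr 1
  exact eps_congr ⟨1 - a, by ring⟩

theorem sum_map_idx {n : ℕ} (δ : Fin n → ℤ) (I : Finset (Fin n)) :
    ((idx I).map δ).sum = ∑ i ∈ I, δ i := by
  rw [← ofFn_comp_orderEmbOfFin, List.sum_ofFn]
  conv_rhs => rw [← Finset.map_orderEmbOfFin_univ I rfl, Finset.sum_map]
  rfl

/-- Distribute the arguments x_I to θ_a and the rest to θ_b. A factor reduced to a scalar kills the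
bracket, so a > |I| and b > |Iᶜ|; as a + b = n + 3, one factor is left with weight 1 and the other
with weight 2. These two cases give the Jacobi terms of I and of its complement, so each term occurs
twice. -/
theorem iad_antidiagonal {θ : ℕ → BigAlg 𝒱} (hθ : ∀ a : ℕ, θ a ∈ wt 𝒱 a (3 - a))
    {br : ∀ n : ℕ, (Fin n → V × Module.Dual K V) → V × Module.Dual K V}
    (hbr : ∀ n x, gen 𝒱 (br n x) = iad 𝒱 (θ (n + 1)) (List.ofFn x))
    {n : ℕ} {x : Fin n → V × Module.Dual K V} {δ : Fin n → ℤ} (hx : ∀ i, x i ∈ dblGr 𝒱 (δ i)) :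
    iad 𝒱 (∑ p ∈ Finset.HasAntidiagonal.antidiagonal (n + 3),
      bigBracket 𝒱 (θ p.1) (θ p.2)) (List.ofFn x) = (2 : ℤ) • gen 𝒱 (jacobiator br x δ) := by
  set u : Finset (Fin n) → V × Module.Dual K V :=
    fun I => br I.card (fun i => x (I.orderEmbOfFin rfl i)) with hu
  set P : Finset (Fin n) → ℤ := fun I => ∑ i ∈ I, (δ i - 1) with hP
  have hlist : ∀ I : Finset (Fin n), HomList 𝒱 ((idx I).map x) ((idx I).map δ) :=
    fun I => homList_map 𝒱 x δ hx _
  have hPd : ∀ I : Finset (Fin n), ∑ i ∈ I, δ i = P I + I.card := fun I => by simp [hP]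
  have hgu : ∀ I, gen 𝒱 (u I) = iad 𝒱 (θ (I.card + 1)) ((idx I).map x) := fun I => by
    rw [hu, hbr, ofFn_comp_orderEmbOfFin]
  -- The sum `P I` consists of total degrees; the passage back to internal degrees adds |I|, which
  -- cancels against the degree 2 - |I| of the inner bracket.
  have hdeg : ∀ I, u I ∈ dblGr 𝒱 (P I + 2) := by
    intro I
    have h1 := iad_mem_wt 𝒱 (hlist I) (N := 1) (F := θ (I.card + 1)) (d := 3 - (I.card + 1 : ℕ))
      (wt_cast 𝒱 (hθ _) (by rw [List.length_map, length_idx, add_comm]) rfl)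
    rw [← hgu, sum_map_idx, hPd] at h1
    obtain ⟨w, hw, hw'⟩ := exists_gen_of_mem_wt 𝒱 h1
    rw [gen_injective 𝒱 hw']
    convert hw using 2
    push_cast
    ring
  have hadL : ∀ I (J : Finset (Fin n)) (F : BigAlg 𝒱), parityB 𝒱 F = eps 1 • F →
      adL 𝒱 (u I) (iad 𝒱 F ((idx J).map x)) =
        eps (P I) • iad 𝒱 F (u I :: (idx J).map x) := by
    intro I J F hF
    rw [adL_iad 𝒱 (hlist J), adL_eq 𝒱 (hdeg I), sgn_apply 𝒱 _ hF, map_zsmul, ← neg_smul,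
      iad_zsmul, iad_cons]
    congr 1
    have h1 : eps (1 : ℤ) = -1 := eps_odd odd_one
    rw [show (P I + 2 - 1) * 1 = P I + 1 by ring, eps_add, h1]
    ring
  set T : Finset (Fin n) → BigAlg 𝒱 := fun I =>
    unshuffleSign δ I • iad 𝒱 (θ (Iᶜ.card + 2)) (u I :: (idx Iᶜ).map x) with hT
  have hJ : gen 𝒱 (jacobiator br x δ) = ∑ I, T I := by
    rw [jacobiator, map_sum]
    refine Finset.sum_congr rfl fun I _ => ?_
    rw [map_zsmul, hbr, List.ofFn_cons, ofFn_comp_orderEmbOfFin]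
  have hpair : ∀ I : Finset (Fin n),
      ∑ p ∈ Finset.HasAntidiagonal.antidiagonal (n + 3), (eps (1 * ∑ i ∈ I, (δ i - 1)) *
        unshuffleSign δ I) • bigBracket 𝒱 (iad 𝒱 (θ p.1) ((idx I).map x))
          (iad 𝒱 (θ p.2) ((idx Iᶜ).map x)) = T I + T Iᶜ := by
    intro I
    have hc : I.card + Iᶜ.card = n := by simp
    -- In the first surviving pair the left factor is the generator `u I`; in the second the right
    -- factor is `u Iᶜ`.
    rw [Finset.sum_eq_add (I.card + 1, Iᶜ.card + 2) (I.card + 2, Iᶜ.card + 1) (by simp)]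
    · congr 1
      · rw [← hgu, bigBracket_gen_left, hadL _ _ _ (parityB_theta 𝒱 (hθ _)), smul_smul, hT]
        congr 1
        rw [one_mul]
        change eps (P I) * unshuffleSign δ I * eps (P I) = unshuffleSign δ I
        linear_combination (unshuffleSign δ I) * eps_mul_self (P I)
      · simp only [hT, compl_compl]
        rw [← hgu, bigBracket_gen_right]
        have hF := iad_mem_wt 𝒱 (hlist I) (N := 2) (F := θ (I.card + 2))
          (d := 3 - (I.card + 2 : ℕ))
          (wt_cast 𝒱 (hθ _) (by rw [List.length_map, length_idx, add_comm]) rfl)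
        rw [sum_map_idx, hPd] at hF
        -- Applied to a twisted argument, since `sgn` is an involution, this expresses the right
        -- action of `u Iᶜ` by its left action, for which `hadL` is available.
        have h1 := adL_eq 𝒱 (hdeg Iᶜ) (sgn 𝒱 (P Iᶜ + 2) (iad 𝒱 (θ (I.card + 2)) ((idx I).map x)))
        rw [sgn_sgn, sgn_wt 𝒱 _ hF, map_zsmul, hadL _ _ _ (parityB_theta 𝒱 (hθ _))] at h1
        rw [← neg_eq_iff_eq_neg.2 h1, ← smul_neg, ← smul_neg, smul_smul, smul_smul, smul_neg,
          ← neg_smul, unshuffleSign_compl]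
        congr 1
        have e1 : eps ((P Iᶜ + 2 - 1) * (3 - (I.card + 2 : ℕ) + (P I + I.card) - (2 : ℕ))) =
            -(eps (P I * P Iᶜ) * eps (P I) * eps (P Iᶜ)) := by
          rw [← eps_add, ← eps_add, ← neg_one_mul, ← eps_odd odd_one, ← eps_add]
          refine eps_congr ⟨-1 - P Iᶜ, ?_⟩
          push_cast
          ring
        rw [e1, one_mul]
        have e2 := eps_mul_self (P I)
        have e3 := eps_mul_self (P Iᶜ)
        change -(eps (P I) * unshuffleSign δ I *
          -(eps (P I * P Iᶜ) * eps (P I) * eps (P Iᶜ)) * eps (P Iᶜ)) =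
            unshuffleSign δ I * eps (P I * P Iᶜ)
        linear_combination (unshuffleSign δ I * eps (P I * P Iᶜ) * eps (P Iᶜ) * eps (P Iᶜ)) * e2 +
          (unshuffleSign δ I * eps (P I * P Iᶜ)) * e3
    · rintro ⟨a, b⟩ hab ⟨h1, h2⟩
      rw [Finset.HasAntidiagonal.mem_antidiagonal] at hab
      simp only [ne_eq, Prod.mk.injEq, not_and] at h1 h2 hab
      have hor : a ≤ I.card ∨ b ≤ Iᶜ.card := by omega
      rcases hor with h | h
      · obtain ⟨c, hc⟩ := iad_eq_smul_one 𝒱 (hlist I) (hθ a) (by simpa [length_idx] using h)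
        simp only [hc, bigBracket_smul_one_left, smul_zero]
      · obtain ⟨c, hc⟩ := iad_eq_smul_one 𝒱 (hlist Iᶜ) (hθ b)
          (by rw [List.length_map, length_idx]; exact h)
        simp only [hc, bigBracket_smul_one_right, smul_zero]
    · intro h
      exact absurd (Finset.HasAntidiagonal.mem_antidiagonal.2 (by omega)) h
    · intro h
      exact absurd (Finset.HasAntidiagonal.mem_antidiagonal.2 (by omega)) h
  rw [iad_sum]
  simp only [iad_bigBracket 𝒱 hx _ _ (parityB_theta 𝒱 (hθ _))]
  rw [Finset.sum_comm]
  simp only [hpair, Finset.sum_add_distrib]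
  rw [hJ, two_smul]
  congr 1
  -- Complementation permutes the subsets, so both halves are the full Jacobi sum.
  exact Equiv.sum_comp (Function.Involutive.toPerm (compl : Finset (Fin n) → _) compl_compl) T

end

section

variable {K : Type u} [Field K] {V : Type v} [AddCommGroup V] [Module K V]
variable (𝒱 : ℤ → Submodule K V) [GradedSpace 𝒱]
variable {V' : Type w} [AddCommGroup V'] [Module K V'] (𝒱' : ℤ → Submodule K V') [GradedSpace 𝒱']

/-! ### Functoriality -/

/-- The algebra map induced by a linear map of degree `0`. -/
def mapB (g : V × Module.Dual K V →ₗ[K] V' × Module.Dual K V')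
    (hg : ∀ d, ∀ u ∈ dblGr 𝒱 d, g u ∈ dblGr 𝒱' d) : BigAlg 𝒱 →ₐ[K] BigAlg 𝒱' :=
  liftB 𝒱 (gen 𝒱' ∘ₗ g) fun a b x y hx hy => gen_mul_gen 𝒱' (hg a x hx) (hg b y hy)

theorem mapB_gen (g : V × Module.Dual K V →ₗ[K] V' × Module.Dual K V')
    (hg : ∀ d, ∀ u ∈ dblGr 𝒱 d, g u ∈ dblGr 𝒱' d) (u : V × Module.Dual K V) :
    mapB 𝒱 𝒱' g hg (gen 𝒱 u) = gen 𝒱' (g u) := liftB_gen 𝒱 _ _ u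

variable {𝒱 𝒱'} in
theorem map_mem_wt {Φ : BigAlg 𝒱 →ₐ[K] BigAlg 𝒱'}
    {g : V × Module.Dual K V → V' × Module.Dual K V'} (hΦ : ∀ u, Φ (gen 𝒱 u) = gen 𝒱' (g u))
    (hg : ∀ d, ∀ u ∈ dblGr 𝒱 d, g u ∈ dblGr 𝒱' d) {N : ℕ} {d : ℤ} {F : BigAlg 𝒱}
    (hF : F ∈ wt 𝒱 N d) : Φ F ∈ wt 𝒱' N d := by
  induction hF using Submodule.span_induction with
  | mem P hP =>
    induction hP with
    | one => rw [map_one]; exact one_mem_wt 𝒱'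
    | cons hu _ ih =>
      rw [map_mul, hΦ]
      exact wt_cast 𝒱' (wt_mul 𝒱' (gen_mem_wt 𝒱' (hg _ _ hu)) ih) (add_comm _ _) rfl
  | zero => simp
  | add x y _ _ hx hy => rw [map_add]; exact add_mem hx hy
  | smul c x _ hx => rw [map_smul]; exact Submodule.smul_mem _ _ hx

variable [CharZero K] [Module.Finite K V] [Module.Finite K V']

variable {𝒱 𝒱'}

theorem map_sgn {Φ : BigAlg 𝒱 →ₐ[K] BigAlg 𝒱'}
    {g : V × Module.Dual K V → V' × Module.Dual K V'} (hΦ : ∀ u, Φ (gen 𝒱 u) = gen 𝒱' (g u))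
    (hg : ∀ d, ∀ u ∈ dblGr 𝒱 d, g u ∈ dblGr 𝒱' d) (e : ℤ) (F : BigAlg 𝒱) :
    sgn 𝒱' e (Φ F) = Φ (sgn 𝒱 e F) := by
  induction F using B_induction 𝒱 with
  | h1 c => simp
  | hg d u hu => rw [hΦ, sgn_gen 𝒱' e (hg d u hu), sgn_gen 𝒱 e hu, map_zsmul, hΦ]
  | hm F G hF hG => simp [hF, hG]
  | ha F G hF hG => simp [hF, hG]

/-- The element `w'` need not be `g w`; only its pairings with the image of `g` matter. This covers
`dil`, which does not preserve the pairing. -/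
theorem map_adR {Φ : BigAlg 𝒱 →ₐ[K] BigAlg 𝒱'}
    {g : V × Module.Dual K V → V' × Module.Dual K V'} (hΦ : ∀ u, Φ (gen 𝒱 u) = gen 𝒱' (g u))
    (hg : ∀ d, ∀ u ∈ dblGr 𝒱 d, g u ∈ dblGr 𝒱' d) {e : ℤ} {w : V × Module.Dual K V}
    {w' : V' × Module.Dual K V'} (hw : w ∈ dblGr 𝒱 e) (hw' : w' ∈ dblGr 𝒱' e)
    (h : ∀ u, pairing 𝒱' (g u) w' = pairing 𝒱 u w) (F : BigAlg 𝒱) :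
    adR 𝒱' w' (Φ F) = Φ (adR 𝒱 w F) := by
  induction F using B_induction 𝒱 with
  | h1 c => simp [adR_one]
  | hg d u hu => rw [hΦ, adR_gen, adR_gen, h, map_smul, map_one]
  | hm F G hF hG =>
    rw [map_mul, adR_mul 𝒱' hw', adR_mul 𝒱 hw, hF, hG, map_sgn hΦ hg, map_add, map_mul, map_mul]
  | ha F G hF hG => simp [hF, hG]

theorem map_iad {Φ : BigAlg 𝒱 →ₐ[K] BigAlg 𝒱'}
    {g : V × Module.Dual K V → V' × Module.Dual K V'} (hΦ : ∀ u, Φ (gen 𝒱 u) = gen 𝒱' (g u))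
    (hg : ∀ d, ∀ u ∈ dblGr 𝒱 d, g u ∈ dblGr 𝒱' d)
    (h : ∀ u w, pairing 𝒱' (g u) (g w) = pairing 𝒱 u w)
    {l : List (V × Module.Dual K V)} {D : List ℤ} (hl : HomList 𝒱 l D) (F : BigAlg 𝒱) :
    iad 𝒱' (Φ F) (l.map g) = Φ (iad 𝒱 F l) := by
  induction hl generalizing F with
  | nil => rfl
  | cons hw _ ih =>
    rw [List.map_cons, iad_cons, iad_cons, ← ih, map_adR hΦ hg hw (hg _ _ hw) fun u => h u _]

/-! ### The bidegree -/

variable (𝒱)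

/-- The automorphism of `B` that multiplies `Λ^k V^* ⊗ Λ^l V` by `2^l`. -/
def dil : BigAlg 𝒱 →ₐ[K] BigAlg 𝒱 :=
  mapB 𝒱 𝒱 (((2 : K) • LinearMap.id).prodMap LinearMap.id) fun _ _ hu =>
    (mem_dblGr 𝒱).2 ⟨Submodule.smul_mem _ _ ((mem_dblGr 𝒱).1 hu).1, ((mem_dblGr 𝒱).1 hu).2⟩

theorem dil_gen (u : V × Module.Dual K V) :
    dil 𝒱 (gen 𝒱 u) = gen 𝒱 ((2 : K) • u.1, u.2) := mapB_gen 𝒱 𝒱 _ _ u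

theorem dil_grade (d : ℤ) (u) (hu : u ∈ dblGr 𝒱 d) :
    ((2 : K) • u.1, u.2) ∈ dblGr 𝒱 d :=
  (mem_dblGr 𝒱).2 ⟨Submodule.smul_mem _ _ ((mem_dblGr 𝒱).1 hu).1, ((mem_dblGr 𝒱).1 hu).2⟩

theorem adR_inl_dil (x : V) (F : BigAlg 𝒱) :
    adR 𝒱 (x, 0) (dil 𝒱 F) = dil 𝒱 (adR 𝒱 (x, 0) F) := by
  induction x using hom_induction 𝒱 with
  | h0 => rw [show ((0 : V), (0 : Module.Dual K V)) = 0 from rfl, map_zero]; simp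
  | ha x y hx hy =>
    rw [show (x + y, (0 : Module.Dual K V)) = (x, 0) + (y, 0) by simp]
    simp [-Prod.mk_add_mk, hx, hy]
  | hh d x hx =>
    exact map_adR (dil_gen 𝒱) (dil_grade 𝒱) (inl_mem_dblGr 𝒱 hx) (inl_mem_dblGr 𝒱 hx)
      (fun u => by simp [pairing_apply]) F

/-- A covector contracts a vector, and vectors are what `dil` doubles. -/
theorem adR_inr_dil (ξ : Module.Dual K V) (F : BigAlg 𝒱) :
    adR 𝒱 (0, ξ) (dil 𝒱 F) = (2 : K) • dil 𝒱 (adR 𝒱 (0, ξ) F) := by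
  induction ξ using hom_induction (dualGr 𝒱) with
  | h0 => rw [show ((0 : V), (0 : Module.Dual K V)) = 0 from rfl, map_zero]; simp
  | ha x y hx hy =>
    rw [show ((0 : V), x + y) = (0, x) + (0, y) by simp]
    simp [-Prod.mk_add_mk, hx, hy]
  | hh d ξ hξ =>
    rw [← map_smul, ← LinearMap.smul_apply, ← map_smul]
    exact map_adR (dil_gen 𝒱) (dil_grade 𝒱)
      (Submodule.smul_mem _ _ (inr_mem_dblGr 𝒱 hξ)) (inr_mem_dblGr 𝒱 hξ)
      (fun u => by simp [pairing_apply]) F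

theorem adL_inl_dil (x : V) (F : BigAlg 𝒱) :
    adL 𝒱 (x, 0) (dil 𝒱 F) = dil 𝒱 (adL 𝒱 (x, 0) F) := by
  induction x using hom_induction 𝒱 with
  | h0 => rw [show ((0 : V), (0 : Module.Dual K V)) = 0 from rfl, map_zero]; simp
  | ha x y hx hy =>
    rw [show (x + y, (0 : Module.Dual K V)) = (x, 0) + (y, 0) by simp]
    simp [-Prod.mk_add_mk, hx, hy]
  | hh d x hx =>
    rw [adL_eq 𝒱 (inl_mem_dblGr 𝒱 hx), adL_eq 𝒱 (inl_mem_dblGr 𝒱 hx),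
      map_sgn (dil_gen 𝒱) (dil_grade 𝒱), adR_inl_dil, map_neg]

theorem adL_inr_dil (ξ : Module.Dual K V) (F : BigAlg 𝒱) :
    adL 𝒱 (0, ξ) (dil 𝒱 F) = (2 : K) • dil 𝒱 (adL 𝒱 (0, ξ) F) := by
  induction ξ using hom_induction (dualGr 𝒱) with
  | h0 => rw [show ((0 : V), (0 : Module.Dual K V)) = 0 from rfl, map_zero]; simp
  | ha x y hx hy =>
    rw [show ((0 : V), x + y) = (0, x) + (0, y) by simp]
    simp [-Prod.mk_add_mk, hx, hy]
  | hh d x hx =>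
    rw [adL_eq 𝒱 (inr_mem_dblGr 𝒱 hx), adL_eq 𝒱 (inr_mem_dblGr 𝒱 hx),
      map_sgn (dil_gen 𝒱) (dil_grade 𝒱), adR_inr_dil, map_neg, smul_neg]

/-- Every term of the bracket contracts one vector with one covector, so one factor 2 is lost on the
right. -/
theorem bigBracket_dil (F G : BigAlg 𝒱) :
    bigBracket 𝒱 (dil 𝒱 F) (dil 𝒱 G) = (2 : K) • dil 𝒱 (bigBracket 𝒱 F G) := by
  simp only [bigBracket_eq, adR_inl_dil, adR_inr_dil, adL_inl_dil, adL_inr_dil, map_sum, map_add,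
    map_mul, mul_smul_comm, smul_mul_assoc, Finset.smul_sum, smul_add]

/-! ### The components `Λ^k V^* ⊗ Λ^l V` -/

variable {𝒱}

theorem isMon_ofFn {n : ℕ} {x : Fin n → V × Module.Dual K V} {δ : Fin n → ℤ}
    (h : ∀ i, x i ∈ dblGr 𝒱 (δ i)) :
    IsMon 𝒱 n (∑ i, δ i) (List.ofFn fun i => gen 𝒱 (x i)).prod := by
  induction n with
  | zero => simpa using IsMon.one
  | succ n ih =>
    rw [List.ofFn_succ, List.prod_cons, Fin.sum_univ_succ]
    exact (ih fun i => h i.succ).cons (h 0)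

variable (𝒱)

theorem comp_le_wt (k l : ℕ) (d : ℤ) : comp 𝒱 k l d ≤ wt 𝒱 (k + l) d := by
  refine Submodule.span_le.2 ?_
  rintro _ ⟨ξ, a, x, b, hξ, hx, rfl, rfl⟩
  exact ((isMon_ofFn fun i => inr_mem_dblGr 𝒱 (hξ i)).mul
    (isMon_ofFn fun i => inl_mem_dblGr 𝒱 (hx i))).mem_wt

theorem dil_comp {k l : ℕ} {d : ℤ} {F : BigAlg 𝒱} (hF : F ∈ comp 𝒱 k l d) :
    dil 𝒱 F = (2 : K) ^ l • F := by
  induction hF using Submodule.span_induction with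
  | mem P hP =>
    obtain ⟨ξ, a, x, b, hξ, hx, -, rfl⟩ := hP
    have h1 : dil 𝒱 (List.ofFn fun i => gen 𝒱 (0, ξ i)).prod =
        (List.ofFn fun i => gen 𝒱 (0, ξ i)).prod := by
      rw [map_list_prod, List.map_ofFn]
      congr 2
      funext i
      simp [dil_gen]
    have h2 : dil 𝒱 (List.ofFn fun i => gen 𝒱 (x i, 0)).prod =
        (2 : K) ^ l • (List.ofFn fun i => gen 𝒱 (x i, 0)).prod := by
      clear hx
      induction l with
      | zero => simp
      | succ l ih =>
        rw [List.ofFn_succ, List.prod_cons, map_mul, dil_gen,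
          ih (fun i => x i.succ) (fun i => b i.succ), pow_succ',
          show ((2 : K) • x 0, (0 : Module.Dual K V)) = (2 : K) • (x 0, 0) by simp, map_smul,
          smul_mul_smul_comm]
    rw [map_mul, h1, h2, mul_smul_comm]
  | zero => simp
  | add x y _ _ hx hy => rw [map_add, hx, hy, smul_add]
  | smul c x _ hx => rw [map_smul, hx, smul_comm]

theorem gen_inr_mul_comp {k l : ℕ} {d e : ℤ} {ξ : Module.Dual K V} (hξ : ξ ∈ dualGr 𝒱 e)
    {F : BigAlg 𝒱} (hF : F ∈ comp 𝒱 k l d) : gen 𝒱 (0, ξ) * F ∈ comp 𝒱 (k + 1) l (e + d) := by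
  induction hF using Submodule.span_induction with
  | mem P hP =>
    obtain ⟨η, a, x, b, hη, hx, rfl, rfl⟩ := hP
    refine Submodule.subset_span ⟨Fin.cons ξ η, Fin.cons e a, x, b, cons_hom hξ hη, hx, ?_, ?_⟩
    · rw [Fin.sum_univ_succ]
      simp only [Fin.cons_zero, Fin.cons_succ]
      ring
    · rw [List.ofFn_succ, List.prod_cons, mul_assoc]
      simp
  | zero => simp
  | add x y _ _ hx hy => rw [mul_add]; exact add_mem hx hy
  | smul c x _ hx => rw [mul_smul_comm]; exact Submodule.smul_mem _ _ hx

/-- The vector is moved past the covectors at the cost of a sign, which restores the order of the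
products that span `comp`. -/
theorem gen_inl_mul_comp {k l : ℕ} {d e : ℤ} {y : V} (hy : y ∈ 𝒱 e)
    {F : BigAlg 𝒱} (hF : F ∈ comp 𝒱 k l d) : gen 𝒱 (y, 0) * F ∈ comp 𝒱 k (l + 1) (e + d) := by
  induction hF using Submodule.span_induction with
  | mem P hP =>
    obtain ⟨η, a, x, b, hη, hx, rfl, rfl⟩ := hP
    rw [← mul_assoc, gen_mul 𝒱 (inl_mem_dblGr 𝒱 hy),
      sgn_wt 𝒱 e (isMon_ofFn fun i => inr_mem_dblGr 𝒱 (hη i)).mem_wt, smul_mul_assoc,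
      smul_mul_assoc, mul_assoc]
    refine zsmul_mem ?_ _
    refine Submodule.subset_span
      ⟨η, a, Fin.cons y x, Fin.cons e b, hη, cons_hom hy hx, ?_, ?_⟩
    · rw [Fin.sum_univ_succ]
      simp only [Fin.cons_zero, Fin.cons_succ]
      ring
    · rw [List.ofFn_succ (f := fun j => gen 𝒱 ((Fin.cons y x : Fin (l + 1) → V) j, 0)),
        List.prod_cons]
      simp
  | zero => simp
  | add x y _ _ hx hy => rw [mul_add]; exact add_mem hx hy
  | smul c x _ hx => rw [mul_smul_comm]; exact Submodule.smul_mem _ _ hx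

theorem wt_le_iSup_comp (N : ℕ) (d : ℤ) :
    wt 𝒱 N d ≤ ⨆ p ∈ Finset.HasAntidiagonal.antidiagonal N, comp 𝒱 p.1 p.2 d := by
  refine Submodule.span_le.2 fun P hP => ?_
  induction hP with
  | one =>
    have h1 : (1 : BigAlg 𝒱) ∈ comp 𝒱 0 0 0 := Submodule.subset_span ⟨Fin.elim0, Fin.elim0, Fin.elim0, Fin.elim0, fun i => i.elim0,
      fun i => i.elim0, by simp, by simp⟩
    exact Submodule.mem_iSup_of_mem (0, 0) (Submodule.mem_iSup_of_mem (by simp) h1)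
  | @cons N d e u P hu hP ih =>
    obtain ⟨μ, hμ⟩ := (Submodule.mem_iSup_finset_iff_exists_sum _ _).1 ih
    rw [← hμ, SetLike.mem_coe, Finset.mul_sum]
    refine sum_mem fun p hp => ?_
    rw [Finset.HasAntidiagonal.mem_antidiagonal] at hp
    rw [show u = (0, u.2) + (u.1, 0) by simp, map_add, add_mul]
    refine add_mem ?_ ?_
    · refine Submodule.mem_iSup_of_mem (p.1 + 1, p.2) (Submodule.mem_iSup_of_mem ?_
        (gen_inr_mul_comp 𝒱 ((mem_dblGr 𝒱).1 hu).2 (μ p).2))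
      rw [Finset.HasAntidiagonal.mem_antidiagonal]
      simp only
      omega
    · refine Submodule.mem_iSup_of_mem (p.1, p.2 + 1) (Submodule.mem_iSup_of_mem ?_
        (gen_inl_mul_comp 𝒱 ((mem_dblGr 𝒱).1 hu).1 (μ p).2))
      rw [Finset.HasAntidiagonal.mem_antidiagonal]
      simp only
      omega

theorem exists_comp_sum {N : ℕ} {d : ℤ} {F : BigAlg 𝒱} (hF : F ∈ wt 𝒱 N d) :
    ∃ t : ℕ × ℕ → BigAlg 𝒱, (∀ p, t p ∈ comp 𝒱 p.1 p.2 d) ∧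
      ∑ p ∈ Finset.HasAntidiagonal.antidiagonal N, t p = F := by
  obtain ⟨μ, hμ⟩ := (Submodule.mem_iSup_finset_iff_exists_sum _ _).1 (wt_le_iSup_comp 𝒱 N d hF)
  exact ⟨fun p => μ p, fun p => (μ p).2, hμ⟩

/-- On an antidiagonal l determines k, and the powers of 2 are distinct in characteristic 0. -/
theorem two_pow_injOn (N : ℕ) : Set.InjOn (fun p : ℕ × ℕ => (2 : K) ^ p.2)
    (Finset.HasAntidiagonal.antidiagonal N : Finset (ℕ × ℕ)) := by
  rintro ⟨a, b⟩ hp ⟨a', b'⟩ hq h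
  have h' : b = b' := by
    have h2 : (2 : K) ^ b = 2 ^ b' := h
    exact Nat.pow_right_injective le_rfl (by exact_mod_cast h2)
  simp only [Finset.mem_coe, Finset.HasAntidiagonal.mem_antidiagonal] at hp hq
  exact Prod.ext (by simp only; omega) h'

/-- The components of a given weight are eigenvectors of `dil` for distinct eigenvalues, so their
sum determines them. -/
theorem comp_sum_injective {t t' : ℕ → ℕ → BigAlg 𝒱} {e : ℕ → ℕ → ℤ}
    (ht : ∀ k l, t k l ∈ comp 𝒱 k l (e k l)) (ht' : ∀ k l, t' k l ∈ comp 𝒱 k l (e k l))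
    (h : ∀ N, ∑ p ∈ Finset.HasAntidiagonal.antidiagonal N, t p.1 p.2 =
      ∑ p ∈ Finset.HasAntidiagonal.antidiagonal N, t' p.1 p.2) : t = t' := by
  funext k l
  have := eq_zero_of_sum_eigen (dil 𝒱).toLinearMap (fun p : ℕ × ℕ => (2 : K) ^ p.2)
    (Finset.HasAntidiagonal.antidiagonal (k + l)) (two_pow_injOn _)
    (fun p => t p.1 p.2 - t' p.1 p.2)
    (fun p _ => dil_comp 𝒱 (sub_mem (ht p.1 p.2) (ht' p.1 p.2)))
    (by rw [Finset.sum_sub_distrib, h, sub_self]) (k, l)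
    (Finset.HasAntidiagonal.mem_antidiagonal.2 rfl)
  exact sub_eq_zero.1 this

/-- The part of weight `N` of `∑ t_{kl}`. -/
def weightPart (t : ℕ → ℕ → BigAlg 𝒱) (N : ℕ) : BigAlg 𝒱 :=
  ∑ p ∈ Finset.HasAntidiagonal.antidiagonal N, t p.1 p.2

theorem weightPart_mem {t : ℕ → ℕ → BigAlg 𝒱} (ht : ∀ k l : ℕ, t k l ∈ comp 𝒱 k l (3 - k - l))
    (N : ℕ) : weightPart 𝒱 t N ∈ wt 𝒱 N (3 - N) := by
  refine sum_mem fun p hp => ?_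
  rw [Finset.HasAntidiagonal.mem_antidiagonal] at hp
  subst hp
  exact wt_cast 𝒱 (comp_le_wt 𝒱 _ _ _ (ht p.1 p.2)) rfl (by push_cast; ring)

theorem sum_bracket (t : ℕ → ℕ → BigAlg 𝒱) (N : ℕ) :
    ∑ r ∈ Finset.HasAntidiagonal.antidiagonal N, (∑ k ∈ Finset.HasAntidiagonal.antidiagonal r.1,
      ∑ l ∈ Finset.HasAntidiagonal.antidiagonal r.2,
        bigBracket 𝒱 (t k.1 l.1) (t k.2 l.2)) =
    ∑ r ∈ Finset.HasAntidiagonal.antidiagonal N,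
      bigBracket 𝒱 (weightPart 𝒱 t r.1) (weightPart 𝒱 t r.2) := by
  simp only [weightPart, map_sum, LinearMap.sum_apply]
  have hc : ∀ f : ℕ × ℕ → ℕ × ℕ → BigAlg 𝒱, ∀ r : ℕ × ℕ,
      ∑ l ∈ Finset.HasAntidiagonal.antidiagonal r.2, ∑ k ∈ Finset.HasAntidiagonal.antidiagonal r.1,
        f k l = ∑ k ∈ Finset.HasAntidiagonal.antidiagonal r.1,
          ∑ l ∈ Finset.HasAntidiagonal.antidiagonal r.2, f k l :=
    fun f r => Finset.sum_comm
  simp only [hc (fun k l => bigBracket 𝒱 (t k.1 k.2) (t l.1 l.2)), Finset.sum_sigma']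
  -- The four indices form a 2 × 2 array; the bijection transposes it and is its own inverse.
  refine Finset.sum_bij' (fun z _ => ⟨(z.2.1.1 + z.2.2.1, z.2.1.2 + z.2.2.2), ⟨(z.2.1.1, z.2.2.1),
      (z.2.1.2, z.2.2.2)⟩⟩)
    (fun z _ => ⟨(z.2.1.1 + z.2.2.1, z.2.1.2 + z.2.2.2), ⟨(z.2.1.1, z.2.2.1),
      (z.2.1.2, z.2.2.2)⟩⟩)
    ?_ ?_ ?_ ?_ ?_
  · rintro ⟨⟨p, q⟩, ⟨⟨a, b⟩, ⟨c, d⟩⟩⟩ h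
    simp only [Finset.mem_sigma, Finset.HasAntidiagonal.mem_antidiagonal, and_self, and_true] at h ⊢
    omega
  · rintro ⟨⟨p, q⟩, ⟨⟨a, b⟩, ⟨c, d⟩⟩⟩ h
    simp only [Finset.mem_sigma, Finset.HasAntidiagonal.mem_antidiagonal, and_self, and_true] at h ⊢
    omega
  · rintro ⟨⟨p, q⟩, ⟨⟨a, b⟩, ⟨c, d⟩⟩⟩ h
    simp only [Finset.mem_sigma, Finset.HasAntidiagonal.mem_antidiagonal] at h
    obtain ⟨h1, rfl, rfl⟩ := h
    rfl
  · rintro ⟨⟨p, q⟩, ⟨⟨a, b⟩, ⟨c, d⟩⟩⟩ h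
    simp only [Finset.mem_sigma, Finset.HasAntidiagonal.mem_antidiagonal] at h
    obtain ⟨h1, rfl, rfl⟩ := h
    rfl
  · intro z _
    rfl

/-- The equation `[S, S] = 0` may be checked on the parts of a given weight. -/
theorem bracket_self_iff {t : ℕ → ℕ → BigAlg 𝒱} {e : ℕ → ℕ → ℤ}
    (ht : ∀ k l, t k l ∈ comp 𝒱 k l (e k l)) :
    (∀ p q : ℕ, ∑ k ∈ Finset.HasAntidiagonal.antidiagonal p,
      ∑ l ∈ Finset.HasAntidiagonal.antidiagonal q, bigBracket 𝒱 (t k.1 l.1) (t k.2 l.2) = 0) ↔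
    ∀ N : ℕ, ∑ r ∈ Finset.HasAntidiagonal.antidiagonal N,
      bigBracket 𝒱 (weightPart 𝒱 t r.1) (weightPart 𝒱 t r.2) = 0 := by
  constructor
  · intro h N
    rw [← sum_bracket]
    exact Finset.sum_eq_zero fun r _ => h r.1 r.2
  · intro h p q
    -- The factor 2 compensates for the vector lost in the bracket, so the component with l₁ + l₂ =
    -- q has eigenvalue 2^q.
    refine eq_zero_of_sum_eigen ((2 : K) • (dil 𝒱).toLinearMap) (fun p : ℕ × ℕ => (2 : K) ^ p.2)
      (Finset.HasAntidiagonal.antidiagonal (p + q)) (two_pow_injOn _)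
      (fun r => ∑ k ∈ Finset.HasAntidiagonal.antidiagonal r.1,
        ∑ l ∈ Finset.HasAntidiagonal.antidiagonal r.2, bigBracket 𝒱 (t k.1 l.1) (t k.2 l.2))
      (fun r _ => ?_) ((sum_bracket 𝒱 t _).trans (h _)) (p, q)
      (Finset.HasAntidiagonal.mem_antidiagonal.2 rfl)
    simp only [LinearMap.smul_apply, AlgHom.toLinearMap_apply, map_sum, Finset.smul_sum]
    refine Finset.sum_congr rfl fun k _ => Finset.sum_congr rfl fun l hl => ?_
    rw [← bigBracket_dil, dil_comp 𝒱 (ht _ _), dil_comp 𝒱 (ht _ _), map_smul, map_smul,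
      LinearMap.smul_apply, smul_smul, ← pow_add, add_comm,
      Finset.HasAntidiagonal.mem_antidiagonal.1 hl]

end

section

variable {K : Type u} [Field K] [CharZero K] {V : Type v} [AddCommGroup V] [Module K V]
  [Module.Finite K V] (𝒱 : ℤ → Submodule K V) [GradedSpace 𝒱]

/-! ### From solutions of the Maurer-Cartan equation to quasi-triples -/

theorem iadM_gradedSymm {n : ℕ} (F : BigAlg 𝒱) : GradedSymm (dblGr 𝒱) (iadM 𝒱 n F) := by
  intro x δ hx i j hij
  rw [iadM_apply, iadM_apply]
  induction n generalizing F with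
  | zero => exact i.elim0
  | succ n ih =>
    obtain ⟨j, rfl⟩ := Fin.exists_succ_eq.2 (show j ≠ 0 by rintro rfl; simp at hij)
    refine Fin.cases (motive := fun i => (j.succ : ℕ) = i + 1 →
      iad 𝒱 F (List.ofFn (x ∘ Equiv.swap i j.succ)) =
        ksign (δ i) (δ j.succ) • iad 𝒱 F (List.ofFn x)) ?_ (fun i => ?_) i hij
    · intro hij
      obtain ⟨m, rfl⟩ : ∃ m, n = m + 1 := ⟨n - 1, by have := j.2; omega⟩
      obtain rfl : j = 0 := Fin.ext (by simpa using hij)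
      rw [← Fin.cons_self_tail x, ← Fin.cons_self_tail (Fin.tail x)]
      have := cons_cons_swap (x 0) (Fin.tail x 0) (Fin.tail (Fin.tail x))
      rw [show (Fin.succ 0 : Fin (m + 2)) = 1 from rfl, this]
      simp only [List.ofFn_cons, iad_cons]
      have h1 : Fin.tail x 0 ∈ dblGr 𝒱 (δ 1) := hx 1
      rw [adR_adR 𝒱 (hx 0) h1, iad_zsmul]
    · intro hij
      rw [← Fin.cons_self_tail x, cons_swap_succ, List.ofFn_cons, List.ofFn_cons, iad_cons,
        iad_cons]
      exact ih _ _ (fun i => δ i.succ) (fun i => hx i.succ) i j (by simpa using hij)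

theorem ofFn_succ_last {E : Type*} {n : ℕ} (x : Fin (n + 1) → E) :
    List.ofFn x = List.ofFn (fun i : Fin n => x i.castSucc) ++ [x (Fin.last n)] := by
  rw [List.ofFn_succ', List.concat_eq_append]

theorem weightPart_zero {t : ℕ → ℕ → BigAlg 𝒱} (ht : IsMaurerCartan 𝒱 t) :
    weightPart 𝒱 t 0 = 0 := by
  simp [weightPart, ht.t_k_zero]

theorem weightPart_one {t : ℕ → ℕ → BigAlg 𝒱} (ht : IsMaurerCartan 𝒱 t) :
    weightPart 𝒱 t 1 = 0 := by
  rw [weightPart, show Finset.HasAntidiagonal.antidiagonal 1 =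
    ({(0, 1), (1, 0)} : Finset (ℕ × ℕ)) from rfl]
  simp [ht.t_k_zero, ht.t_zero_one]

/-- Iterated brackets with elements of `V` annihilate the terms of positive degree in `V`. -/
theorem iad_inl_dil (l : List V) (F : BigAlg 𝒱) :
    iad 𝒱 (dil 𝒱 F) (l.map fun y => (y, 0)) = dil 𝒱 (iad 𝒱 F (l.map fun y => (y, 0))) := by
  induction l generalizing F with
  | nil => rfl
  | cons y l ih => rw [List.map_cons, iad_cons, iad_cons, adR_inl_dil, ih]

/-- Bracketing with vectors commutes with `dil`. The resulting scalar is therefore both fixed and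
multiplied by 2^l. -/
theorem iad_inl_comp {k l N : ℕ} {d : ℤ} {F : BigAlg 𝒱} (hF : F ∈ comp 𝒱 k l d) (hl : l ≠ 0)
    (hN : k + l = N) {y : Fin N → V} {δ : Fin N → ℤ} (hy : ∀ i, y i ∈ 𝒱 (δ i)) :
    iad 𝒱 F (List.ofFn fun i => (y i, 0)) = 0 := by
  subst hN
  obtain ⟨c, hc⟩ := iad_eq_smul_one 𝒱 (homList_ofFn 𝒱 fun i => inl_mem_dblGr 𝒱 (hy i))
    (comp_le_wt 𝒱 _ _ _ hF) (by simp)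
  have h := iad_inl_dil 𝒱 (List.ofFn y) F
  rw [List.map_ofFn, dil_comp 𝒱 hF, iad_smul] at h
  simp only [Function.comp_def] at h
  rw [hc, map_smul, map_one, smul_smul] at h
  have h1 := smul_one_inj 𝒱 h
  have h2 : ((2 : K) ^ l - 1) * c = 0 := by rw [sub_mul, h1]; ring
  have h3 : (2 : K) ^ l - 1 ≠ 0 := by
    rw [sub_ne_zero]
    exact_mod_cast (Nat.one_lt_two_pow hl).ne'
  rw [hc, (mul_eq_zero.1 h2).resolve_left h3, zero_smul]

/-- So t_{N0} is exactly what the bracket of N - 1 vectors, paired with another vector, can see; it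
is the obstruction to V being a subalgebra. -/
theorem weightPart_inl {t : ℕ → ℕ → BigAlg 𝒱} (hm : ∀ k l : ℕ, t k l ∈ comp 𝒱 k l (3 - k - l))
    {N : ℕ} {y : Fin N → V} {δ : Fin N → ℤ} (hy : ∀ i, y i ∈ 𝒱 (δ i)) :
    iad 𝒱 (weightPart 𝒱 t N) (List.ofFn fun i => (y i, 0)) =
      iad 𝒱 (t N 0) (List.ofFn fun i => (y i, 0)) := by
  rw [weightPart, iad_sum]
  refine Finset.sum_eq_single (N, 0) (fun p hp hne => ?_) (fun h => ?_)
  · rw [Finset.HasAntidiagonal.mem_antidiagonal] at hp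
    refine iad_inl_comp 𝒱 (hm p.1 p.2) (fun h0 => hne (Prod.ext ?_ h0)) hp hy
    simp only
    omega
  · exact absurd (Finset.HasAntidiagonal.mem_antidiagonal.2 (by simp)) h

theorem inl_induction {y : V × Module.Dual K V} (hy : y ∈ (⊤ : Submodule K V).prod
    (⊥ : Submodule K (Module.Dual K V))) : y = (y.1, 0) :=
  Prod.ext rfl ((Submodule.mem_bot K).1 (Submodule.mem_prod.1 hy).2)

theorem zsmul_two_eq_zero {E : Type*} [AddCommGroup E] [Module K E] {x : E}
    (h : (2 : ℤ) • x = 0) : x = 0 := by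
  rw [← Int.cast_smul_eq_zsmul K] at h
  exact (smul_eq_zero.1 h).resolve_left (by norm_num)

variable {𝒱}

theorem IsMaurerCartan.exists_double {t : ℕ → ℕ → BigAlg 𝒱} (ht : IsMaurerCartan 𝒱 t) :
    ∃ T : ManinQuasiTriple K (V × Module.Dual K V), IsDouble t T := by
  -- Iterated brackets take values in B. A left inverse of `gen` turns them into elements of V ⊕ V^*
  -- in a linear way; its values off the range of `gen` play no role, by `hbr`.
  obtain ⟨r, hr⟩ := LinearMap.exists_leftInverse_of_injective (gen 𝒱)
    (LinearMap.ker_eq_bot.2 (gen_injective 𝒱))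
  set θ := weightPart 𝒱 t with hθdef
  have hθ : ∀ a : ℕ, θ a ∈ wt 𝒱 a (3 - a) := weightPart_mem 𝒱 ht.mem
  let br : ∀ n : ℕ, MultilinearMap K (fun _ : Fin n => V × Module.Dual K V)
    (V × Module.Dual K V) := fun n => r.compMultilinearMap (iadM 𝒱 n (θ (n + 1)))
  have hwt : ∀ (n : ℕ) (x : Fin n → V × Module.Dual K V) (δ : Fin n → ℤ),
      (∀ i, x i ∈ dblGr 𝒱 (δ i)) →
      iad 𝒱 (θ (n + 1)) (List.ofFn x) ∈ wt 𝒱 1 (∑ i, δ i + 2 - n) := by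
    intro n x δ hx
    have := iad_mem_wt 𝒱 (homList_ofFn 𝒱 hx) (N := 1) (F := θ (n + 1)) (d := 3 - (n + 1 : ℕ))
      (wt_cast 𝒱 (hθ (n + 1)) (by rw [List.length_ofFn, add_comm]) rfl)
    refine wt_cast 𝒱 this rfl ?_
    rw [List.sum_ofFn]
    push_cast
    ring
  have hbr : ∀ n x, gen 𝒱 (br n x) = iad 𝒱 (θ (n + 1)) (List.ofFn x) := by
    intro n x
    have : (gen 𝒱).compMultilinearMap (br n) = iadM 𝒱 n (θ (n + 1)) := by
      refine multilinear_ext_hom (dblGr 𝒱) fun x δ hx => ?_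
      obtain ⟨u, -, hu⟩ := exists_gen_of_mem_wt 𝒱 (hwt n x δ hx)
      simp only [br, LinearMap.compMultilinearMap_apply, iadM_apply, hu]
      rw [show r (gen 𝒱 u) = u from LinearMap.congr_fun hr u]
    rw [← iadM_apply, ← this]
    rfl
  have hmem : ∀ (n : ℕ) (x : Fin n → V × Module.Dual K V) (δ : Fin n → ℤ),
      (∀ i, x i ∈ dblGr 𝒱 (δ i)) → br n x ∈ dblGr 𝒱 (∑ i, δ i + 2 - n) := by
    intro n x δ hx
    have := hwt n x δ hx
    rw [← hbr] at this
    obtain ⟨u, hu, hu'⟩ := exists_gen_of_mem_wt 𝒱 this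
    rwa [gen_injective 𝒱 hu']
  have htop : ∀ x : V, x ∈ ⨆ d, 𝒱 d := fun x =>
    (GradedSpace.internal (𝒱 := 𝒱)).submodule_iSup_eq_top ▸ Submodule.mem_top
  have htop' : ∀ ξ : Module.Dual K V, ξ ∈ ⨆ d, dualGr 𝒱 d := fun ξ =>
    iSup_dualGr 𝒱 ▸ Submodule.mem_top
  refine ⟨
    { gr := dblGr 𝒱
      graded := inferInstance
      br := br
      br_zero := ?_
      br_degree := hmem
      br_swap := ?_
      jacobi := ?_
      form := pairing 𝒱
      form_degree := fun a b x y hx hy h => pairing_degree 𝒱 hx hy h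
      form_symm := ?_
      form_nondegenerate := ?_
      invariant := ?_
      plus := (⊤ : Submodule K V).prod ⊥
      plus_graded := ?_
      plus_isotropic := ?_
      plus_subalgebra := ?_
      minus := (⊥ : Submodule K V).prod ⊤
      minus_graded := ?_
      minus_lagrangian := ?_
      isCompl := ?_ }, rfl, rfl, rfl, rfl, fun n x => hbr (n + 1) x⟩
  · ext1 x
    refine gen_injective 𝒱 ?_
    rw [hbr, hθdef, weightPart_one 𝒱 ht, iad_zero]
    simp
  · intro n x δ hx i j hij
    refine gen_injective 𝒱 ?_
    rw [map_zsmul, hbr, hbr, ← iadM_apply, ← iadM_apply]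
    exact iadM_gradedSymm 𝒱 _ x δ hx i j hij
  · intro n x δ hx
    change jacobiator (fun n x => br n x) x δ = 0
    refine gen_injective 𝒱 ?_
    rw [map_zero]
    refine zsmul_two_eq_zero (K := K) ?_
    rw [← iad_antidiagonal 𝒱 hθ hbr hx, (bracket_self_iff 𝒱 ht.mem).1 ht.bracket_self,
      iad_zero]
  · intro a b x y hx hy
    by_cases h : a + b = 0
    · rw [pairing_hom_swap 𝒱 hx]
      congr 1
      obtain rfl : b = -a := by omega
      refine eps_congr ?_
      rw [show a - a * -a = a * (a + 1) by ring]
      exact Int.even_mul_succ_self a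
    · rw [pairing_degree 𝒱 hx hy h, pairing_degree 𝒱 hy hx (by omega), smul_zero]
  · exact ⟨fun u h => pairing_left_nondeg 𝒱 h, fun u h => pairing_right_nondeg 𝒱 h⟩
  · intro n x δ y e hx hy
    refine smul_one_inj 𝒱 ?_
    -- Pairing with y is one more bracket, so invariance is the graded commutation of the last two
    -- adjoint actions.
    rw [← adR_gen, hbr, smul_assoc, ← adR_gen, hbr, ofFn_succ_last x, iad_concat,
      adR_adR 𝒱 hy (hx _), ofFn_succ_last (Function.update x (Fin.last n) y), iad_concat,
      ksign_comm]
    simp [Function.update_of_ne, Fin.castSucc_ne_last]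
  · rintro ⟨x, ξ⟩ h
    rw [inl_induction h]
    have : (⨆ d, 𝒱 d).map (LinearMap.inl K V (Module.Dual K V)) ≤
        ⨆ d, (⊤ : Submodule K V).prod ⊥ ⊓ dblGr 𝒱 d := by
      rw [Submodule.map_iSup]
      refine iSup_mono fun d => ?_
      rintro _ ⟨x, hx, rfl⟩
      exact ⟨by simp, inl_mem_dblGr 𝒱 hx⟩
    exact this ⟨x, htop x, rfl⟩
  · intro x hx y hy
    rw [inl_induction hx, inl_induction hy]
    simp [pairing_apply]
  · intro n x hx
    have h0 : ((LinearMap.snd K V (Module.Dual K V)).compMultilinearMap (br n)).compLinearMap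
        (fun _ => LinearMap.inl K V (Module.Dual K V)) = 0 := by
      refine multilinear_ext_hom 𝒱 fun y δ hy => ?_
      -- The V^*-component is tested on z by one more bracket; with vectors in all n + 1 slots only
      -- t_{n+1,0} = 0 contributes.
      have hy' : ∀ z : V, ∀ d, z ∈ 𝒱 d → ((br n fun i => (y i, 0)).2) z = 0 := by
        intro z d hz
        have h1 := adR_gen 𝒱 (z, 0) (br n fun i => (y i, 0))
        have h2 := weightPart_inl 𝒱 ht.mem (y := (Fin.snoc y z : Fin (n + 1) → V))
          (δ := (Fin.snoc δ d : Fin (n + 1) → ℤ)) (fun i => by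
            refine Fin.lastCases ?_ (fun i => ?_) i
            · simpa using hz
            · simpa using hy i)
        rw [ht.t_k_zero, iad_zero, ofFn_succ_last, iad_concat] at h2
        simp only [Fin.snoc_castSucc, Fin.snoc_last] at h2
        rw [hbr, h2, ← zero_smul K] at h1
        have := smul_one_inj 𝒱 h1
        simpa [pairing_apply] using this.symm
      change (br n fun i => (y i, 0)).2 = 0
      exact ext_hom 𝒱 fun d z hz => hy' z d hz
    have h1 := congrArg (fun f => f fun i => (x i).1) h0
    refine Submodule.mem_prod.2 ⟨Submodule.mem_top, ?_⟩
    have hx' : x = fun i => ((x i).1, 0) := funext fun i => inl_induction (hx i)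
    rw [hx']
    exact h1
  · rintro ⟨x, ξ⟩ h
    have h1 : x = 0 := (Submodule.mem_bot K).1 (Submodule.mem_prod.1 h).1
    subst h1
    have : (⨆ d, dualGr 𝒱 d).map (LinearMap.inr K V (Module.Dual K V)) ≤
        ⨆ d, (⊥ : Submodule K V).prod ⊤ ⊓ dblGr 𝒱 d := by
      rw [Submodule.map_iSup]
      refine iSup_mono fun d => ?_
      rintro _ ⟨x, hx, rfl⟩
      exact ⟨by simp, inr_mem_dblGr 𝒱 hx⟩
    exact this ⟨ξ, htop' ξ, rfl⟩
  · rintro ⟨x, ξ⟩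
    constructor
    · rintro h ⟨y, η⟩ h'
      have h1 : x = 0 := (Submodule.mem_bot K).1 (Submodule.mem_prod.1 h).1
      have h2 : y = 0 := (Submodule.mem_bot K).1 (Submodule.mem_prod.1 h').1
      simp [pairing_apply, h1, h2]
    · intro h
      refine Submodule.mem_prod.2 ⟨(Submodule.mem_bot K).2 ?_, Submodule.mem_top⟩
      change x = 0
      rw [← gradInv_gradInv 𝒱 x]
      have : gradInv 𝒱 x = 0 := by
        rw [← Module.forall_dual_apply_eq_zero_iff K]
        intro η
        simpa [pairing_apply] using h (0, η) (by simp)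
      rw [this, map_zero]
  · constructor
    · rw [Submodule.disjoint_def]
      rintro ⟨x, ξ⟩ h h'
      exact Prod.ext ((Submodule.mem_bot K).1 (Submodule.mem_prod.1 h').1)
        ((Submodule.mem_bot K).1 (Submodule.mem_prod.1 h).2)
    · rw [codisjoint_iff, Submodule.eq_top_iff']
      rintro ⟨x, ξ⟩
      exact Submodule.mem_sup.2 ⟨(x, 0), by simp, (0, ξ), by simp, by simp⟩

/-! ### Uniqueness of the double and of the solution -/

theorem ManinQuasiTriple.ext_of_br {W : Type*} [AddCommGroup W] [Module K W]
    {T T' : ManinQuasiTriple K W} (hgr : T.gr = T'.gr) (hform : T.form = T'.form)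
    (hplus : T.plus = T'.plus) (hminus : T.minus = T'.minus)
    (hbr : ∀ n x, T.br (n + 1) x = T'.br (n + 1) x) : T = T' := by
  have h : T.br = T'.br := by
    funext n
    cases n with
    | zero => rw [T.br_zero, T'.br_zero]
    | succ n => ext1 x; exact hbr n x
  obtain ⟨⟨_, _, _, _, _, _, _⟩, _, _, _, _, _, _, _, _, _, _, _, _, _⟩ := T
  obtain ⟨⟨_, _, _, _, _, _, _⟩, _, _, _, _, _, _, _, _, _, _, _, _, _⟩ := T'
  simp only at hgr hform hplus hminus h
  subst hgr hform hplus hminus h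
  rfl

theorem IsDouble.unique {t : ℕ → ℕ → BigAlg 𝒱} {T T' : ManinQuasiTriple K (V × Module.Dual K V)}
    (h : IsDouble t T) (h' : IsDouble t T') : T = T' :=
  ManinQuasiTriple.ext_of_br (h.gr_eq.trans h'.gr_eq.symm) (h.form_eq.trans h'.form_eq.symm)
    (h.plus_eq.trans h'.plus_eq.symm) (h.minus_eq.trans h'.minus_eq.symm) fun n x =>
      gen_injective 𝒱 ((h.br_eq n x).trans (h'.br_eq n x).symm)

theorem IsDouble.gen_br {t : ℕ → ℕ → BigAlg 𝒱} (ht : IsMaurerCartan 𝒱 t)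
    {T : ManinQuasiTriple K (V × Module.Dual K V)} (h : IsDouble t T) (n : ℕ)
    (x : Fin n → V × Module.Dual K V) :
    gen 𝒱 (T.br n x) = iad 𝒱 (weightPart 𝒱 t (n + 1)) (List.ofFn x) := by
  cases n with
  | zero => rw [T.br_zero, weightPart_one 𝒱 ht, iad_zero]; simp
  | succ n => exact h.br_eq n x

/-- A solution is determined by its double. -/
theorem IsDouble.injective {t t' : ℕ → ℕ → BigAlg 𝒱} (ht : IsMaurerCartan 𝒱 t)
    (ht' : IsMaurerCartan 𝒱 t') {T : ManinQuasiTriple K (V × Module.Dual K V)}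
    (h : IsDouble t T) (h' : IsDouble t' T) : t = t' := by
  refine comp_sum_injective 𝒱 ht.mem ht'.mem fun N => ?_
  change weightPart 𝒱 t N = weightPart 𝒱 t' N
  cases N with
  | zero => rw [weightPart_zero 𝒱 ht, weightPart_zero 𝒱 ht']
  | succ n =>
    refine eq_of_iad 𝒱 (weightPart_mem 𝒱 ht.mem _) (weightPart_mem 𝒱 ht'.mem _) fun x δ hx => ?_
    rw [ofFn_succ_last, iad_concat, iad_concat, ← h.gen_br ht, ← h'.gen_br ht']

/-! ### The condition `t_{02} = 0` -/

variable (𝒱)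

theorem adR_list_prod {e : ℤ} {w : V × Module.Dual K V} (hw : w ∈ dblGr 𝒱 e)
    (l : List (V × Module.Dual K V)) (h : ∀ u ∈ l, pairing 𝒱 u w = 0) :
    adR 𝒱 w (l.map (gen 𝒱)).prod = 0 := by
  induction l with
  | nil => simp [adR_one]
  | cons u l ih =>
    rw [List.map_cons, List.prod_cons, adR_gen_mul 𝒱 hw, h u (by simp),
      ih fun u hu => h u (by simp [hu])]
    simp

theorem adR_inr_comp_zero {k : ℕ} {d e : ℤ} {F : BigAlg 𝒱} (hF : F ∈ comp 𝒱 k 0 d)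
    {ξ : Module.Dual K V} (hξ : ξ ∈ dualGr 𝒱 e) : adR 𝒱 (0, ξ) F = 0 := by
  induction hF using Submodule.span_induction with
  | mem P hP =>
    obtain ⟨η, a, x, b, hη, hx, -, rfl⟩ := hP
    have := adR_list_prod 𝒱 (inr_mem_dblGr 𝒱 hξ) (List.ofFn fun i => (0, η i)) (fun u hu => by
      obtain ⟨i, rfl⟩ := (List.mem_ofFn' _ _).1 hu
      simp [pairing_apply])
    rw [List.map_ofFn] at this
    simpa [Function.comp_def] using this
  | zero => simp
  | add x y _ _ hx hy => rw [map_add, hx, hy, add_zero]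
  | smul c x _ hx => rw [map_smul, hx, smul_zero]

theorem adR_inl_comp_zero {l : ℕ} {d e : ℤ} {F : BigAlg 𝒱} (hF : F ∈ comp 𝒱 0 l d)
    {y : V} (hy : y ∈ 𝒱 e) : adR 𝒱 (y, 0) F = 0 := by
  induction hF using Submodule.span_induction with
  | mem P hP =>
    obtain ⟨η, a, x, b, hη, hx, -, rfl⟩ := hP
    have := adR_list_prod 𝒱 (inl_mem_dblGr 𝒱 hy) (List.ofFn fun i => (x i, 0)) (fun u hu => by
      obtain ⟨i, rfl⟩ := (List.mem_ofFn' _ _).1 hu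
      simp [pairing_apply])
    rw [List.map_ofFn] at this
    simpa [Function.comp_def] using this
  | zero => simp
  | add x y _ _ hx hy => rw [map_add, hx, hy, add_zero]
  | smul c x _ hx => rw [map_smul, hx, smul_zero]

theorem two_smul_dil_adR_inr {k l : ℕ} {d : ℤ} {F : BigAlg 𝒱} (hF : F ∈ comp 𝒱 k l d)
    (ξ : Module.Dual K V) :
    (2 : K) • dil 𝒱 (adR 𝒱 (0, ξ) F) = (2 : K) ^ l • adR 𝒱 (0, ξ) F := by
  rw [← adR_inr_dil, dil_comp 𝒱 hF, map_smul]

variable {𝒱}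

/-- On V^* the differential is [t_{02} + t_{11}, ·], whose V-component comes from t_{02} alone. As
t_{02} is annihilated by brackets with V, it vanishes as soon as its brackets with V^* do. -/
theorem IsDouble.minusClosed_iff {t : ℕ → ℕ → BigAlg 𝒱} (ht : IsMaurerCartan 𝒱 t)
    {T : ManinQuasiTriple K (V × Module.Dual K V)} (h : IsDouble t T) :
    T.MinusClosed ↔ t 0 2 = 0 := by
  have hgen : ∀ ξ : Module.Dual K V, gen 𝒱 (T.br 1 fun _ => (0, ξ)) =
      adR 𝒱 (0, ξ) (t 0 2) + adR 𝒱 (0, ξ) (t 1 1) := by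
    intro ξ
    rw [h.gen_br ht, List.ofFn_succ, List.ofFn_zero, iad_cons, iad_nil, ← map_add]
    congr 1
    rw [weightPart, show Finset.HasAntidiagonal.antidiagonal (1 + 1) =
      ({(0, 2), (1, 1), (2, 0)} : Finset (ℕ × ℕ)) from rfl]
    simp [ht.t_k_zero]
  -- The operator `dil` - 1 projects the generators onto V. It fixes [t_{02}, ξ], which `dil`
  -- doubles, and kills [t_{11}, ξ].
  have key : ∀ ξ : Module.Dual K V, gen 𝒱 ((T.br 1 fun _ => (0, ξ)).1, 0) =
      adR 𝒱 (0, ξ) (t 0 2) := by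
    intro ξ
    have two : ∀ x y : BigAlg 𝒱, (2 : K) • x = (2 : K) • y → x = y := fun x y h =>
      smul_right_injective _ (two_ne_zero (α := K)) h
    have e1 := two_smul_dil_adR_inr 𝒱 (ht.mem 0 2) ξ
    have e2 := two_smul_dil_adR_inr 𝒱 (ht.mem 1 1) ξ
    rw [sq, mul_smul] at e1
    rw [pow_one] at e2
    have h1 := two _ _ e1
    have h2 := two _ _ e2
    have h3 := congrArg (dil 𝒱) (hgen ξ)
    rw [map_add, h1, h2, dil_gen] at h3
    have h4 : gen 𝒱 ((T.br 1 fun _ => (0, ξ)).1, 0) =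
        gen 𝒱 ((2 : K) • (T.br 1 fun _ => (0, ξ)).1, (T.br 1 fun _ => (0, ξ)).2) -
          gen 𝒱 (T.br 1 fun _ => (0, ξ)) := by
      rw [← map_sub]
      congr 1
      refine Prod.ext ?_ ?_
      · simp [two_smul]
      · simp
    rw [h4, h3, hgen, two_smul]
    abel
  constructor
  · intro hc
    refine eq_zero_of_adR 𝒱 (N := 1)
      (wt_cast 𝒱 (comp_le_wt 𝒱 0 2 _ (ht.mem 0 2)) (by norm_num) rfl) fun e w hw => ?_
    have h1 : adR 𝒱 (0, w.2) (t 0 2) = 0 := by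
      have := hc (0, w.2) (by rw [h.minus_eq]; simp)
      rw [h.minus_eq] at this
      rw [← key, (Submodule.mem_bot K).1 (Submodule.mem_prod.1 this).1]
      exact map_zero (gen 𝒱)
    rw [show w = (w.1, 0) + (0, w.2) by simp, map_add, LinearMap.add_apply, h1,
      adR_inl_comp_zero 𝒱 (ht.mem 0 2) ((mem_dblGr 𝒱).1 hw).1, add_zero]
  · rintro h0 ⟨x, ξ⟩ hx
    rw [h.minus_eq] at hx ⊢
    have h1 : x = 0 := (Submodule.mem_bot K).1 (Submodule.mem_prod.1 hx).1
    subst h1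
    refine Submodule.mem_prod.2 ⟨(Submodule.mem_bot K).2 ?_, Submodule.mem_top⟩
    have h2 := key ξ
    rw [h0, map_zero, ← map_zero (gen 𝒱)] at h2
    exact congrArg Prod.fst (gen_injective 𝒱 h2)

/-! ### From quasi-triples to solutions of the Maurer-Cartan equation -/

variable (𝒱)

/-- The annihilation by V^* persists under brackets with V, because the actions commute up to sign;
so vectors suffice as test arguments. -/
theorem eq_zero_of_iad_inl {N : ℕ} {d : ℤ} {F : BigAlg 𝒱} (hF : F ∈ wt 𝒱 N d)
    (h0 : ∀ e, ∀ ξ ∈ dualGr 𝒱 e, adR 𝒱 (0, ξ) F = 0)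
    (h : ∀ (y : Fin N → V) (δ : Fin N → ℤ), (∀ i, y i ∈ 𝒱 (δ i)) →
      iad 𝒱 F (List.ofFn fun i => (y i, 0)) = 0) : F = 0 := by
  induction N generalizing F d with
  | zero => simpa [iad_nil] using h Fin.elim0 Fin.elim0 (fun i => i.elim0)
  | succ N ih =>
    refine eq_zero_of_adR 𝒱 hF fun e w hw => ?_
    obtain ⟨hw1, hw2⟩ := (mem_dblGr 𝒱).1 hw
    rw [show w = (w.1, 0) + (0, w.2) by simp, map_add, LinearMap.add_apply, h0 e _ hw2, add_zero]
    refine ih (adR_mem_wt 𝒱 (inl_mem_dblGr 𝒱 hw1) hF) (fun e' ξ hξ => ?_) fun y δ hy => ?_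
    · rw [adR_adR 𝒱 (inr_mem_dblGr 𝒱 hξ) (inl_mem_dblGr 𝒱 hw1), h0 e' ξ hξ, map_zero, smul_zero]
    · have := h (Fin.cons w.1 y) (Fin.cons e δ) (cons_hom hw1 hy)
      rw [List.ofFn_succ, iad_cons] at this
      simpa using this

variable {𝒱}

/-- Brings the exchange of the last two slots into the shape of the invariance axiom. -/
theorem init_swap_last {E : Type*} {n : ℕ} (x : Fin (n + 2) → E) :
    x ∘ Equiv.swap (Fin.last n).castSucc (Fin.last (n + 1)) =
      Fin.snoc (Function.update (fun i : Fin (n + 1) => x i.castSucc) (Fin.last n)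
        (x (Fin.last (n + 1)))) (x (Fin.last n).castSucc) := by
  funext k
  refine Fin.lastCases ?_ (fun k => ?_) k
  · simp
  · refine Fin.lastCases ?_ (fun k => ?_) k
    · simp
    · rw [Function.comp_apply, Equiv.swap_apply_of_ne_of_ne, Fin.snoc_castSucc,
        Function.update_of_ne (Fin.castSucc_ne_last k)]
      · exact fun hc => Fin.castSucc_ne_last k (Fin.castSucc_injective _ hc)
      · exact Fin.castSucc_ne_last _

theorem init_swap_castSucc {E : Type*} {n : ℕ} (x : Fin (n + 1) → E) (i j : Fin n) :
    (fun k : Fin n => (x ∘ Equiv.swap i.castSucc j.castSucc) k.castSucc) =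
      (fun k : Fin n => x k.castSucc) ∘ Equiv.swap i j := by
  funext k
  simp only [Function.comp_apply]
  rw [Equiv.swap_apply_def, Equiv.swap_apply_def]
  simp only [Fin.castSucc_inj]
  split_ifs <;> rfl

theorem ManinQuasiTriple.exists_maurerCartan (T : ManinQuasiTriple K (V × Module.Dual K V))
    (hgr : T.gr = dblGr 𝒱) (hform : T.form = pairing 𝒱)
    (hplus : T.plus = (⊤ : Submodule K V).prod ⊥) (hminus : T.minus = (⊥ : Submodule K V).prod ⊤) :
    ∃ t : ℕ → ℕ → BigAlg 𝒱, IsMaurerCartan 𝒱 t ∧ IsDouble t T := by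
  -- The output of the bracket becomes an additional last slot.
  let c : ∀ n, MultilinearMap K (fun _ : Fin (n + 1) => V × Module.Dual K V) K := fun n =>
    MultilinearMap.uncurryRight ((pairing 𝒱).compMultilinearMap (T.br n))
  have hc : ∀ n x, c n x = pairing 𝒱 (T.br n fun i => x i.castSucc) (x (Fin.last n)) :=
    fun n x => rfl
  have hdeg : ∀ (n : ℕ) (x : Fin n → V × Module.Dual K V) (δ : Fin n → ℤ),
      (∀ i, x i ∈ dblGr 𝒱 (δ i)) → T.br n x ∈ dblGr 𝒱 (∑ i, δ i + 2 - n) := by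
    intro n x δ hx
    have := T.br_degree n x δ (by rw [hgr]; exact hx)
    rwa [hgr] at this
  -- Exchanges among the first n slots are covered by the symmetry of the bracket; the exchange with
  -- the added slot is invariance.
  have hsymm : ∀ n, GradedSymm (dblGr 𝒱) (c n) := by
    intro n x δ hx i j hij
    obtain ⟨i, rfl⟩ := Fin.exists_castSucc_eq.2 (show i ≠ Fin.last n by
      rintro rfl; have := j.2; simp at hij; omega)
    refine Fin.lastCases (motive := fun j => (j : ℕ) = i.castSucc + 1 →
      c n (x ∘ Equiv.swap i.castSucc j) = ksign (δ i.castSucc) (δ j) • c n x) ?_ (fun j => ?_) j hij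
    · intro hij
      obtain ⟨m, rfl⟩ : ∃ m, n = m + 1 := ⟨n - 1, by have := i.2; omega⟩
      obtain rfl : i = Fin.last m := Fin.ext (by simpa using hij.symm)
      rw [init_swap_last, hc, hc]
      simp only [Fin.snoc_castSucc, Fin.snoc_last]
      have := T.invariant m (fun i => x i.castSucc) (fun i => δ i.castSucc)
        (x (Fin.last (m + 1))) (δ (Fin.last (m + 1))) (by rw [hgr]; exact fun i => hx _)
        (by rw [hgr]; exact hx _)
      rw [hform] at this
      rw [this, smul_smul, ksign_mul_self, one_smul]
    · intro hij
      rw [hc, hc, init_swap_castSucc, T.br_swap n _ (fun i => δ i.castSucc)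
        (by rw [hgr]; exact fun i => hx _) i j (by simpa using hij), map_zsmul,
        LinearMap.smul_apply, Function.comp_apply, Equiv.swap_apply_of_ne_of_ne
          (Fin.castSucc_ne_last _).symm (Fin.castSucc_ne_last _).symm]
  have hfd : ∀ n : ℕ, FormDegree (dblGr 𝒱) (c n) (3 - (n + 1 : ℕ)) := by
    intro n x δ hx hne
    rw [hc]
    refine pairing_degree 𝒱 (hdeg n _ (fun i => δ i.castSucc) fun i => hx _) (hx _) ?_
    rw [Fin.sum_univ_castSucc] at hne
    push_cast at hne
    intro h0
    exact hne (by linarith)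
  choose θ' hθ' hiad using fun n => exists_iad_eq 𝒱 (c n) (hsymm n) (hfd n)
  -- The n-ary bracket has weight n + 1. No bracket sees weight 0, which is set to zero as t_{00} =
  -- 0 demands.
  obtain ⟨θ, hθ0, hθs⟩ : ∃ θ : ℕ → BigAlg 𝒱, θ 0 = 0 ∧ ∀ n, θ (n + 1) = θ' n :=
    ⟨fun N => Nat.casesOn N 0 θ', rfl, fun _ => rfl⟩
  have hθ : ∀ a : ℕ, θ a ∈ wt 𝒱 a (3 - a) := by
    intro a
    cases a with
    | zero => rw [hθ0]; exact zero_mem _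
    | succ a => rw [hθs]; exact hθ' a
  have hbr : ∀ n x, gen 𝒱 (T.br n x) = iad 𝒱 (θ (n + 1)) (List.ofFn x) := by
    intro n x
    have : (gen 𝒱).compMultilinearMap (T.br n) = iadM 𝒱 n (θ (n + 1)) := by
      refine multilinear_ext_hom (dblGr 𝒱) fun x δ hx => ?_
      have hw := iad_mem_wt 𝒱 (homList_ofFn 𝒱 hx) (N := 1) (F := θ (n + 1))
        (d := 3 - (n + 1 : ℕ)) (wt_cast 𝒱 (hθ (n + 1)) (by rw [List.length_ofFn, add_comm]) rfl)
      obtain ⟨u, -, hu⟩ := exists_gen_of_mem_wt 𝒱 hw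
      rw [LinearMap.compMultilinearMap_apply, iadM_apply, hu]
      congr 1
      -- The form c records only pairings, so the bracket is recovered by nondegeneracy.
      rw [← sub_eq_zero]
      refine pairing_left_nondeg 𝒱 fun y => ?_
      induction y using hom_induction (dblGr 𝒱) with
      | h0 => simp
      | ha y z hy hz => rw [map_add, hy, hz, add_zero]
      | hh d y hy =>
        have h1 := hiad n (Fin.snoc x y : Fin (n + 1) → V × Module.Dual K V)
          (Fin.snoc δ d : Fin (n + 1) → ℤ) (fun i => by
            refine Fin.lastCases ?_ (fun i => ?_) i
            · simpa using hy
            · simpa using hx i)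
        rw [ofFn_succ_last, iad_concat, hc] at h1
        simp only [Fin.snoc_castSucc, Fin.snoc_last] at h1
        rw [← hθs, hu, adR_gen] at h1
        rw [map_sub, LinearMap.sub_apply, smul_one_inj 𝒱 h1, sub_self]
    rw [← iadM_apply, ← this]
    rfl
  have hθ1 : θ 1 = 0 := by
    refine eq_of_iad 𝒱 (hθ 1) (zero_mem _) fun x δ hx => ?_
    rw [iad_zero, hθs 0, hiad 0 x δ hx, hc, T.br_zero]
    simp
  choose s hs hsum using fun N => exists_comp_sum 𝒱 (hθ N)
  let t : ℕ → ℕ → BigAlg 𝒱 := fun k l => s (k + l) (k, l)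
  have htm : ∀ k l : ℕ, t k l ∈ comp 𝒱 k l (3 - k - l) := by
    intro k l
    have h1 := hs (k + l) (k, l)
    rw [show (3 - (k + l : ℕ) : ℤ) = 3 - k - l by push_cast; ring] at h1
    exact h1
  have htw : ∀ N, weightPart 𝒱 t N = θ N := by
    intro N
    rw [← hsum N]
    refine Finset.sum_congr rfl fun p hp => ?_
    rw [Finset.HasAntidiagonal.mem_antidiagonal] at hp
    subst hp
    rfl
  -- On vectors, θ_k reduces to t_{k0}. It vanishes there because `plus` is closed under the
  -- brackets and isotropic; brackets with covectors kill t_{k0} anyway.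
  have hk0 : ∀ k, t k 0 = 0 := by
    intro k
    refine eq_zero_of_iad_inl 𝒱 (N := k)
      (wt_cast 𝒱 (comp_le_wt 𝒱 k 0 _ (htm k 0)) (Nat.add_zero k) rfl)
      (fun e ξ hξ => adR_inr_comp_zero 𝒱 (htm k 0) hξ) fun y δ hy => ?_
    rw [← weightPart_inl 𝒱 htm hy, htw]
    cases k with
    | zero => rw [hθ0]; exact iad_zero 𝒱 _
    | succ n =>
      have h1 := hiad n (fun i => (y i, 0)) δ fun i => inl_mem_dblGr 𝒱 (hy i)
      have h2 : ∀ z : V, ((z, 0) : V × Module.Dual K V) ∈ T.plus := fun z => by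
        rw [hplus]; simp
      rw [hc, ← hform, T.plus_isotropic _ (T.plus_subalgebra n _ fun i => h2 _) _ (h2 _),
        zero_smul] at h1
      rw [hθs]
      exact h1
  have h01 : t 0 1 = 0 := by
    have h1 := (htw 1).trans hθ1
    rw [weightPart, show Finset.HasAntidiagonal.antidiagonal 1 =
      ({(0, 1), (1, 0)} : Finset (ℕ × ℕ)) from rfl] at h1
    simpa [hk0] using h1
  refine ⟨t, ⟨htm, hk0, h01, (bracket_self_iff 𝒱 htm).2 fun N => ?_⟩,
    ⟨hgr, hform, hplus, hminus, fun n x => ?_⟩⟩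
  · simp only [htw]
    have hz : ∀ a, a ≤ 1 → θ a = 0 := by
      intro a ha
      interval_cases a
      · exact hθ0
      · exact hθ1
    -- Below 3 one of the two weights is at most 1, where θ is zero. For N = n + 3 the sum has
    -- weight n + 1; the first n test arguments already produce twice the Jacobi sum.
    rcases Nat.lt_or_ge N 3 with hN | hN
    · refine Finset.sum_eq_zero fun r hr => ?_
      rw [Finset.HasAntidiagonal.mem_antidiagonal] at hr
      rcases (show r.1 ≤ 1 ∨ r.2 ≤ 1 by omega) with h | h <;> rw [hz _ h] <;> simp
    · obtain ⟨n, rfl⟩ : ∃ n, N = n + 3 := ⟨N - 3, by omega⟩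
      have hmem : ∑ r ∈ Finset.HasAntidiagonal.antidiagonal (n + 3),
          bigBracket 𝒱 (θ r.1) (θ r.2) ∈ wt 𝒱 (n + 1) (3 - n) := by
        refine sum_mem fun r hr => ?_
        rw [Finset.HasAntidiagonal.mem_antidiagonal] at hr
        rcases Nat.eq_zero_or_pos r.1 with h | h
        · rw [hz r.1 (by omega)]; simp
        rcases Nat.eq_zero_or_pos r.2 with h' | h'
        · rw [hz r.2 (by omega)]; simp
        refine wt_cast 𝒱 (bigBracket_mem_wt 𝒱 (N := r.1 - 1) (M := r.2 - 1)
          (wt_cast 𝒱 (hθ r.1) (by omega) rfl) (wt_cast 𝒱 (hθ r.2) (by omega) rfl))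
          (by omega) (by omega)
      refine eq_zero_of_iad 𝒱 hmem fun x δ hx => ?_
      have hj := T.jacobi n (fun i => x i.castSucc) (fun i => δ i.castSucc)
        (by rw [hgr]; exact fun i => hx _)
      rw [ofFn_succ_last, iad_concat, iad_antidiagonal 𝒱 (br := fun n x => T.br n x) hθ hbr
        (fun i => hx i.castSucc)]
      have hj' : jacobiator (fun n x => T.br n x) (fun i => x i.castSucc)
        (fun i => δ i.castSucc) = 0 := hj
      rw [hj']
      simp
  · change _ = iad 𝒱 (weightPart 𝒱 t (n + 2)) _
    rw [hbr, htw]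

end

section

/-! ### Transport of structure -/

variable {K : Type u} [Field K] {W : Type v} [AddCommGroup W] [Module K W]
  {W' : Type w} [AddCommGroup W'] [Module K W']

theorem mem_map_equiv (e : W ≃ₗ[K] W') (p : Submodule K W) {x : W'} :
    x ∈ p.map e.toLinearMap ↔ e.symm x ∈ p := Submodule.mem_map_equiv p

theorem graded_map [CharZero K] (e : W ≃ₗ[K] W') (gr : ℤ → Submodule K W) [GradedSpace gr] :
    GradedSpace fun d => (gr d).map e.toLinearMap where
  internal := by
    rw [DirectSum.isInternal_submodule_iff_iSupIndep_and_iSup_eq_top]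
    constructor
    · refine iSupIndep_of_eigen (e.toLinearMap ∘ₗ degOp gr ∘ₗ e.symm.toLinearMap)
        (fun d : ℤ => (d : K)) Int.cast_injective _ fun d x hx => ?_
      rw [mem_map_equiv] at hx
      simp only [LinearMap.comp_apply, LinearEquiv.coe_coe]
      rw [degOp_apply gr hx, map_zsmul, LinearEquiv.apply_symm_apply, Int.cast_smul_eq_zsmul]
    · rw [← Submodule.map_iSup, (GradedSpace.internal (𝒱 := gr)).submodule_iSup_eq_top,
        Submodule.map_top]
      exact LinearEquiv.range e

theorem map_le_iSup_inf (e : W ≃ₗ[K] W') {p : Submodule K W} {gr : ℤ → Submodule K W}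
    (h : p ≤ ⨆ d, p ⊓ gr d) : p.map e.toLinearMap ≤
      ⨆ d, p.map e.toLinearMap ⊓ (gr d).map e.toLinearMap := by
  refine (Submodule.map_mono h).trans ?_
  rw [Submodule.map_iSup]
  exact iSup_mono fun d => Submodule.map_inf_le _

/-- Transport of a quasi-triple along a linear isomorphism. -/
def ManinQuasiTriple.transport [CharZero K] (T : ManinQuasiTriple K W) (e : W ≃ₗ[K] W') :
    ManinQuasiTriple K W' where
  gr d := (T.gr d).map e.toLinearMap
  graded := haveI := T.graded; graded_map e T.gr
  br n := (e.toLinearMap.compMultilinearMap (T.br n)).compLinearMap fun _ => e.symm.toLinearMap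
  br_zero := by rw [T.br_zero]; ext; simp
  br_degree n x d hx := by
    refine Submodule.mem_map_of_mem (T.br_degree n _ d fun i => ?_)
    exact (mem_map_equiv e _).1 (hx i)
  br_swap n x d hx i j hij := by
    have := T.br_swap n (fun i => e.symm (x i)) d (fun i => (mem_map_equiv e _).1 (hx i)) i j hij
    exact (congrArg e this).trans (map_zsmul e _ _)
  jacobi n x d hx := by
    have := congrArg e
      (T.jacobi n (fun i => e.symm (x i)) d (fun i => (mem_map_equiv e _).1 (hx i)))
    rw [map_zero, map_sum] at this
    rw [← this]
    refine Finset.sum_congr rfl fun I _ => ?_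
    rw [map_zsmul]
    simp only [MultilinearMap.compLinearMap_apply, LinearMap.compMultilinearMap_apply,
      LinearEquiv.coe_coe]
    congr 3
    funext i
    refine Fin.cases ?_ (fun i => ?_) i <;> simp
  form := T.form.compl₁₂ e.symm.toLinearMap e.symm.toLinearMap
  form_degree a b x y hx hy h :=
    T.form_degree a b _ _ ((mem_map_equiv e _).1 hx) ((mem_map_equiv e _).1 hy) h
  form_symm a b x y hx hy :=
    T.form_symm a b _ _ ((mem_map_equiv e _).1 hx) ((mem_map_equiv e _).1 hy)
  form_nondegenerate := by
    constructor
    · intro x hx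
      have := T.form_nondegenerate.1 (e.symm x) fun y => by simpa using hx (e y)
      simpa using this
    · intro x hx
      have := T.form_nondegenerate.2 (e.symm x) fun y => by simpa using hx (e y)
      simpa using this
  invariant n x d y f hx hy := by
    have := T.invariant n (fun i => e.symm (x i)) d (e.symm y) f
      (fun i => (mem_map_equiv e _).1 (hx i)) ((mem_map_equiv e _).1 hy)
    simp only [MultilinearMap.compLinearMap_apply, LinearMap.compMultilinearMap_apply,
      LinearEquiv.coe_coe, LinearMap.compl₁₂_apply, LinearEquiv.symm_apply_apply]
    rw [this]
    congr 4
    funext i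
    by_cases hi : i = Fin.last n
    · subst hi; simp
    · simp [Function.update_of_ne hi]
  plus := T.plus.map e.toLinearMap
  plus_graded := map_le_iSup_inf e T.plus_graded
  plus_isotropic x hx y hy :=
    T.plus_isotropic _ ((mem_map_equiv e _).1 hx) _ ((mem_map_equiv e _).1 hy)
  plus_subalgebra n x hx :=
    Submodule.mem_map_of_mem (T.plus_subalgebra n _ fun i => (mem_map_equiv e _).1 (hx i))
  minus := T.minus.map e.toLinearMap
  minus_graded := map_le_iSup_inf e T.minus_graded
  minus_lagrangian x := by
    rw [mem_map_equiv, T.minus_lagrangian]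
    constructor
    · intro h y hy
      exact h _ ((mem_map_equiv e _).1 hy)
    · intro h y hy
      have := h (e y) (Submodule.mem_map_of_mem hy)
      simpa using this
  isCompl := by
    have := T.isCompl
    exact this.map (Submodule.orderIsoMapComap e)

theorem ManinQuasiTriple.transport_isIso [CharZero K] (T : ManinQuasiTriple K W)
    (e : W ≃ₗ[K] W') : ManinQuasiTriple.IsIso T (T.transport e) e.toLinearMap where
  bijective := e.bijective
  map_gr _ := rfl
  map_plus := rfl
  map_minus := rfl
  map_form x y := by simp [transport]
  map_br n x := by simp [transport]

theorem ManinQuasiTriple.IsIso.minusClosed_iff {T : ManinQuasiTriple K W}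
    {T' : ManinQuasiTriple K W'} {F : W →ₗ[K] W'} (h : IsIso T T' F) :
    T.MinusClosed ↔ T'.MinusClosed := by
  constructor
  · intro hc x hx
    rw [← h.map_minus] at hx ⊢
    obtain ⟨y, hy, rfl⟩ := hx
    rw [← h.map_br 1 fun _ => y]
    exact Submodule.mem_map_of_mem (hc y hy)
  · intro hc x hx
    have h1 := hc (F x) (by rw [← h.map_minus]; exact Submodule.mem_map_of_mem hx)
    rw [← h.map_br 1 fun _ => x, ← h.map_minus] at h1
    obtain ⟨y, hy, hxy⟩ := h1
    rwa [← h.bijective.1 hxy]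

/-! ### Homogeneous elements -/

/-- The vectors (i - d) x_i, with x_i the components of `x`, sum to zero and are eigenvectors for
distinct eigenvalues; hence x_i = 0 for i ≠ d. -/
theorem mem_of_degOp [CharZero K] (gr : ℤ → Submodule K W) [GradedSpace gr] {d : ℤ} {x : W}
    (h : degOp gr x = d • x) : x ∈ gr d := by
  classical
  let _ := (GradedSpace.internal (𝒱 := gr)).chooseDecomposition
  set s := (DirectSum.decompose gr x).support
  have hx : ∑ i ∈ s, (DirectSum.decompose gr x i : W) = x := DirectSum.sum_support_decompose gr x
  have hm : ∀ i, (DirectSum.decompose gr x i : W) ∈ gr i := fun i => SetLike.coe_mem _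
  have hz := eq_zero_of_sum_eigen (degOp gr) (fun i : ℤ => (i : K)) s Int.cast_injective.injOn
    (fun i => (i - d) • (DirectSum.decompose gr x i : W)) (fun i _ => by
      rw [map_zsmul, degOp_apply gr (hm i), Int.cast_smul_eq_zsmul, smul_comm]) (by
      simp only [sub_smul, Finset.sum_sub_distrib]
      rw [← Finset.smul_sum, hx, ← h]
      conv_rhs => rw [← sub_self (degOp gr x)]
      congr 1
      conv_rhs => rw [← hx, map_sum]
      exact Finset.sum_congr rfl fun i _ => (degOp_apply gr (hm i)).symm)
  rw [← hx]
  refine sum_mem fun i hi => ?_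
  by_cases hid : i = d
  · exact hid ▸ hm i
  · have h1 := hz i hi
    rw [← Int.cast_smul_eq_zsmul K] at h1
    rw [(smul_eq_zero.1 h1).resolve_left (by exact_mod_cast sub_ne_zero.2 hid)]
    exact zero_mem _

/-- A bijective linear map of degree `0` is an isomorphism of graded spaces. -/
theorem map_gr_eq [CharZero K] {gr : ℤ → Submodule K W} {gr' : ℤ → Submodule K W'}
    [GradedSpace gr] [GradedSpace gr'] {F : W →ₗ[K] W'} (hF : Function.Bijective F)
    (h : ∀ d, ∀ x ∈ gr d, F x ∈ gr' d) (d : ℤ) : (gr d).map F = gr' d := by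
  -- Since F intertwines the degree operators, preimages of homogeneous elements are eigenvectors,
  -- hence homogeneous.
  have hc : F ∘ₗ degOp gr = degOp gr' ∘ₗ F := ext_hom gr fun d x hx => by
    rw [LinearMap.comp_apply, LinearMap.comp_apply, degOp_apply gr hx, degOp_apply gr' (h d x hx),
      map_zsmul]
  refine le_antisymm ?_ fun y hy => ?_
  · rintro _ ⟨x, hx, rfl⟩
    exact h d x hx
  · obtain ⟨x, rfl⟩ := hF.2 y
    refine Submodule.mem_map_of_mem (mem_of_degOp gr (hF.1 ?_))
    have := LinearMap.congr_fun hc x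
    rw [LinearMap.comp_apply, LinearMap.comp_apply, degOp_apply gr' hy] at this
    rw [this, map_zsmul]

theorem degOp_mem [CharZero K] {gr : ℤ → Submodule K W} [GradedSpace gr] {p : Submodule K W}
    (hp : p ≤ ⨆ d, p ⊓ gr d) {x : W} (hx : x ∈ p) : degOp gr x ∈ p := by
  have hx' := hp hx
  clear hx
  induction hx' using Submodule.iSup_induction' with
  | mem d x hx => rw [degOp_apply gr hx.2]; exact zsmul_mem hx.1 _
  | zero => simp
  | add x y _ _ hx hy => rw [map_add]; exact add_mem hx hy

/-! ### A quasi-triple is isomorphic to the sum of its subalgebra and the dual space -/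

namespace ManinQuasiTriple

variable (T : ManinQuasiTriple K W)

instance : GradedSpace T.gr := T.graded

/-- The projection onto `plus` along `minus`. -/
def proj : W →ₗ[K] T.plus := Submodule.projectionOnto T.plus T.minus T.isCompl

theorem proj_plus (x : T.plus) : T.proj x = x :=
  Submodule.projectionOnto_apply_left T.isCompl x

theorem proj_eq_zero {x : W} : T.proj x = 0 ↔ x ∈ T.minus :=
  Submodule.projectionOnto_apply_eq_zero_iff T.isCompl

theorem sub_proj_mem (x : W) : x - T.proj x ∈ T.minus := by
  rw [← proj_eq_zero, map_sub, proj_plus, sub_self]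

/-- The map `W → plus ⊕ plus^*`. -/
def toDouble : W →ₗ[K] T.plus × Module.Dual K T.plus :=
  T.proj.prod (T.form.compl₂ T.plus.subtype)

theorem toDouble_apply (x : W) : T.toDouble x = (T.proj x, T.form x ∘ₗ T.plus.subtype) := rfl

theorem toDouble_plus (x : T.plus) : T.toDouble x = (x, 0) := by
  rw [toDouble_apply, proj_plus]
  refine Prod.ext rfl ?_
  ext y
  exact T.plus_isotropic _ x.2 _ y.2

/-- An element of the kernel lies in `minus`, so it is orthogonal to `minus`; its second component
makes it orthogonal to `plus` as well. -/
theorem toDouble_injective : Function.Injective T.toDouble := by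
  refine (injective_iff_map_eq_zero _).2 fun x hx => T.form_nondegenerate.1 x fun y => ?_
  have h1 : x ∈ T.minus := T.proj_eq_zero.1 (congrArg Prod.fst hx)
  have h2 : T.form x (T.proj y) = 0 := LinearMap.congr_fun (congrArg Prod.snd hx) (T.proj y)
  rw [← sub_add_cancel y (T.proj y : W), map_add, h2,
    (T.minus_lagrangian x).1 h1 _ (T.sub_proj_mem y), add_zero]

theorem toDouble_bijective [Module.Finite K W] : Function.Bijective T.toDouble := by
  refine ⟨T.toDouble_injective, ?_⟩
  rintro ⟨x, ξ⟩
  have hinj : Function.Injective T.form :=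
    (injective_iff_map_eq_zero _).2 fun x hx => T.form_nondegenerate.1 x fun y => by simp [hx]
  -- By finite dimension the form represents the extension of ξ by zero on `minus`. Removing the
  -- `plus`-part of w does not change its pairing with `plus`, which is isotropic.
  obtain ⟨w, hw⟩ := (LinearMap.injective_iff_surjective_of_finrank_eq_finrank
    (Subspace.dual_finrank_eq (K := K) (V := W)).symm).1 hinj (ξ ∘ₗ T.proj)
  refine ⟨x + (w - T.proj w), ?_⟩
  rw [map_add, toDouble_plus, toDouble_apply, T.proj_eq_zero.2 (T.sub_proj_mem w)]
  have : T.form (w - T.proj w) ∘ₗ T.plus.subtype = ξ := by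
    ext y
    rw [LinearMap.comp_apply, map_sub, LinearMap.sub_apply, hw]
    simp [proj_plus, T.plus_isotropic _ (T.proj w).2 _ y.2]
  rw [this]
  simp

variable [CharZero K]

/-- Both graded subspaces are stable under the degree operator, so the defect of the projection from
being an eigenvector lies in `plus` and in `minus`. -/
theorem proj_degree {d : ℤ} {x : W} (hx : x ∈ T.gr d) : T.proj x ∈ T.plusGr d := by
  change (T.proj x : W) ∈ T.gr d
  refine mem_of_degOp T.gr ?_
  have h1 : degOp T.gr (T.proj x : W) - d • (T.proj x : W) ∈ T.plus :=
    sub_mem (degOp_mem T.plus_graded (T.proj x).2) (zsmul_mem (T.proj x).2 _)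
  have h2 : degOp T.gr (T.proj x : W) - d • (T.proj x : W) ∈ T.minus := by
    have h3 : degOp T.gr (x - T.proj x) - d • (x - (T.proj x : W)) ∈ T.minus :=
      sub_mem (degOp_mem T.minus_graded (T.sub_proj_mem x)) (zsmul_mem (T.sub_proj_mem x) _)
    rw [map_sub, degOp_apply T.gr hx, smul_sub, sub_sub_sub_cancel_left] at h3
    rw [← neg_sub]
    exact neg_mem h3
  exact sub_eq_zero.1 (Submodule.disjoint_def.1 T.isCompl.disjoint _ h1 h2)

theorem toDouble_degree [Module.Finite K W] (d : ℤ) :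
    (T.gr d).map T.toDouble = dblGr T.plusGr d := by
  refine map_gr_eq T.toDouble_bijective (fun d x hx => ?_) d
  refine (mem_dblGr T.plusGr).2 ⟨T.proj_degree hx, fun b hb y hy => ?_⟩
  exact T.form_degree d b x y hx hy (by omega)

/-- This is the sign built into the canonical pairing: only degree -a pairs with degree a, and
(-1)^{a(-a)} = (-1)^a. -/
theorem form_plus (x : T.plus) (m : W) : T.form x m = T.form m (gradInv T.plusGr x) := by
  induction x using hom_induction T.plusGr with
  | h0 => simp
  | ha x y hx hy => simp only [Submodule.coe_add, map_add, LinearMap.add_apply, hx, hy]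
  | hh a x hx =>
    rw [gradInv_apply T.plusGr hx]
    induction m using hom_induction T.gr with
    | h0 => simp
    | ha m n hm hn => simp only [map_add, LinearMap.add_apply, hm, hn]
    | hh b m hm =>
      rw [T.form_symm a b x m hx hm, SetLike.val_smul_of_tower, map_zsmul]
      by_cases h : a + b = 0
      · congr 1
        obtain rfl : b = -a := by omega
        refine eps_congr ?_
        rw [show a * -a - a = -(a * (a + 1)) by ring]
        exact (Int.even_mul_succ_self a).neg
      · rw [T.form_degree b a m x hm hx (by omega), smul_zero, smul_zero]

theorem toDouble_form [Module.Finite K W] (x y : W) :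
    pairing T.plusGr (T.toDouble x) (T.toDouble y) = T.form x y := by
  change T.form x (T.proj y) + T.form y (gradInv T.plusGr (T.proj x)) = _
  rw [← form_plus]
  -- Both subspaces are isotropic, so only the two mixed terms of the form survive.
  have h1 : T.form (x - T.proj x) (y - T.proj y) = 0 :=
    (T.minus_lagrangian _).1 (T.sub_proj_mem x) _ (T.sub_proj_mem y)
  have h2 := T.plus_isotropic _ (T.proj x).2 _ (T.proj y).2
  simp only [map_sub, LinearMap.sub_apply, h2] at h1
  linear_combination -h1

theorem toDouble_map_plus [Module.Finite K W] :
    T.plus.map T.toDouble = (⊤ : Submodule K T.plus).prod ⊥ := by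
  ext u
  constructor
  · rintro ⟨x, hx, rfl⟩
    rw [T.toDouble_plus ⟨x, hx⟩]
    simp
  · intro hu
    rw [inl_induction hu]
    exact ⟨u.1, u.1.2, T.toDouble_plus u.1⟩

theorem toDouble_map_minus [Module.Finite K W] :
    T.minus.map T.toDouble = (⊥ : Submodule K T.plus).prod ⊤ := by
  ext u
  constructor
  · rintro ⟨x, hx, rfl⟩
    exact Submodule.mem_prod.2 ⟨(Submodule.mem_bot K).2 (T.proj_eq_zero.2 hx), Submodule.mem_top⟩
  · intro hu
    obtain ⟨x, rfl⟩ := T.toDouble_bijective.2 u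
    exact ⟨x, T.proj_eq_zero.1 ((Submodule.mem_bot K).1 (Submodule.mem_prod.1 hu).1), rfl⟩

end ManinQuasiTriple

end

section

/-! ### Presentations -/

variable {K : Type u} [Field K] [CharZero K]

namespace ManinQuasiTriple

theorem IsIso.target_unique {W : Type v} [AddCommGroup W] [Module K W] {W' : Type w}
    [AddCommGroup W'] [Module K W'] {T : ManinQuasiTriple K W} {T₁ T₂ : ManinQuasiTriple K W'}
    {F : W →ₗ[K] W'} (h₁ : IsIso T T₁ F) (h₂ : IsIso T T₂ F) : T₁ = T₂ := by
  refine ext_of_br (funext fun d => (h₁.map_gr d).symm.trans (h₂.map_gr d)) ?_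
    (h₁.map_plus.symm.trans h₂.map_plus) (h₁.map_minus.symm.trans h₂.map_minus) fun n x => ?_
  · ext x y
    obtain ⟨x, rfl⟩ := h₁.bijective.2 x
    obtain ⟨y, rfl⟩ := h₁.bijective.2 y
    rw [h₁.map_form, h₂.map_form]
  · choose y hy using fun i => h₁.bijective.2 (x i)
    obtain rfl : (fun i => F (y i)) = x := funext hy
    rw [← h₁.map_br, ← h₂.map_br]

variable {W : Type v} [AddCommGroup W] [Module K W] [Module.Finite K W] (T : ManinQuasiTriple K W)

/-- An isomorphism with a double that is the identity on `plus` is the canonical one. -/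
theorem IsIso.eq_toDouble {t : ℕ → ℕ → BigAlg T.plusGr}
    {T' : ManinQuasiTriple K (T.plus × Module.Dual K T.plus)} (hT' : IsDouble t T')
    {F : W →ₗ[K] T.plus × Module.Dual K T.plus} (hF : IsIso T T' F)
    (hx : ∀ x : T.plus, F x = (x, 0)) : F = T.toDouble := by
  ext1 w
  rw [← sub_add_cancel w (T.proj w : W), map_add, map_add, hx, toDouble_plus]
  congr 1
  -- The image of the `minus`-part lies in plus^*, and a functional there is determined by its
  -- pairing with `plus`, which F preserves.
  have hm := T.sub_proj_mem w
  set m := w - (T.proj w : W)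
  have h1 : F m ∈ (⊥ : Submodule K T.plus).prod ⊤ := by
    rw [← hT'.minus_eq, ← hF.map_minus]
    exact Submodule.mem_map_of_mem hm
  rw [toDouble_apply, T.proj_eq_zero.2 hm]
  refine Prod.ext ((Submodule.mem_bot K).1 (Submodule.mem_prod.1 h1).1) ?_
  ext y
  have h2 := hF.map_form m y
  rw [hx, hT'.form_eq, pairing_apply] at h2
  simpa using h2

/-- Both isomorphisms are the canonical map, so both doubles carry the structure transported along
it and coincide; a solution is determined by its double. -/
theorem presents_unique {t₁ t₂ : ℕ → ℕ → BigAlg T.plusGr} (ht₁ : IsMaurerCartan T.plusGr t₁)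
    (ht₂ : IsMaurerCartan T.plusGr t₂) (h₁ : Presents T t₁) (h₂ : Presents T t₂) : t₁ = t₂ := by
  obtain ⟨T₁, hT₁, F₁, hF₁, hx₁⟩ := h₁
  obtain ⟨T₂, hT₂, F₂, hF₂, hx₂⟩ := h₂
  obtain rfl := hF₁.eq_toDouble T hT₁ hx₁
  obtain rfl := hF₂.eq_toDouble T hT₂ hx₂
  obtain rfl := hF₁.target_unique hF₂
  exact hT₁.injective ht₁ ht₂ hT₂

theorem exists_presents : ∃ t : ℕ → ℕ → BigAlg T.plusGr,
    IsMaurerCartan T.plusGr t ∧ Presents T t := by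
  let e : W ≃ₗ[K] T.plus × Module.Dual K T.plus :=
    LinearEquiv.ofBijective T.toDouble T.toDouble_bijective
  have he : e.toLinearMap = T.toDouble := rfl
  have hi := T.transport_isIso e
  rw [he] at hi
  obtain ⟨t, ht, hd⟩ := (T.transport e).exists_maurerCartan (𝒱 := T.plusGr)
    (funext fun d => (hi.map_gr d).symm.trans (T.toDouble_degree d)) (by
      refine LinearMap.ext fun x => LinearMap.ext fun y => ?_
      obtain ⟨x, rfl⟩ := T.toDouble_bijective.2 x
      obtain ⟨y, rfl⟩ := T.toDouble_bijective.2 y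
      rw [hi.map_form, toDouble_form])
    (hi.map_plus.symm.trans T.toDouble_map_plus) (hi.map_minus.symm.trans T.toDouble_map_minus)
  exact ⟨t, ht, _, hd, _, hi, T.toDouble_plus⟩

theorem isQuasiBialgebra_iff {t : ℕ → ℕ → BigAlg T.plusGr} (ht : IsMaurerCartan T.plusGr t)
    (h : Presents T t) : IsQuasiBialgebra T.plusGr t ↔ T.MinusClosed := by
  obtain ⟨T', hT', F, hF, -⟩ := h
  rw [hF.minusClosed_iff, hT'.minusClosed_iff ht]
  exact ⟨fun h => h.t_zero_two, fun h => ⟨ht, h⟩⟩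

end ManinQuasiTriple

/-! ### Isomorphisms of doubles -/

variable {V : Type v} [AddCommGroup V] [Module K V] {𝒱 : ℤ → Submodule K V} [GradedSpace 𝒱]
  {V' : Type w} [AddCommGroup V'] [Module K V'] {𝒱' : ℤ → Submodule K V'} [GradedSpace 𝒱']

/-- The map `f ⊕ (f⁻¹)^*`. -/
def dblMap (f : V ≃ₗ[K] V') : (V × Module.Dual K V) ≃ₗ[K] (V' × Module.Dual K V') :=
  f.prodCongr f.symm.dualMap

theorem dblMap_apply (f : V ≃ₗ[K] V') (u : V × Module.Dual K V) :
    dblMap f u = (f u.1, f.symm.dualMap u.2) := rfl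

variable {f : V ≃ₗ[K] V'}

theorem dblMap_mem (hf : ∀ d, (𝒱 d).map f.toLinearMap = 𝒱' d) (d : ℤ) (u : V × Module.Dual K V)
    (hu : u ∈ dblGr 𝒱 d) : dblMap f u ∈ dblGr 𝒱' d := by
  refine (mem_dblGr 𝒱').2 ⟨hf d ▸ Submodule.mem_map_of_mem ((mem_dblGr 𝒱).1 hu).1, ?_⟩
  intro b hb y hy
  rw [← hf b, mem_map_equiv] at hy
  exact ((mem_dblGr 𝒱).1 hu).2 b hb _ hy

theorem map_gradInv (hf : ∀ d, (𝒱 d).map f.toLinearMap = 𝒱' d) (x : V) :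
    gradInv 𝒱' (f x) = f (gradInv 𝒱 x) := by
  induction x using hom_induction 𝒱 with
  | h0 => simp
  | ha x y hx hy => simp only [map_add, hx, hy]
  | hh d x hx =>
    rw [gradInv_apply 𝒱 hx, gradInv_apply 𝒱' (hf d ▸ Submodule.mem_map_of_mem hx), map_zsmul]

theorem pairing_dblMap (hf : ∀ d, (𝒱 d).map f.toLinearMap = 𝒱' d) (u w : V × Module.Dual K V) :
    pairing 𝒱' (dblMap f u) (dblMap f w) = pairing 𝒱 u w := by
  simp [dblMap_apply, pairing, map_gradInv hf]

theorem map_comp {Φ : BigAlg 𝒱 →ₐ[K] BigAlg 𝒱'} (hΦ : ∀ u, Φ (gen 𝒱 u) = gen 𝒱' (dblMap f u))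
    (hf : ∀ d, (𝒱 d).map f.toLinearMap = 𝒱' d) {k l : ℕ} {d : ℤ} {F : BigAlg 𝒱}
    (hF : F ∈ comp 𝒱 k l d) : Φ F ∈ comp 𝒱' k l d := by
  induction hF using Submodule.span_induction with
  | mem P hP =>
    obtain ⟨ξ, a, x, b, hξ, hx, hab, rfl⟩ := hP
    refine Submodule.subset_span ⟨fun i => f.symm.dualMap (ξ i), a, fun j => f (x j), b,
      fun i => ((mem_dblGr 𝒱').1 (dblMap_mem hf _ _ (inr_mem_dblGr 𝒱 (hξ i)))).2,
      fun i => ((mem_dblGr 𝒱').1 (dblMap_mem hf _ _ (inl_mem_dblGr 𝒱 (hx i)))).1, hab, ?_⟩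
    rw [map_mul, map_list_prod, map_list_prod, List.map_ofFn, List.map_ofFn]
    congr 3 <;> funext i <;> simp [hΦ, dblMap_apply]
  | zero => simp
  | add x y _ _ hx hy => rw [map_add]; exact add_mem hx hy
  | smul c x _ hx => rw [map_smul]; exact Submodule.smul_mem _ _ hx

variable [Module.Finite K V] [Module.Finite K V'] {t : ℕ → ℕ → BigAlg 𝒱} {t' : ℕ → ℕ → BigAlg 𝒱'}
  {T : ManinQuasiTriple K (V × Module.Dual K V)} {T' : ManinQuasiTriple K (V' × Module.Dual K V')}

/-- An algebra map induced by an isometry of degree 0 intertwines iterated brackets, hence the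
brackets of the doubles. -/
theorem IsQBIso.isIso (ht : IsMaurerCartan 𝒱 t) (ht' : IsMaurerCartan 𝒱' t') (hT : IsDouble t T)
    (hT' : IsDouble t' T') (h : IsQBIso t t' f) :
    ManinQuasiTriple.IsIso T T' (dblMap f).toLinearMap := by
  obtain ⟨hf, Φ, hΦ, hΦt⟩ := h
  have hΦ' : ∀ u, Φ (gen 𝒱 u) = gen 𝒱' (dblMap f u) := hΦ
  refine ⟨(dblMap f).bijective, ?_, ?_, ?_, ?_, ?_⟩
  · rw [hT.gr_eq, hT'.gr_eq]
    exact map_gr_eq (dblMap f).bijective (dblMap_mem hf)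
  · rw [hT.plus_eq, hT'.plus_eq]
    ext u
    rw [mem_map_equiv]
    simp [dblMap, Submodule.mem_prod]
  · rw [hT.minus_eq, hT'.minus_eq]
    ext u
    rw [mem_map_equiv]
    simp [dblMap, Submodule.mem_prod]
  · intro x y
    rw [hT.form_eq, hT'.form_eq]
    exact pairing_dblMap hf x y
  · intro n x
    have hw : Φ (weightPart 𝒱 t (n + 1)) = weightPart 𝒱' t' (n + 1) := by
      simp only [weightPart, map_sum, hΦt]
    have key : (dblMap f).toLinearMap.compMultilinearMap (T.br n) =
        (T'.br n).compLinearMap fun _ => (dblMap f).toLinearMap := by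
      refine multilinear_ext_hom (dblGr 𝒱) fun x δ hx => gen_injective 𝒱' ?_
      rw [LinearMap.compMultilinearMap_apply, MultilinearMap.compLinearMap_apply,
        hT'.gen_br ht', LinearEquiv.coe_coe, ← hΦ', hT.gen_br ht, ← hw,
        ← map_iad hΦ' (dblMap_mem hf) (pairing_dblMap hf) (homList_ofFn 𝒱 hx), List.map_ofFn]
      rfl
    exact MultilinearMap.congr_fun key x

theorem ManinQuasiTriple.IsIso.exists_isQBIso (ht : IsMaurerCartan 𝒱 t)
    (ht' : IsMaurerCartan 𝒱' t') (hT : IsDouble t T) (hT' : IsDouble t' T')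
    {F : V × Module.Dual K V →ₗ[K] V' × Module.Dual K V'} (h : IsIso T T' F) :
    ∃ f : V ≃ₗ[K] V', IsQBIso t t' f ∧ ∀ u, F u = dblMap f u := by
  have hplus : ∀ x : V, F (x, 0) = ((F (x, 0)).1, 0) := fun x => by
    refine inl_induction ?_
    rw [← hT'.plus_eq, ← h.map_plus, hT.plus_eq]
    exact Submodule.mem_map_of_mem (by simp)
  have hbij : Function.Bijective (LinearMap.fst K V' (Module.Dual K V') ∘ₗ F ∘ₗ
      LinearMap.inl K V (Module.Dual K V)) := by
    constructor
    · intro x y hxy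
      have hxy' : (F (x, 0)).1 = (F (y, 0)).1 := hxy
      have := h.bijective.1 ((hplus x).trans (hxy' ▸ (hplus y).symm))
      exact congrArg Prod.fst this
    · intro y
      have hy : ((y, 0) : V' × Module.Dual K V') ∈ T.plus.map F := by
        rw [h.map_plus, hT'.plus_eq]; simp
      obtain ⟨u, hu, huy⟩ := hy
      rw [hT.plus_eq] at hu
      rw [SetLike.mem_coe] at hu
      rw [inl_induction hu] at huy
      exact ⟨u.1, congrArg Prod.fst huy⟩
  let f : V ≃ₗ[K] V' := LinearEquiv.ofBijective _ hbij
  have hl : ∀ x, F (x, 0) = (f x, 0) := hplus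
  -- Once F is f on V, its values on V^* are forced by preservation of the pairing.
  have hr : ∀ ξ, F (0, ξ) = (0, f.symm.dualMap ξ) := fun ξ => by
    have h1 : F (0, ξ) ∈ (⊥ : Submodule K V').prod ⊤ := by
      rw [← hT'.minus_eq, ← h.map_minus, hT.minus_eq]
      exact Submodule.mem_map_of_mem (by simp)
    refine Prod.ext ((Submodule.mem_bot K).1 (Submodule.mem_prod.1 h1).1) ?_
    ext y
    have h2 := h.map_form (0, ξ) (f.symm y, 0)
    rw [hl, hT.form_eq, hT'.form_eq, pairing_apply, pairing_apply] at h2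
    simpa using h2
  have hF : ∀ u, F u = dblMap f u := fun u => by
    rw [show u = (u.1, 0) + (0, u.2) by simp, map_add, hl, hr]
    simp [dblMap_apply]
  have hgr : ∀ d, ∀ u ∈ dblGr 𝒱 d, F u ∈ dblGr 𝒱' d := fun d u hu => by
    rw [← hT'.gr_eq, ← h.map_gr, hT.gr_eq]
    exact Submodule.mem_map_of_mem hu
  have hf : ∀ d, (𝒱 d).map f.toLinearMap = 𝒱' d := map_gr_eq f.bijective fun d x hx =>
    ((mem_dblGr 𝒱').1 (hl x ▸ hgr d _ (inl_mem_dblGr 𝒱 hx))).1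
  have hdm := dblMap_mem hf
  let Φ := mapB 𝒱 𝒱' (dblMap f).toLinearMap hdm
  have hΦ : ∀ u, Φ (gen 𝒱 u) = gen 𝒱' (dblMap f u) := mapB_gen 𝒱 𝒱' _ hdm
  have hiad : ∀ {n : ℕ} (x : Fin n → V × Module.Dual K V) (δ : Fin n → ℤ),
      (∀ i, x i ∈ dblGr 𝒱 (δ i)) → ∀ G : BigAlg 𝒱,
        iad 𝒱' (Φ G) (List.ofFn fun i => dblMap f (x i)) = Φ (iad 𝒱 G (List.ofFn x)) :=
    fun x δ hx G => by
      rw [← map_iad hΦ hdm (pairing_dblMap hf) (homList_ofFn 𝒱 hx), List.map_ofFn]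
      rfl
  -- Every homogeneous test argument is an image under `dblMap f`; the brackets with all but the
  -- last argument are the brackets of the doubles, which F matches.
  have hw : ∀ N, Φ (weightPart 𝒱 t N) = weightPart 𝒱' t' N := by
    intro N
    cases N with
    | zero => rw [weightPart_zero 𝒱 ht, weightPart_zero 𝒱' ht', map_zero]
    | succ n =>
      refine eq_of_iad 𝒱' (map_mem_wt hΦ hdm (weightPart_mem 𝒱 ht.mem _))
        (weightPart_mem 𝒱' ht'.mem _) fun y δ hy => ?_
      have hx : ∀ i, ∃ x ∈ dblGr 𝒱 (δ i), dblMap f x = y i := fun i => by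
        have := hy i
        rw [← map_gr_eq (dblMap f).bijective hdm] at this
        exact this
      choose x hx hxy using hx
      obtain rfl : (fun i => dblMap f (x i)) = y := funext hxy
      rw [ofFn_succ_last, iad_concat, iad_concat]
      congr 1
      rw [hiad (fun i : Fin n => x i.castSucc) _ (fun i => hx i.castSucc), ← hT.gen_br ht, hΦ, ← hF,
        h.map_br, hT'.gen_br ht']
      simp only [hF]
  -- The map Φ preserves bidegrees, so agreement of the weight parts is agreement of the components.
  have htt : (fun k l => Φ (t k l)) = t' :=
    comp_sum_injective 𝒱' (fun k l => map_comp hΦ hf (ht.mem k l)) ht'.mem fun N => by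
      have := hw N
      rwa [weightPart, map_sum] at this
  exact ⟨f, ⟨hf, Φ, hΦ, fun k l => congrFun (congrFun htt k) l⟩, hF⟩

end

end LInf

end

/-! ### The equivalence -/

theorem mainTheorem2 {K : Type u} [Field K] [CharZero K] :
    -- from `L_∞`-quasi-bialgebras to Manin `L_∞`-quasi-triples
    (∀ (V : Type v) [AddCommGroup V] [Module K V] [Module.Finite K V]
      (𝒱 : ℤ → Submodule K V) [GradedSpace 𝒱] (t : ℕ → ℕ → BigAlg 𝒱),
      IsQuasiBialgebra 𝒱 t → ∃ T : ManinQuasiTriple K (V × Module.Dual K V),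
        IsDouble t T ∧ T.MinusClosed ∧ ∀ T', IsDouble t T' → T' = T) ∧
    -- from Manin `L_∞`-quasi-triples to `L_∞`-quasi-bialgebras
    (∀ (W : Type v) [AddCommGroup W] [Module K W] [Module.Finite K W] (T : ManinQuasiTriple K W),
      T.MinusClosed → ∃! t : ℕ → ℕ → BigAlg T.plusGr,
        IsQuasiBialgebra T.plusGr t ∧ Presents T t) ∧
    -- the same without the conditions `t_{02} = 0` and `λ_1 (minus) ⊆ minus`
    (∀ (V : Type v) [AddCommGroup V] [Module K V] [Module.Finite K V]
      (𝒱 : ℤ → Submodule K V) [GradedSpace 𝒱] (t : ℕ → ℕ → BigAlg 𝒱),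
      IsMaurerCartan 𝒱 t → ∃! T : ManinQuasiTriple K (V × Module.Dual K V), IsDouble t T) ∧
    (∀ (W : Type v) [AddCommGroup W] [Module K W] [Module.Finite K W] (T : ManinQuasiTriple K W),
      (∃! t : ℕ → ℕ → BigAlg T.plusGr, IsMaurerCartan T.plusGr t ∧ Presents T t) ∧
      ∀ t : ℕ → ℕ → BigAlg T.plusGr, IsMaurerCartan T.plusGr t → Presents T t →
        (IsQuasiBialgebra T.plusGr t ↔ T.MinusClosed)) ∧
    -- the correspondence on isomorphisms
    (∀ (V V' : Type v) [AddCommGroup V] [Module K V] [Module.Finite K V]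
      [AddCommGroup V'] [Module K V'] [Module.Finite K V']
      (𝒱 : ℤ → Submodule K V) [GradedSpace 𝒱] (𝒱' : ℤ → Submodule K V') [GradedSpace 𝒱']
      (t : ℕ → ℕ → BigAlg 𝒱) (t' : ℕ → ℕ → BigAlg 𝒱')
      (T : ManinQuasiTriple K (V × Module.Dual K V))
      (T' : ManinQuasiTriple K (V' × Module.Dual K V')),
      IsMaurerCartan 𝒱 t → IsMaurerCartan 𝒱' t' → IsDouble t T → IsDouble t' T' →
      ∀ F : V × Module.Dual K V →ₗ[K] V' × Module.Dual K V',
        ManinQuasiTriple.IsIso T T' F ↔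
          ∃ f : V ≃ₗ[K] V', IsQBIso t t' f ∧ ∀ u, F u = (f u.1, f.symm.dualMap u.2)) := by
  refine ⟨?_, ?_, ?_, ?_, ?_⟩
  · intro V _ _ _ 𝒱 _ t ht
    obtain ⟨T, hT⟩ := ht.toIsMaurerCartan.exists_double
    exact ⟨T, hT, (hT.minusClosed_iff ht.toIsMaurerCartan).2 ht.t_zero_two,
      fun T' hT' => hT'.unique hT⟩
  · intro W _ _ _ T hc
    obtain ⟨t, ht, hp⟩ := T.exists_presents
    exact ⟨t, ⟨(T.isQuasiBialgebra_iff ht hp).2 hc, hp⟩,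
      fun t' ht' => T.presents_unique ht'.1.toIsMaurerCartan ht ht'.2 hp⟩
  · intro V _ _ _ 𝒱 _ t ht
    obtain ⟨T, hT⟩ := ht.exists_double
    exact ⟨T, hT, fun T' hT' => hT'.unique hT⟩
  · intro W _ _ _ T
    obtain ⟨t, ht, hp⟩ := T.exists_presents
    exact ⟨⟨t, ⟨ht, hp⟩, fun t' ht' => T.presents_unique ht'.1 ht ht'.2 hp⟩,
      fun t' ht' hp' => T.isQuasiBialgebra_iff ht' hp'⟩
  · intro V V' _ _ _ _ _ _ 𝒱 _ 𝒱' _ t t' T T' ht ht' hT hT' F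
    refine ⟨fun h => h.exists_isQBIso ht ht' hT hT', ?_⟩
    rintro ⟨f, hf, hF⟩
    obtain rfl : F = (dblMap f).toLinearMap := LinearMap.ext hF
    exact hf.isIso ht ht' hT hT'
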